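/- **Setting.** Let $(V,E)$ be a finite directed graph with $V\neq\emptyset$ (loops and multiple edges allowed); $i(e)$ and $t(e)$ denote the initial and terminal vertex of $e\in E$. Assume that $(V,E)$ is strongly connected: for all $v,v'\in V$ there is a directed path with at least one edge from $v$ to $v'$. For each $e\in E$ let $\psi_e(\xi)=T_e\xi+t_e$ on $\mathbb R^2$ with $t_e\in\mathbb R^2$ and $T_e=\mathrm{diag}(\pm a_e,\pm b_e)$ diagonal, $0<a_e,b_e<1$. Assume the rectangular open set condition: for every $v\in V$, the sets $\psi_e((0,1)^2)$ with $i(e)=v$ are contained in $(0,1)^2$ and pairwise disjoint. Let $(p_e)_{e\in E}$ be positive with $\sum_{i(e)=v}p_e=1$ for all $v\in V$, and let $\{\mu_v\}_{v\in V}$ be the Borel probability measures on $\mathbb R^2$ with $\mu_v=\sum_{i(e)=v}p_e\,\mu_{t(e)}\circ\psi_e^{-1}$ for all $v\in V$. Let $\mu_v^x,\mu_v^y$ be the projections of $\mu_v$ onto the $x$- and the $y$-axis. For a compactly supported Borel probability measure $\nu$ on $\mathbb R^n$ and $q\ge 0$, the $L^q$-spectrum is $\tau_\nu(q)=\lim_{\delta\to0+}\frac{\log\sum_Q\nu(Q)^q}{-\log\delta}$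 if this limit exists, where $Q$ runs over the closed cubes of the $\delta$-mesh with $\nu(Q)>0$. Fix $q\ge0$. For $x,y\in\mathbb R$ let $F_{x,y}$ be the $E\times E$ matrix with $F_{x,y}(e,e')=p_{e'}^q a_{e'}^x b_{e'}^y$ if $t(e)=i(e')$ and $0$ otherwise, and let $\rho$ denote the spectral radius. For an admissible word $w=w_1\cdots w_k$ (that is, $t(w_{j})=i(w_{j+1})$ for $1\le j<k$) put $i(w)=i(w_1)$, $t(w)=t(w_k)$, $p_w=\prod_j p_{w_j}$, $a_w=\prod_j a_{w_j}$, $b_w=\prod_j b_{w_j}$, $\alpha_1(w)=\max\{a_w,b_w\}$, $\alpha_2(w)=\min\{a_w,b_w\}$, and let $\tau_w$ be $\tau_{\mu^x_{t(w)}}(q)$ if $a_w\ge b_w$ and $\tau_{\mu^y_{t(w)}}(q)$ if $a_w<b_w$. For $s\in\mathbb R$ put $$P(s)=\lim_{k\to\infty}\Big(\sum_{w}p_w^q\,\alpha_1(w)^{\tau_w}\alpha_2(w)^{s-\tau_w}\Big)^{1/k},$$ where $w$ runs over the admissible words of length $k$. **Theorem.** The following objects are well defined: numbers $\tau_A,\tau_B\in\mathbb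 R$ such that for all $v\in V$ the $L^q$-spectra of $\mu_v^x$ and $\mu_v^y$ at $q$ exist and equal $\tau_A$ and $\tau_B$, respectively; the unique $\gamma_A,\gamma_B\in\mathbb R$ with $\rho(F_{\tau_A,\gamma_A-\tau_A})=1$ and $\rho(F_{\gamma_B-\tau_B,\tau_B})=1$; for each $x\in\mathbb R$ the unique $y(x)\in\mathbb R$ with $\rho(F_{x,y(x)})=1$, and the unique vector $f(x)=(v_e(x)u_e(x))_{e\in E}$ where $u(x)$ is a positive column vector with $F_{x,y(x)}u(x)=u(x)$ and $\sum_e u_e(x)=1$, and $v(x)$ is a positive row vector with $v(x)F_{x,y(x)}=v(x)$ and $\sum_e v_e(x)u_e(x)=1$; the limit $P(s)$ for every $s\in\mathbb R$, and the unique $\gamma\in\mathbb R$ with $P(\gamma)=1$. For every $v\in V$ the $L^q$-spectrum of $\mu_v$ at $q$ exists and $\tau_{\mu_v}(q)=\gamma$. Put $t=\tau_A+\tau_B$. Then either $\max\{\gamma_A,\gamma_B\}\le t$ or $\min\{\gamma_A,\gamma_B\}\ge t$, and: (a) If $\max\{\gamma_A,\gamma_B\}\le t$, then $$\gamma=\max\{\gamma_A,\gamma_B\}=\max\{x+y:\rho(F_{x,y})=1,\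 \gamma_B-\tau_B\le x\le\tau_A\}=\max\{x+y:\rho(F_{x,y})=1,\ \gamma_A-\tau_A\le y\le\tau_B\}.$$ (b) If $\min\{\gamma_A,\gamma_B\}\ge t$, then $$\gamma=\min\{x+y:\rho(F_{x,y})=1,\ \tau_A\le x\le\gamma_B-\tau_B\}=\min\{x+y:\rho(F_{x,y})=1,\ \tau_B\le y\le\gamma_A-\tau_A\}.$$ Moreover: (b1) if $\sum_{e\in E}f_e(\tau_A)\log(a_e/b_e)\ge0$, then $\gamma=\gamma_A$; (b2) if $\sum_{e\in E}f_e(\gamma_B-\tau_B)\log(a_e/b_e)\le0$, then $\gamma=\gamma_B$; (b3) if neither of these two inequalities holds, there are $x\in[\tau_A,\gamma_B-\tau_B]$ and $y\in[\tau_B,\gamma_A-\tau_A]$ with $\rho(F_{x,y})=1$, $\sum_{e\in E}f_e(x)\log(a_e/b_e)=0$ and $\gamma=x+y$. -/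

import Mathlib

open Filter Topology MeasureTheory Matrix

noncomputable section

/-! ### `L^q`-spectra of measures on `ℝⁿ` -/

/-- The closed cube of the `δ`-mesh of `ℝⁿ` with index `k ∈ ℤⁿ`. -/
def meshCube {n : ℕ} (δ : ℝ) (k : Fin n → ℤ) : Set (Fin n → ℝ) :=
  {ξ | ∀ i, δ * (k i : ℝ) ≤ ξ i ∧ ξ i ≤ δ * ((k i : ℝ) + 1)}

open Classical in
/-- The moment sum `∑_Q ν(Q)^q` over the cubes of the `δ`-mesh. Cubes of measure zero contribute
nothing, also for `q = 0` (so that the case `q = 0` counts the cubes of positive measure). -/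
def momentSum {n : ℕ} (ν : Measure (Fin n → ℝ)) (q δ : ℝ) : ENNReal :=
  ∑' k : Fin n → ℤ, if ν (meshCube δ k) = 0 then 0 else ν (meshCube δ k) ^ q

/-- The quotient `log (∑_Q ν(Q)^q) / (- log δ)`. -/
def lqQuotient {n : ℕ} (ν : Measure (Fin n → ℝ)) (q δ : ℝ) : ℝ :=
  Real.log (momentSum ν q δ).toReal / (-Real.log δ)

/-- The `L^q`-spectrum of `ν` exists at `q` and is the real number `τ`, i.e. the upper and the lower
limit of the quotient as `δ → 0+` are both equal to `τ`. -/
def HasLqSpectrum {n : ℕ} (ν : Measure (Fin n → ℝ)) (q τ : ℝ) : Prop :=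
  Tendsto (lqQuotient ν q) (𝓝[>] 0) (𝓝 τ)

/-- The value of the `L^q`-spectrum of `ν` at `q` (meaningful if the spectrum exists there). -/
def lqSpectrum {n : ℕ} (ν : Measure (Fin n → ℝ)) (q : ℝ) : ℝ :=
  limUnder (𝓝[>] (0 : ℝ)) (lqQuotient ν q)

/-- The projection of a planar measure onto the `j`-th coordinate axis (`0` is the `x`-axis and `1`
the `y`-axis), as a measure on `ℝ¹`. -/
def projMeasure (ν : Measure (Fin 2 → ℝ)) (j : Fin 2) : Measure (Fin 1 → ℝ) :=
  ν.map fun ξ _ => ξ j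

/-! ### Spectral radius and Perron vectors -/

/-- The spectral radius of a real square matrix: the largest modulus of a complex eigenvalue. -/
def specRadius {E : Type*} [Fintype E] [DecidableEq E] (M : Matrix E E ℝ) : ENNReal :=
  spectralRadius ℂ (M.map (algebraMap ℝ ℂ))

/-- `f = (v_e u_e)_e`, where `u` is the right Perron vector of `M` (positive, of unit `ℓ¹` norm,
with `M u = u`) and `v` is the left Perron vector (positive, with `v M = v` and
`∑_e v_e u_e = 1`). Meant for irreducible nonnegative matrices of spectral radius one. -/
def IsPerronProduct {E : Type*} [Fintype E] (M : Matrix E E ℝ) (f : E → ℝ) : Prop :=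
  ∃ u v : E → ℝ, (∀ e, 0 < u e) ∧ (∀ e, 0 < v e) ∧ ∑ e, u e = 1 ∧
    M *ᵥ u = u ∧ v ᵥ* M = v ∧ ∑ e, v e * u e = 1 ∧ ∀ e, f e = v e * u e

/-! ### Planar box-like self-affine graph-directed iterated function systems -/

/-- A planar box-like self-affine GIFS over a directed graph with vertex set `V` and edge set `E`
(loops and multiple edges allowed): for every edge `e` an affine map `ξ ↦ T_e ξ + t_e` of the plane
with `T_e` equal to `(±a_e, 0; 0, ±b_e)` or `(0, ±a_e; ±b_e, 0)`, where `0 < a_e, b_e < 1`. -/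
structure BoxLikeGIFS (V E : Type*) where
  /-- initial vertex of an edge -/
  src : E → V
  /-- terminal vertex of an edge -/
  tgt : E → V
  /-- linear part -/
  T : E → Matrix (Fin 2) (Fin 2) ℝ
  /-- translation part -/
  trans : E → Fin 2 → ℝ
  /-- modulus of the nonzero entry in the first row of the linear part -/
  a : E → ℝ
  /-- modulus of the nonzero entry in the second row of the linear part -/
  b : E → ℝ
  a_pos : ∀ e, 0 < a e
  a_lt_one : ∀ e, a e < 1
  b_pos : ∀ e, 0 < b e
  b_lt_one : ∀ e, b e < 1
  boxLike : ∀ e,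
    (|T e 0 0| = a e ∧ T e 0 1 = 0 ∧ T e 1 0 = 0 ∧ |T e 1 1| = b e) ∨
    (T e 0 0 = 0 ∧ |T e 0 1| = a e ∧ |T e 1 0| = b e ∧ T e 1 1 = 0)

namespace BoxLikeGIFS

variable {V E : Type*} (G : BoxLikeGIFS V E)

/-- The contraction of an edge. -/
def psi (e : E) (ξ : Fin 2 → ℝ) : Fin 2 → ℝ := G.T e *ᵥ ξ + G.trans e

/-- Any two vertices (equal or not) are joined by a directed path with at least one edge. -/
def StronglyConnected : Prop :=
  ∀ v v' : V, Relation.TransGen (fun x y => ∃ e, G.src e = x ∧ G.tgt e = y) v v'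

/-- The open unit square. -/
def openSquare : Set (Fin 2 → ℝ) := {ξ | ∀ i, 0 < ξ i ∧ ξ i < 1}

/-- Rectangular open set condition. -/
def ROSC : Prop :=
  (∀ e, G.psi e '' openSquare ⊆ openSquare) ∧
  ∀ e e', G.src e = G.src e' → e ≠ e' →
    Disjoint (G.psi e '' openSquare) (G.psi e' '' openSquare)

/-- A positive vector on the edges whose entries sum to one over the edges leaving each vertex. -/
def IsProbVector [Fintype E] [DecidableEq V] (p : E → ℝ) : Prop :=
  (∀ e, 0 < p e) ∧ ∀ v, ∑ e with G.src e = v, p e = 1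

/-- The graph-directed self-affine measure family associated with `p`: Borel probability measures
with `μ_v = ∑_{e : i(e) = v} p_e · (μ_{t(e)} ∘ ψ_e⁻¹)` for every vertex `v`. -/
def IsMeasureFamily [Fintype E] [DecidableEq V] (p : E → ℝ)
    (μ : V → Measure (Fin 2 → ℝ)) : Prop :=
  (∀ v, IsProbabilityMeasure (μ v)) ∧
  ∀ v, μ v = ∑ e with G.src e = v, ENNReal.ofReal (p e) • (μ (G.tgt e)).map (G.psi e)

/-- The matrix `F^{(q)}_{x,y}`, indexed by edges. -/
def F [DecidableEq V] (p : E → ℝ) (q x y : ℝ) : Matrix E E ℝ :=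
  Matrix.of fun e e' => if G.tgt e = G.src e' then p e' ^ q * G.a e' ^ x * G.b e' ^ y else 0

/-! ### The pressure function -/

/-- Admissibility of a word of `k + 1` edges. -/
def Admissible {k : ℕ} (w : Fin (k + 1) → E) : Prop :=
  ∀ i : Fin k, G.tgt (w i.castSucc) = G.src (w i.succ)

/-- The linear part `T_{w_1} ⋯ T_{w_k}` of the map of a word. -/
def wordT {k : ℕ} (w : Fin k → E) : Matrix (Fin 2) (Fin 2) ℝ :=
  (List.ofFn fun i => G.T (w i)).prod

/-- The width (`j = 0`) and the height (`j = 1`) of the image of the unit square under an affine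
map with linear part `T`. -/
def side (T : Matrix (Fin 2) (Fin 2) ℝ) (j : Fin 2) : ℝ := |T j 0| + |T j 1|

/-- The singular values of a `2 × 2` matrix in decreasing order, numbered from zero. -/
def singVal (T : Matrix (Fin 2) (Fin 2) ℝ) (i : ℕ) : ℝ :=
  (Matrix.toEuclideanLin T).singularValues i

open Classical in
/-- The coordinate axis that the linear part `T` of a word maps to the direction of the longest side
of the image rectangle. -/
def longAxis (T : Matrix (Fin 2) (Fin 2) ℝ) : Fin 2 :=
  if T.IsDiag then (if side T 1 ≤ side T 0 then 0 else 1)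
  else (if side T 1 ≤ side T 0 then 1 else 0)

/-- `τ_w(q)`: the value at `q` of the `L^q`-spectrum of the projection of `μ_{t(w)}` onto the axis
belonging to the longest side of the rectangle of the word `w`. -/
def wordTau (μ : V → Measure (Fin 2 → ℝ)) (q : ℝ) {k : ℕ} (w : Fin (k + 1) → E) : ℝ :=
  lqSpectrum (projMeasure (μ (G.tgt (w (Fin.last k)))) (longAxis (G.wordT w))) q

/-- The modified singular value function `p_w^q α₁(w)^{τ_w(q)} α₂(w)^{s - τ_w(q)}`. -/
def phi (p : E → ℝ) (μ : V → Measure (Fin 2 → ℝ)) (s q : ℝ) {k : ℕ}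
    (w : Fin (k + 1) → E) : ℝ :=
  (∏ i, p (w i)) ^ q * singVal (G.wordT w) 0 ^ G.wordTau μ q w *
    singVal (G.wordT w) 1 ^ (s - G.wordTau μ q w)

open Classical in
/-- The modified singular value function matrices `A_k^{s,q}`: the entry at `(v, v')` is the sum of
`φ^{s,q}(w)` over the admissible words `w` of length `k` from `v` to `v'`; `A_0` is the identity. -/
def modMatrix [Fintype E] (p : E → ℝ) (μ : V → Measure (Fin 2 → ℝ)) (s q : ℝ) :
    ℕ → Matrix V V ℝ
  | 0 => 1
  | k + 1 => Matrix.of fun v v' =>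
      ∑ w : Fin (k + 1) → E with
        G.Admissible w ∧ G.src (w 0) = v ∧ G.tgt (w (Fin.last k)) = v', G.phi p μ s q w

/-- `‖A_k^{s,q}‖^{1/k}`, with the entrywise `1`-norm. -/
def pressureSeq [Fintype V] [Fintype E] (p : E → ℝ) (μ : V → Measure (Fin 2 → ℝ)) (s q : ℝ)
    (k : ℕ) : ℝ :=
  (∑ v, ∑ v', |G.modMatrix p μ s q k v v'|) ^ (1 / (k : ℝ))

/-- The pressure `P(s,q) = lim_k ‖A_k^{s,q}‖^{1/k}`. -/
def pressure [Fintype V] [Fintype E] (p : E → ℝ) (μ : V → Measure (Fin 2 → ℝ)) (s q : ℝ) : ℝ :=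
  limUnder atTop (G.pressureSeq p μ s q)

end BoxLikeGIFS

end

noncomputable section

/-! ### Perron-Frobenius theory of irreducible nonnegative matrices -/

section Perron

variable {E : Type*} [Fintype E]

/-! Cut `μ v` along a section: a finite maximal antichain of words, here those whose rectangles have
short side comparable to δ. At scale δ the piece of a word w is a thin strip. Its moment sum is
therefore p_w^q times that of the projection of μ_{t(w)} onto the axis of the long side at scale
δ/α₁(w), that is about p_w^q (α₁(w)/δ)^{τ_w}. Since α₂(w) is comparable to δ, this is δ^{-s} φ^s(w)
for every s, up to factors δ^{±ε}, where φ^s is the modified singular value function. By the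
rectangular open set condition each mesh square meets boundedly many pieces
(`exists_packing_bound`). So the moment sum of `μ v` is about δ^{-s} times the sum of φ^s over the
section, and the spectrum is the s for which these sums have exponential growth rate zero in the
word length (`hasLqSpectrum_of_growthRate_eq_zero`). The sections of all words of length k give the
pressure, with the same rate.

The rate is found in `exists_growth_rate`. Sums over sections of the multiplicative weights p^q a^x
b^y grow like the spectral radius of F_{x,y}, because a Perron vector gives a harmonic function on
the vertices. The function φ^s chooses between the weights with (x, y) = (τ_A, s - τ_A) and (s -
τ_B, τ_B). For s ≤ τ_A + τ_B it is the larger of the two, and its rate is the maximum of their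
rates. For s ≥ τ_A + τ_B it is the smaller one. Then every weight with y = s - x and x in [τ_A, s -
τ_B] bounds it from above, and the rate is the minimum of log ρ(F_{x,s-x}) over this interval: at a
minimizer, words whose log(a/b) deviates too far to the harmful side are rare by exponential
tilting, and on the other words φ^s and the weight differ by at most exp(ε length).

All facts on log ρ(F_{x,y}) come from one inequality (`log_perronRoot_sub_ge`): the means of log a
and log b under the product of the Perron vectors form a subgradient. Hence the function is convex,
Lipschitz and strictly decreasing, and the formulas for γ become plane geometry of the curve ρ = 1
and the antidiagonals (`exists_variational_formula`).

The spectra of the projections exist by Fekete's lemma. Jensen's inequality inside the cells of a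
coarse mesh makes the moment sums almost submultiplicative for q ≥ 1 and almost supermultiplicative
for q ≤ 1, without any separation on the line (`exists_mul_bound`). -/

theorem mulVec_mono_right {M : Matrix E E ℝ} (hM : ∀ i j, 0 ≤ M i j) {u w : E → ℝ} (h : u ≤ w) :
    M *ᵥ u ≤ M *ᵥ w := fun i =>
  Finset.sum_le_sum fun j _ => mul_le_mul_of_nonneg_left (h j) (hM i j)

variable [DecidableEq E]

theorem pow_nonneg_entry {M : Matrix E E ℝ} (hM : ∀ i j, 0 ≤ M i j) (k : ℕ) (i j : E) :
    0 ≤ (M ^ k) i j := by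
  induction k generalizing i j with
  | zero => rw [pow_zero, one_apply]; split_ifs <;> norm_num
  | succ k ih =>
    rw [pow_succ, mul_apply]
    exact Finset.sum_nonneg fun l _ => mul_nonneg (ih i l) (hM l j)

theorem Matrix.IsIrreducible.exists_pow_pos {M : Matrix E E ℝ} (hM : M.IsIrreducible) (i j : E) :
    ∃ k > 0, 0 < (M ^ k) i j :=
  (isIrreducible_iff_exists_pow_pos hM.nonneg).1 hM i j

theorem Matrix.IsIrreducible.exists_entry_pos {M : Matrix E E ℝ} (hM : M.IsIrreducible) (i : E) :
    ∃ j, 0 < M i j := by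
  obtain ⟨k, hk, h⟩ := hM.exists_pow_pos i i
  by_contra! hcon
  have h0 : ∀ j, M i j = 0 := fun j => le_antisymm (hcon j) (hM.nonneg i j)
  obtain ⟨m, rfl⟩ := Nat.exists_eq_succ_of_ne_zero hk.ne'
  rw [pow_succ', mul_apply] at h
  simp [h0] at h

/-- A nonzero nonnegative vector with `M z ≤ t z` is positive if `M` is irreducible. -/
theorem Matrix.IsIrreducible.pos_of_mulVec_le {M : Matrix E E ℝ} (hM : M.IsIrreducible)
    {t : ℝ} (ht : 0 ≤ t) {z : E → ℝ} (hz : 0 ≤ z) (hz0 : z ≠ 0) (h : M *ᵥ z ≤ t • z) (i : E) :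
    0 < z i := by
  obtain ⟨j, hj⟩ : ∃ j, z j ≠ 0 := by
    by_contra! hcon; exact hz0 (funext hcon)
  have hj' : 0 < z j := lt_of_le_of_ne (hz j) (Ne.symm hj)
  -- Iterating the inequality lets a positive entry of z at j reach i through a positive entry of
  -- some power of M.
  have key : ∀ k : ℕ, (M ^ k) *ᵥ z ≤ t ^ k • z := by
    intro k
    induction k with
    | zero => simp
    | succ k ih =>
      rw [pow_succ', ← mulVec_mulVec]
      refine (mulVec_mono_right hM.nonneg ih).trans ?_
      rw [mulVec_smul, pow_succ, mul_smul]
      exact smul_le_smul_of_nonneg_left h (pow_nonneg ht k)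
  obtain ⟨k, -, hk⟩ := hM.exists_pow_pos i j
  have h1 : 0 < ((M ^ k) *ᵥ z) i := by
    refine lt_of_lt_of_le (mul_pos hk hj') ?_
    exact Finset.single_le_sum (f := fun l => (M ^ k) i l * z l)
      (fun l _ => mul_nonneg (pow_nonneg_entry hM.nonneg k i l) (hz l)) (Finset.mem_univ j)
  have h2 := h1.trans_le (key k i)
  simp only [Pi.smul_apply, smul_eq_mul] at h2
  exact (pos_iff_pos_of_mul_pos h2).1 (by
    by_contra hcon
    have : t ^ k = 0 := le_antisymm (not_lt.1 hcon) (pow_nonneg ht k)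
    simp [this] at h2)

/-- A polynomial in `M` with positive entries. -/
theorem Matrix.IsIrreducible.exists_sum_pow_pos {M : Matrix E E ℝ} (hM : M.IsIrreducible) :
    ∃ N : ℕ, ∀ i j, 0 < (∑ k ∈ Finset.range N, M ^ k) i j := by
  choose k _ hk using hM.exists_pow_pos
  refine ⟨(∑ i, ∑ j, k i j) + 1, fun i j => ?_⟩
  rw [Matrix.sum_apply]
  refine lt_of_lt_of_le (hk i j) (Finset.single_le_sum (f := fun l => (M ^ l) i j)
    (fun l _ => pow_nonneg_entry hM.nonneg l i j) ?_)
  rw [Finset.mem_range]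
  have h1 : k i j ≤ ∑ j, k i j := Finset.single_le_sum (f := fun j => k i j)
    (fun _ _ => Nat.zero_le _) (Finset.mem_univ j)
  have h2 : ∑ j, k i j ≤ ∑ i, ∑ j, k i j := Finset.single_le_sum (f := fun i => ∑ j, k i j)
    (fun _ _ => Nat.zero_le _) (Finset.mem_univ i)
  omega

/-- Existence of a positive eigenvector of an irreducible matrix. -/
theorem Matrix.IsIrreducible.exists_eigenvector [Nonempty E] {M : Matrix E E ℝ}
    (hM : M.IsIrreducible) :
    ∃ t : ℝ, 0 < t ∧ ∃ u ∈ stdSimplex ℝ E, (∀ e, 0 < u e) ∧ M *ᵥ u = t • u := by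
  classical
  set C := ∑ i, ∑ j, M i j with hC
  have hMC : ∀ u ∈ stdSimplex ℝ E, ∑ i, (M *ᵥ u) i ≤ C := by
    intro u hu
    refine Finset.sum_le_sum fun i _ => Finset.sum_le_sum fun j _ => ?_
    have : u j ≤ 1 := by
      rw [← hu.2]; exact Finset.single_le_sum (fun l _ => hu.1 l) (Finset.mem_univ j)
    exact mul_le_of_le_one_right (hM.nonneg i j) this
  have hC0 : 0 ≤ C := Finset.sum_nonneg fun i _ => Finset.sum_nonneg fun j _ => hM.nonneg i j
  -- Collatz–Wielandt: the Perron root is the largest t with t u ≤ M u for some u in the simplex.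
  -- Summing the entries gives t ≤ C, so the cut-off at C loses nothing and makes the set compact.
  set K : Set (ℝ × (E → ℝ)) := (Set.Icc 0 C ×ˢ stdSimplex ℝ E) ∩
    {z | ∀ i, z.1 * z.2 i ≤ (M *ᵥ z.2) i} with hK
  have hKc : IsCompact K := by
    refine (isCompact_Icc.prod (isCompact_stdSimplex ℝ E)).inter_right ?_
    simp only [Set.ofPred_forall]
    refine isClosed_iInter fun i => isClosed_le (by fun_prop) ?_
    have : Continuous fun z : ℝ × (E → ℝ) => M *ᵥ z.2 :=
      Continuous.matrix_mulVec continuous_const continuous_snd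
    exact (continuous_apply i).comp this
  have hKne : K.Nonempty := by
    obtain ⟨i₀⟩ := ‹Nonempty E›
    refine ⟨(0, Pi.single i₀ 1), ⟨⟨⟨le_rfl, hC0⟩, single_mem_stdSimplex ℝ i₀⟩, fun i => ?_⟩⟩
    simp only [zero_mul]
    refine Finset.sum_nonneg fun j _ => mul_nonneg (hM.nonneg i j) ?_
    exact (single_mem_stdSimplex ℝ i₀).1 j
  obtain ⟨⟨t, u⟩, htu, hmax⟩ := hKc.exists_isMaxOn hKne (f := Prod.fst) continuous_fst.continuousOn
  obtain ⟨⟨⟨ht0, htC⟩, hu⟩, hle⟩ := htu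
  simp only at ht0 htC hu hle
  obtain ⟨N, hN⟩ := hM.exists_sum_pow_pos
  set B := ∑ k ∈ Finset.range N, M ^ k with hB
  have hBM : B * M = M * B := by
    rw [hB, Finset.sum_mul, Finset.mul_sum]
    exact Finset.sum_congr rfl fun k _ => by rw [← pow_succ, ← pow_succ']
  have hBpos : ∀ z : E → ℝ, 0 ≤ z → z ≠ 0 → ∀ i, 0 < (B *ᵥ z) i := by
    intro z hz hz0 i
    obtain ⟨j, hj⟩ : ∃ j, z j ≠ 0 := by
      by_contra! hcon; exact hz0 (funext hcon)
    exact Finset.sum_pos' (fun l _ => mul_nonneg (hN i l).le (hz l))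
      ⟨j, Finset.mem_univ j, mul_pos (hN i j) (lt_of_le_of_ne (hz j) (Ne.symm hj))⟩
  have hu0 : u ≠ 0 := by
    rintro rfl
    simpa using hu.2
  -- If M u - t u were not zero, the positive matrix B would make it strictly positive. As B
  -- commutes with M, the vector w = B u satisfies t w < M w in every entry, and t could be
  -- increased.
  have heq : M *ᵥ u = t • u := by
    by_contra hne
    set d := M *ᵥ u - t • u with hd
    have hd0 : 0 ≤ d := fun i => by
      simpa [hd] using hle i
    have hdpos := hBpos d hd0 (sub_ne_zero.2 hne)
    have hwpos := hBpos u hu.1 hu0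
    set w := B *ᵥ u with hw
    have hMw : ∀ i, t * w i < (M *ᵥ w) i := by
      intro i
      have h1 := hdpos i
      rw [hd, mulVec_sub, mulVec_smul, mulVec_mulVec, hBM, ← mulVec_mulVec] at h1
      simpa [hw] using h1
    obtain ⟨i₁, -, hi₁⟩ := Finset.exists_min_image Finset.univ (fun i => (M *ᵥ w) i / w i)
      Finset.univ_nonempty
    set t' := (M *ᵥ w) i₁ / w i₁ with ht'
    have htt' : t < t' := by rw [ht', lt_div_iff₀ (hwpos i₁)]; exact hMw i₁
    have hws : 0 < ∑ i, w i := Finset.sum_pos (fun i _ => hwpos i) Finset.univ_nonempty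
    set w' := (∑ i, w i)⁻¹ • w with hw'
    have hw's : w' ∈ stdSimplex ℝ E := by
      refine ⟨fun i => mul_nonneg (inv_nonneg.2 hws.le) (hwpos i).le, ?_⟩
      simp only [hw', Pi.smul_apply, smul_eq_mul, ← Finset.mul_sum]
      exact inv_mul_cancel₀ hws.ne'
    have hw'le : ∀ i, t' * w' i ≤ (M *ᵥ w') i := by
      intro i
      have h1 := hi₁ i (Finset.mem_univ i)
      rw [le_div_iff₀ (hwpos i)] at h1
      rw [hw', mulVec_smul]
      simp only [Pi.smul_apply, smul_eq_mul]
      rw [mul_left_comm]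
      exact mul_le_mul_of_nonneg_left h1 (inv_nonneg.2 hws.le)
    have ht'C : t' ≤ C := by
      refine le_trans ?_ (hMC w' hw's)
      calc t' = t' * ∑ i, w' i := by rw [hw's.2, mul_one]
        _ = ∑ i, t' * w' i := Finset.mul_sum ..
        _ ≤ _ := Finset.sum_le_sum fun i _ => hw'le i
    have := hmax (a := (t', w')) ⟨⟨⟨ht0.trans htt'.le, ht'C⟩, hw's⟩, hw'le⟩
    exact absurd htt' (not_lt.2 this)
  have hupos := hM.pos_of_mulVec_le ht0 hu.1 hu0 heq.le
  refine ⟨t, ?_, u, hu, hupos, heq⟩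
  obtain ⟨i⟩ := ‹Nonempty E›
  obtain ⟨j, hj⟩ := hM.exists_entry_pos i
  have h1 : 0 < (M *ᵥ u) i := Finset.sum_pos'
    (fun l _ => mul_nonneg (hM.nonneg i l) (hupos l).le) ⟨j, Finset.mem_univ j, mul_pos hj (hupos j)⟩
  rw [heq] at h1
  exact pos_of_mul_pos_left h1 (hupos i).le

/-- The spectral radius of a nonnegative matrix with a positive eigenvector. -/
theorem specRadius_eq_of_eigenvector [Nonempty E] {M : Matrix E E ℝ} (hM : ∀ i j, 0 ≤ M i j)
    {t : ℝ} (ht : 0 ≤ t) {u : E → ℝ} (hu : ∀ e, 0 < u e) (h : M *ᵥ u = t • u) :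
    specRadius M = ENNReal.ofReal t := by
  have hmem : ∀ k : ℂ, k ∈ spectrum ℂ (M.map (algebraMap ℝ ℂ)) ↔
      ∃ z : E → ℂ, z ≠ 0 ∧ (M.map (algebraMap ℝ ℂ)) *ᵥ z = k • z := by
    intro k
    rw [spectrum.mem_iff, isUnit_iff_isUnit_det, isUnit_iff_ne_zero, not_not,
      ← exists_mulVec_eq_zero_iff]
    refine exists_congr fun z => and_congr_right fun _ => ?_
    rw [sub_mulVec, sub_eq_zero, eq_comm, algebraMap_eq_diagonal]
    refine Eq.congr_right ?_
    ext i
    simp [mulVec_diagonal]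
  apply le_antisymm
  · refine iSup₂_le fun k hk => ?_
    obtain ⟨z, hz, hkz⟩ := (hmem k).1 hk
    -- Where |z_i|/u_i is largest, the vector of moduli is dominated by a multiple of u touching it
    -- at i, and M u = t u bounds |k| by t.
    obtain ⟨i, -, hi⟩ := Finset.exists_max_image Finset.univ (fun i => ‖z i‖ / u i)
      Finset.univ_nonempty
    have hzi : 0 < ‖z i‖ := by
      by_contra hcon
      apply hz
      funext j
      have h1 := hi j (Finset.mem_univ j)
      have h0 : ‖z i‖ = 0 := le_antisymm (not_lt.1 hcon) (norm_nonneg _)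
      rw [h0, zero_div, div_le_iff₀ (hu j), zero_mul] at h1
      exact norm_le_zero_iff.1 h1
    have h2 : ‖k‖ * ‖z i‖ ≤ t * ‖z i‖ := by
      have h3 := congrFun hkz i
      simp only [Pi.smul_apply, smul_eq_mul] at h3
      rw [← norm_mul, ← h3]
      calc ‖∑ j, (M.map (algebraMap ℝ ℂ)) i j * z j‖
          ≤ ∑ j, ‖(M.map (algebraMap ℝ ℂ)) i j * z j‖ := norm_sum_le _ _
        _ = ∑ j, M i j * ‖z j‖ := by
            refine Finset.sum_congr rfl fun j _ => ?_
            rw [norm_mul]; simp [abs_of_nonneg (hM i j)]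
        _ ≤ ∑ j, M i j * (‖z i‖ / u i * u j) := by
            refine Finset.sum_le_sum fun j _ => mul_le_mul_of_nonneg_left ?_ (hM i j)
            rw [← div_le_iff₀ (hu j)]
            exact hi j (Finset.mem_univ j)
        _ = ‖z i‖ / u i * (M *ᵥ u) i := by
            rw [mulVec, dotProduct, Finset.mul_sum]
            exact Finset.sum_congr rfl fun j _ => by ring
        _ = t * ‖z i‖ := by
            rw [h, Pi.smul_apply, smul_eq_mul]
            field_simp [(hu i).ne']
    have h4 : ‖k‖ ≤ t := le_of_mul_le_mul_right h2 hzi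
    rw [ENNReal.ofReal, ENNReal.coe_le_coe]
    exact NNReal.le_toNNReal_of_coe_le h4
  · have h1 : ((t : ℂ)) ∈ spectrum ℂ (M.map (algebraMap ℝ ℂ)) := by
      refine (hmem _).2 ⟨fun e => (u e : ℂ), ?_, ?_⟩
      · intro h0
        obtain ⟨i⟩ := ‹Nonempty E›
        have := congrFun h0 i
        simp [(hu i).ne'] at this
      · ext i
        have h2 := congrFun h i
        simp only [mulVec, dotProduct, Pi.smul_apply, smul_eq_mul] at h2 ⊢
        rw [← Complex.ofReal_mul, ← h2]
        push_cast
        rfl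
    refine le_trans ?_ (le_iSup₂ (f := fun k (_ : k ∈ spectrum ℂ (M.map (algebraMap ℝ ℂ))) =>
      (‖k‖₊ : ENNReal)) (t : ℂ) h1)
    rw [ENNReal.ofReal, ENNReal.coe_le_coe]
    refine NNReal.coe_le_coe.1 ?_
    simp [ht, abs_of_nonneg ht]

/-- The spectral radius as a real number. -/
def perronRoot (M : Matrix E E ℝ) : ℝ := (specRadius M).toReal

theorem perronRoot_eq_of_eigenvector [Nonempty E] {M : Matrix E E ℝ} (hM : ∀ i j, 0 ≤ M i j)
    {t : ℝ} (ht : 0 ≤ t) {u : E → ℝ} (hu : ∀ e, 0 < u e) (h : M *ᵥ u = t • u) :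
    perronRoot M = t := by
  rw [perronRoot, specRadius_eq_of_eigenvector hM ht hu h, ENNReal.toReal_ofReal ht]

theorem Matrix.IsIrreducible.perron [Nonempty E] {M : Matrix E E ℝ} (hM : M.IsIrreducible) :
    0 < perronRoot M ∧ specRadius M = ENNReal.ofReal (perronRoot M) ∧
      ∃ u ∈ stdSimplex ℝ E, (∀ e, 0 < u e) ∧ M *ᵥ u = perronRoot M • u := by
  obtain ⟨t, ht, u, hu, hpos, h⟩ := hM.exists_eigenvector
  have h1 := perronRoot_eq_of_eigenvector hM.nonneg ht.le hpos h
  rw [h1]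
  exact ⟨ht, specRadius_eq_of_eigenvector hM.nonneg ht.le hpos h, u, hu, hpos, h⟩

/-- Uniqueness of the normalized Perron eigenvector. -/
theorem Matrix.IsIrreducible.eigenvector_unique [Nonempty E] {M : Matrix E E ℝ}
    (hM : M.IsIrreducible) {u w : E → ℝ} (hu : u ∈ stdSimplex ℝ E) (hw : w ∈ stdSimplex ℝ E)
    (hMu : M *ᵥ u = perronRoot M • u) (hMw : M *ᵥ w = perronRoot M • w) : u = w := by
  have ht := hM.perron.1.le
  have hu0 : u ≠ 0 := by rintro rfl; simpa using hu.2
  have hupos := hM.pos_of_mulVec_le ht hu.1 hu0 hMu.le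
  -- c is the largest factor with c u ≤ w. The vector w - c u is a nonnegative eigenvector with a
  -- zero entry, hence zero by `pos_of_mulVec_le`.
  obtain ⟨i, -, hi⟩ := Finset.exists_min_image Finset.univ (fun i => w i / u i)
      Finset.univ_nonempty
  set c := w i / u i with hc
  set z := w - c • u with hz
  have hz0 : 0 ≤ z := fun j => by
    have := hi j (Finset.mem_univ j)
    rw [le_div_iff₀ (hupos j)] at this
    simpa [hz] using this
  have hzi : z i = 0 := by
    simp [hz, hc, (hupos i).ne']
  have hMz : M *ᵥ z = perronRoot M • z := by
    rw [hz, mulVec_sub, mulVec_smul, hMu, hMw, smul_sub, smul_comm]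
  have hzz : z = 0 := by
    by_contra hne
    exact (hM.pos_of_mulVec_le ht hz0 hne hMz.le i).ne' hzi
  have hwc : w = c • u := sub_eq_zero.1 hzz
  have hc1 : c = 1 := by
    have := hw.2
    rw [hwc] at this
    simpa [← Finset.mul_sum, hu.2] using this
  rw [hwc, hc1, one_smul]

/-- The normalized right Perron vector of an irreducible matrix (`0` for other matrices). -/
def perronVec (M : Matrix E E ℝ) : E → ℝ :=
  open Classical in
  if h : ∃ u ∈ stdSimplex ℝ E, (∀ e, 0 < u e) ∧ M *ᵥ u = perronRoot M • u then h.choose else 0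

theorem Matrix.IsIrreducible.perronVec_spec [Nonempty E] {M : Matrix E E ℝ}
    (hM : M.IsIrreducible) : perronVec M ∈ stdSimplex ℝ E ∧ (∀ e, 0 < perronVec M e) ∧
      M *ᵥ perronVec M = perronRoot M • perronVec M := by
  have h := hM.perron.2.2
  rw [perronVec, dif_pos h]
  exact h.choose_spec

/-- A positive left eigenvector paired with a positive right one has nonzero product, so evaluating
w · M u in two ways identifies the eigenvalues. -/
theorem perronRoot_transpose [Nonempty E] {M : Matrix E E ℝ} (hM : M.IsIrreducible) :
    perronRoot Mᵀ = perronRoot M := by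
  obtain ⟨-, -, u, -, hu, hMu⟩ := hM.perron
  obtain ⟨-, -, w, -, hw, hMw⟩ := hM.transpose.perron
  have h1 : w ⬝ᵥ (M *ᵥ u) = (Mᵀ *ᵥ w) ⬝ᵥ u := by
    rw [dotProduct_mulVec, ← mulVec_transpose]
  rw [hMu, hMw, dotProduct_smul, smul_dotProduct] at h1
  have h2 : 0 < w ⬝ᵥ u := Finset.sum_pos (fun i _ => mul_pos (hw i) (hu i)) Finset.univ_nonempty
  exact (mul_right_cancel₀ h2.ne' h1).symm

/-- Continuity of the Perron vector along continuous families with continuous Perron root. -/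
theorem continuous_perronVec [Nonempty E] {X : Type*} [TopologicalSpace X]
    {A : X → Matrix E E ℝ} (hA : ∀ x, (A x).IsIrreducible) (hc : Continuous A)
    (hr : Continuous fun x => perronRoot (A x)) : Continuous fun x => perronVec (A x) := by
  rw [continuous_iff_continuousAt]
  intro x₀
  -- The vectors stay in the compact simplex, and each cluster point at x₀ is a normalized Perron
  -- vector of `A x₀`, of which there is only one.
  refine (isCompact_stdSimplex ℝ E).le_nhds_of_unique_clusterPt
    (l := map (fun x => perronVec (A x)) (𝓝 x₀)) ?_ ?_
  · exact mem_map.2 (Eventually.of_forall fun x => (hA x).perronVec_spec.1)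
  · intro w hw hclus
    refine (hA x₀).eigenvector_unique hw (hA x₀).perronVec_spec.1 ?_ (hA x₀).perronVec_spec.2.2
    have h1 : MapClusterPt w (𝓝 x₀) fun x => perronVec (A x) := hclus
    obtain ⟨U, hU, hUw⟩ := mapClusterPt_iff_ultrafilter.1 h1
    have hUx : Tendsto id (U : Filter X) (𝓝 x₀) := hU
    have hA' : Tendsto A U (𝓝 (A x₀)) := (hc.tendsto x₀).comp hUx
    have hr' : Tendsto (fun x => perronRoot (A x)) U (𝓝 (perronRoot (A x₀))) :=
      (hr.tendsto x₀).comp hUx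
    have hm : Continuous fun z : Matrix E E ℝ × (E → ℝ) => z.1 *ᵥ z.2 :=
      Continuous.matrix_mulVec continuous_fst continuous_snd
    have hl : Tendsto (fun x => A x *ᵥ perronVec (A x)) U (𝓝 (A x₀ *ᵥ w)) :=
      (hm.tendsto (A x₀, w)).comp (hA'.prodMk_nhds hUw)
    have hl' : Tendsto (fun x => A x *ᵥ perronVec (A x)) U (𝓝 (perronRoot (A x₀) • w)) := by
      simp_rw [fun x => (hA x).perronVec_spec.2.2]
      exact hr'.smul hUw
    exact tendsto_nhds_unique hl hl'

/-- The product of the left and right Perron vectors, normalized to total mass one. -/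
def perronProduct (M : Matrix E E ℝ) (e : E) : ℝ :=
  perronVec Mᵀ e * perronVec M e / ∑ e', perronVec Mᵀ e' * perronVec M e'

theorem perron_dot_pos [Nonempty E] {M : Matrix E E ℝ} (hM : M.IsIrreducible) :
    0 < ∑ e, perronVec Mᵀ e * perronVec M e :=
  Finset.sum_pos (fun i _ => mul_pos (hM.transpose.perronVec_spec.2.1 i)
    (hM.perronVec_spec.2.1 i)) Finset.univ_nonempty

theorem perronProduct_pos [Nonempty E] {M : Matrix E E ℝ} (hM : M.IsIrreducible) (e : E) :
    0 < perronProduct M e :=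
  div_pos (mul_pos (hM.transpose.perronVec_spec.2.1 e) (hM.perronVec_spec.2.1 e)) (perron_dot_pos hM)

theorem sum_perronProduct [Nonempty E] {M : Matrix E E ℝ} (hM : M.IsIrreducible) :
    ∑ e, perronProduct M e = 1 := by
  simp only [perronProduct, ← Finset.sum_div]
  exact div_self (perron_dot_pos hM).ne'

theorem continuous_perronProduct [Nonempty E] {X : Type*} [TopologicalSpace X]
    {A : X → Matrix E E ℝ} (hA : ∀ x, (A x).IsIrreducible) (hc : Continuous A)
    (hr : Continuous fun x => perronRoot (A x)) (e : E) :
    Continuous fun x => perronProduct (A x) e := by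
  have h1 := continuous_perronVec hA hc hr
  have h2 : Continuous fun x => perronVec (A x)ᵀ :=
    continuous_perronVec (fun x => (hA x).transpose) hc.matrix_transpose
      (by simpa only [fun x => perronRoot_transpose (hA x)] using hr)
  have h1' := fun e => (continuous_apply e).comp h1
  have h2' := fun e => (continuous_apply e).comp h2
  simp only [Function.comp_def] at h1' h2'
  refine Continuous.div ((h2' e).mul (h1' e))
    (continuous_finsetSum _ fun e' _ => (h2' e').mul (h1' e')) fun x => (perron_dot_pos (hA x)).ne'

/-- The two sides normalize differently: the predicate scales v so that v · u = 1, while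
`perronProduct` takes both vectors in the simplex and divides by their scalar product. The entrywise
product does not see the difference. -/
theorem isPerronProduct_iff [Nonempty E] {M : Matrix E E ℝ} (hM : M.IsIrreducible)
    (h1 : perronRoot M = 1) (g : E → ℝ) : IsPerronProduct M g ↔ g = perronProduct M := by
  obtain ⟨hus, hup, hu⟩ := hM.perronVec_spec
  obtain ⟨hvs, hvp, hv⟩ := hM.transpose.perronVec_spec
  have hd := perron_dot_pos hM
  constructor
  · rintro ⟨u, v, hu', hv', hsum, hMu, hvM, huv, hg⟩
    have e1 : u = perronVec M := hM.eigenvector_unique ⟨fun i => (hu' i).le, hsum⟩ hus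
      (by rw [hMu, h1, one_smul]) hu
    have hvsum : 0 < ∑ e, v e := Finset.sum_pos (fun i _ => hv' i) Finset.univ_nonempty
    have e2 : (∑ e, v e)⁻¹ • v = perronVec Mᵀ := hM.transpose.eigenvector_unique
      ⟨fun i => mul_nonneg (inv_nonneg.2 hvsum.le) (hv' i).le, by
        simp only [Pi.smul_apply, smul_eq_mul, ← Finset.mul_sum]
        exact inv_mul_cancel₀ hvsum.ne'⟩ hvs
      (by rw [mulVec_smul, mulVec_transpose, hvM, perronRoot_transpose hM, h1, one_smul]) hv
    funext e
    rw [hg e, perronProduct, ← e1, ← e2]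
    simp only [Pi.smul_apply, smul_eq_mul, mul_assoc]
    rw [← Finset.mul_sum, huv]
    field_simp
  · rintro rfl
    refine ⟨perronVec M, (∑ e, perronVec Mᵀ e * perronVec M e)⁻¹ • perronVec Mᵀ, hup,
      fun e => mul_pos (inv_pos.2 hd) (hvp e), hus.2, by rw [hu, h1, one_smul], ?_, ?_, ?_⟩
    · rw [← mulVec_transpose, mulVec_smul, hv, perronRoot_transpose hM, h1, one_smul]
    · simp only [Pi.smul_apply, smul_eq_mul, mul_assoc]
      rw [← Finset.mul_sum]
      exact inv_mul_cancel₀ hd.ne'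
    · intro e
      simp only [perronProduct, Pi.smul_apply, smul_eq_mul]
      rw [div_eq_inv_mul, mul_assoc]

end Perron

end

/-! ### Convexity and monotonicity of the logarithm of the spectral radius of F_{x,y}. -/

noncomputable section

/-- The variational lower bound for the Perron root: changing the columns of `M` by factors
`exp (Δ j)` changes its logarithm by at least the mean of `Δ` with respect to the stationary
distribution of the Markov chain belonging to `M`. -/
theorem log_perronRoot_sub_ge {E : Type*} [Fintype E] [DecidableEq E] [Nonempty E]
    {M N : Matrix E E ℝ} (hM : M.IsIrreducible) (hN : N.IsIrreducible) {D : E → ℝ}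
    (h : ∀ i j, N i j = M i j * Real.exp (D j)) :
    ∑ e, perronProduct M e * D e ≤ Real.log (perronRoot N) - Real.log (perronRoot M) := by
  obtain ⟨hus, hup, hu⟩ := hM.perronVec_spec
  obtain ⟨hvs, hvp, hv⟩ := hM.transpose.perronVec_spec
  obtain ⟨hws, hwp, hw⟩ := hN.perronVec_spec
  have hd := perron_dot_pos hM
  have hl := hM.perron.1
  have hk := hN.perron.1
  rw [perronRoot_transpose hM] at hv
  have hf : perronProduct M = fun e => perronVec Mᵀ e * perronVec M e /
    ∑ e', perronVec Mᵀ e' * perronVec M e' := rfl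
  have hfpos := perronProduct_pos hM
  have hfsum := sum_perronProduct hM
  generalize perronProduct M = f at *
  generalize (∑ e', perronVec Mᵀ e' * perronVec M e') = d at *
  generalize perronVec M = u at *
  generalize perronVec Mᵀ = v at *
  generalize perronVec N = w at *
  generalize perronRoot M = l at *
  generalize perronRoot N = k at *
  -- The Doob transform of M by its Perron vector: a stochastic matrix, with stationary distribution
  -- f.
  set P : E → E → ℝ := fun i j => M i j * u j / (l * u i) with hP
  have hP0 : ∀ i j, 0 ≤ P i j := fun i j =>
    div_nonneg (mul_nonneg (hM.nonneg i j) (hup j).le) (mul_pos hl (hup i)).le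
  have hP1 : ∀ i, ∑ j, P i j = 1 := by
    intro i
    rw [hP]
    simp only [← Finset.sum_div]
    have := congrFun hu i
    simp only [mulVec, dotProduct, Pi.smul_apply, smul_eq_mul] at this
    rw [this]
    exact div_self (mul_pos hl (hup i)).ne'
  have hPf : ∀ j, ∑ i, f i * P i j = f j := by
    intro j
    have h1 := congrFun hv j
    simp only [mulVec, dotProduct, Pi.smul_apply, smul_eq_mul, transpose_apply] at h1
    have h2 : ∀ i, f i * P i j = (M i j * v i) * (u j / (l * d)) := by
      intro i
      rw [hf, hP]
      have := (hup i).ne'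
      field_simp
    simp only [h2]
    rw [← Finset.sum_mul, h1, hf]
    field_simp
  set L : E → ℝ := fun i => Real.log (w i) - Real.log (u i) with hL
  have key : ∀ i, ∑ j, P i j * (D j + L j) ≤ Real.log k - Real.log l + L i := by
    intro i
    have h1 : ∑ j, P i j * Real.exp (D j + L j) = k * w i / (l * u i) := by
      have h2 := congrFun hw i
      simp only [mulVec, dotProduct, Pi.smul_apply, smul_eq_mul] at h2
      rw [← h2, Finset.sum_div]
      refine Finset.sum_congr rfl fun j _ => ?_
      rw [h, hP, Real.exp_add, hL, Real.exp_sub, Real.exp_log (hwp j), Real.exp_log (hup j)]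
      have := (hup i).ne'
      have := (hup j).ne'
      field_simp
    -- Jensen for the logarithm in row i of P; the eigenvalue equation of N evaluates the mean
    -- inside.
    have h3 := strictConcaveOn_log_Ioi.concaveOn.le_map_sum (t := Finset.univ) (w := P i)
      (p := fun j => Real.exp (D j + L j)) (fun j _ => hP0 i j) (hP1 i)
      (fun j _ => Real.exp_pos _)
    simp only [smul_eq_mul, Real.log_exp, h1] at h3
    rw [Real.log_div (mul_pos hk (hwp i)).ne' (mul_pos hl (hup i)).ne',
      Real.log_mul hk.ne' (hwp i).ne', Real.log_mul hl.ne' (hup i).ne'] at h3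
    rw [hL] at h3 ⊢
    linarith
  -- Averaging over the stationary f removes the coboundary L from both sides.
  have h4 : ∑ i, f i * ∑ j, P i j * (D j + L j) ≤ ∑ i, f i * (Real.log k - Real.log l + L i) :=
    Finset.sum_le_sum fun i _ => mul_le_mul_of_nonneg_left (key i) (hfpos i).le
  have h5 : ∑ i, f i * ∑ j, P i j * (D j + L j) = ∑ j, f j * (D j + L j) := by
    simp only [Finset.mul_sum, ← mul_assoc]
    rw [Finset.sum_comm]
    exact Finset.sum_congr rfl fun j _ => by rw [← Finset.sum_mul, hPf]
  rw [h5] at h4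
  simp only [mul_add, Finset.sum_add_distrib] at h4
  rw [← Finset.sum_mul, hfsum, one_mul] at h4
  linarith

/-- A continuous function of slope at most `-c < 0` has a unique zero. -/
theorem exists_forall_eq_zero_iff {g : ℝ → ℝ} (hg : Continuous g) {c : ℝ} (hc : 0 < c)
    (h : ∀ s s', s ≤ s' → c * (s' - s) ≤ g s - g s') : ∃ r, ∀ s, g s = 0 ↔ s = r := by
  -- The slope bound fixes the sign of g at -|g 0|/c and at |g 0|/c, so the intermediate value
  -- theorem applies.
  obtain ⟨r, hr⟩ : ∃ r, g r = 0 := by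
    have h1 : 0 ≤ g (-(|g 0| / c)) := by
      have := h (-(|g 0| / c)) 0 (neg_nonpos.2 (by positivity))
      rw [zero_sub, neg_neg, mul_div_cancel₀ _ hc.ne'] at this
      linarith [neg_abs_le (g 0)]
    have h2 : g (|g 0| / c) ≤ 0 := by
      have := h 0 (|g 0| / c) (by positivity)
      rw [sub_zero, mul_div_cancel₀ _ hc.ne'] at this
      linarith [le_abs_self (g 0)]
    exact mem_range_of_exists_le_of_exists_ge hg ⟨_, h2⟩ ⟨_, h1⟩
  refine ⟨r, fun s => ⟨fun hs => ?_, fun hs => hs ▸ hr⟩⟩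
  rcases le_total s r with hsr | hsr
  · have := h s r hsr
    rw [hs, hr] at this
    nlinarith
  · have := h r s hsr
    rw [hs, hr] at this
    nlinarith

namespace BoxLikeGIFS

variable {V E : Type*} (G : BoxLikeGIFS V E)

theorem StronglyConnected.nonempty_edge [Nonempty V] {G : BoxLikeGIFS V E}
    (h : G.StronglyConnected) : Nonempty E := by
  obtain ⟨v⟩ := ‹Nonempty V›
  obtain ⟨_, ⟨e, _⟩, _⟩ := (Relation.TransGen.head'_iff).1 (h v v)
  exact ⟨e⟩

/-- Uniform bounds for the logarithms of the contraction ratios. -/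
theorem exists_log_bounds [Fintype E] [Nonempty E] : ∃ c > 0, ∃ C > 0, ∀ e,
    (c ≤ -Real.log (G.a e) ∧ -Real.log (G.a e) ≤ C) ∧
    (c ≤ -Real.log (G.b e) ∧ -Real.log (G.b e) ≤ C) := by
  have ha : ∀ e, 0 < -Real.log (G.a e) := fun e =>
    neg_pos.2 (Real.log_neg (G.a_pos e) (G.a_lt_one e))
  have hb : ∀ e, 0 < -Real.log (G.b e) := fun e =>
    neg_pos.2 (Real.log_neg (G.b_pos e) (G.b_lt_one e))
  obtain ⟨e₁, -, h1⟩ := Finset.exists_min_image Finset.univ (fun e => -Real.log (G.a e))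
    Finset.univ_nonempty
  obtain ⟨e₂, -, h2⟩ := Finset.exists_min_image Finset.univ (fun e => -Real.log (G.b e))
    Finset.univ_nonempty
  obtain ⟨e₃, -, h3⟩ := Finset.exists_max_image Finset.univ (fun e => -Real.log (G.a e))
    Finset.univ_nonempty
  obtain ⟨e₄, -, h4⟩ := Finset.exists_max_image Finset.univ (fun e => -Real.log (G.b e))
    Finset.univ_nonempty
  refine ⟨min (-Real.log (G.a e₁)) (-Real.log (G.b e₂)), lt_min (ha _) (hb _),
    max (-Real.log (G.a e₃)) (-Real.log (G.b e₄)), lt_max_of_lt_left (ha _), fun e =>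
    ⟨⟨(min_le_left _ _).trans (h1 e (Finset.mem_univ e)),
      (h3 e (Finset.mem_univ e)).trans (le_max_left _ _)⟩,
     ⟨(min_le_right _ _).trans (h2 e (Finset.mem_univ e)),
      (h4 e (Finset.mem_univ e)).trans (le_max_right _ _)⟩⟩⟩

variable [DecidableEq V]

theorem F_apply_pos {p : E → ℝ} (hp : ∀ e, 0 < p e) (q x y : ℝ) {e e' : E}
    (h : G.tgt e = G.src e') : 0 < G.F p q x y e e' := by
  simp only [F, Matrix.of_apply, if_pos h]
  have := hp e'
  have := G.a_pos e'
  have := G.b_pos e'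
  positivity

theorem F_nonneg {p : E → ℝ} (hp : ∀ e, 0 < p e) (q x y : ℝ) (e e' : E) :
    0 ≤ G.F p q x y e e' := by
  by_cases h : G.tgt e = G.src e'
  · exact (G.F_apply_pos hp q x y h).le
  · simp [F, h]

theorem continuous_F (p : E → ℝ) (q : ℝ) : Continuous fun z : ℝ × ℝ => G.F p q z.1 z.2 := by
  refine continuous_matrix fun e e' => ?_
  simp only [F, Matrix.of_apply]
  split_ifs
  · refine (continuous_const.mul ?_).mul ?_
    · exact Continuous.rpow continuous_const continuous_fst fun _ => Or.inl (G.a_pos e').ne'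
    · exact Continuous.rpow continuous_const continuous_snd fun _ => Or.inl (G.b_pos e').ne'
  · exact continuous_const

variable [Fintype E] [DecidableEq E]

/-- Positive entries of powers of F correspond to paths of edges. Strong connectivity gives a path
from the end of e to the start of e', and one more step reaches e'. -/
theorem F_isIrreducible {p : E → ℝ} (hp : ∀ e, 0 < p e) (hconn : G.StronglyConnected)
    (q x y : ℝ) : (G.F p q x y).IsIrreducible := by
  have hnn := G.F_nonneg hp q x y
  rw [isIrreducible_iff_exists_pow_pos hnn]
  intro e e'
  have hstep : ∀ (k : ℕ) (e₁ e₂ : E), 0 < (G.F p q x y ^ k) e e₁ → G.tgt e₁ = G.src e₂ →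
      0 < (G.F p q x y ^ (k + 1)) e e₂ := by
    intro k e₁ e₂ h1 h2
    rw [pow_succ, mul_apply]
    exact Finset.sum_pos' (fun l _ => mul_nonneg (pow_nonneg_entry hnn k e l) (hnn l e₂))
      ⟨e₁, Finset.mem_univ _, mul_pos h1 (G.F_apply_pos hp q x y h2)⟩
  have key : ∀ v', Relation.TransGen (fun x y => ∃ e, G.src e = x ∧ G.tgt e = y) (G.tgt e) v' →
      ∃ k, ∃ e₁, G.tgt e₁ = v' ∧ 0 < (G.F p q x y ^ k) e e₁ := by
    intro v' hv
    induction hv with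
    | single h =>
      obtain ⟨e₁, h1, h2⟩ := h
      exact ⟨1, e₁, h2, by simpa using G.F_apply_pos hp q x y h1.symm⟩
    | tail _ h ih =>
      obtain ⟨k, e₁, h1, h2⟩ := ih
      obtain ⟨e₂, h3, h4⟩ := h
      exact ⟨k + 1, e₂, h4, hstep k e₁ e₂ h2 (h1.trans h3.symm)⟩
  obtain ⟨k, e₁, h1, h2⟩ := key _ (hconn (G.tgt e) (G.src e'))
  exact ⟨k + 1, k.succ_pos, hstep k e₁ e' h2 h1⟩

/-- The logarithm of the spectral radius of `F_{x,y}`. -/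
def logRad (p : E → ℝ) (q x y : ℝ) : ℝ := Real.log (perronRoot (G.F p q x y))

/-- The mean of `log a` with respect to the product of the Perron vectors of `F_{x,y}`. -/
def meanA (p : E → ℝ) (q x y : ℝ) : ℝ := ∑ e, perronProduct (G.F p q x y) e * Real.log (G.a e)

/-- The mean of `log b` with respect to the product of the Perron vectors of `F_{x,y}`. -/
def meanB (p : E → ℝ) (q x y : ℝ) : ℝ := ∑ e, perronProduct (G.F p q x y) e * Real.log (G.b e)

/-- The pair (`meanA`, `meanB`) is a subgradient of `logRad`: passing from F_{x₀,y₀} to F_{x,y}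
multiplies each column e by a_e^{x-x₀} b_e^{y-y₀}, and `log_perronRoot_sub_ge` applies. -/
theorem logRad_sub_ge [Nonempty V] {p : E → ℝ} (hp : ∀ e, 0 < p e) (hconn : G.StronglyConnected)
    (q x y x₀ y₀ : ℝ) :
    (x - x₀) * G.meanA p q x₀ y₀ + (y - y₀) * G.meanB p q x₀ y₀ ≤
      G.logRad p q x y - G.logRad p q x₀ y₀ := by
  have := hconn.nonempty_edge
  refine le_trans (le_of_eq ?_) (log_perronRoot_sub_ge (G.F_isIrreducible hp hconn q x₀ y₀)
    (G.F_isIrreducible hp hconn q x y)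
    (D := fun e => (x - x₀) * Real.log (G.a e) + (y - y₀) * Real.log (G.b e)) ?_)
  · simp only [meanA, meanB, Finset.mul_sum, mul_add, Finset.sum_add_distrib]
    congr 1 <;> exact Finset.sum_congr rfl fun e _ => by ring
  · intro e e'
    simp only [F, Matrix.of_apply]
    split_ifs
    · rw [Real.exp_add, mul_comm (x - x₀), mul_comm (y - y₀), ← Real.rpow_def_of_pos (G.a_pos e'),
        ← Real.rpow_def_of_pos (G.b_pos e'), Real.rpow_sub (G.a_pos e'),
        Real.rpow_sub (G.b_pos e')]
      have := (Real.rpow_pos_of_pos (G.a_pos e') x₀).ne'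
      have := (Real.rpow_pos_of_pos (G.b_pos e') y₀).ne'
      field_simp
    · simp

/-- The subgradients are means over probability vectors, so they are bounded away from 0 and -∞
uniformly in x, y. This yields both the Lipschitz bound and the strict decrease of `logRad`. -/
theorem exists_mean_bounds [Nonempty V] {p : E → ℝ} (hp : ∀ e, 0 < p e)
    (hconn : G.StronglyConnected) (q : ℝ) : ∃ c > 0, ∃ C > 0, ∀ x y,
    (c ≤ -G.meanA p q x y ∧ -G.meanA p q x y ≤ C) ∧
    (c ≤ -G.meanB p q x y ∧ -G.meanB p q x y ≤ C) := by
  have := hconn.nonempty_edge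
  obtain ⟨c, hc, C, hC, h⟩ := G.exists_log_bounds
  refine ⟨c, hc, C, hC, fun x y => ?_⟩
  have hirr := G.F_isIrreducible hp hconn q x y
  have aux : ∀ l : E → ℝ, (∀ e, c ≤ -l e ∧ -l e ≤ C) →
      c ≤ -∑ e, perronProduct (G.F p q x y) e * l e ∧
      -∑ e, perronProduct (G.F p q x y) e * l e ≤ C := by
    intro l hl
    rw [← Finset.sum_neg_distrib]
    have h1 := sum_perronProduct hirr
    constructor
    · calc c = ∑ e, perronProduct (G.F p q x y) e * c := by rw [← Finset.sum_mul, h1, one_mul]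
        _ ≤ _ := Finset.sum_le_sum fun e _ => by
          rw [← mul_neg]
          exact mul_le_mul_of_nonneg_left (hl e).1 (perronProduct_pos hirr e).le
    · calc _ ≤ ∑ e, perronProduct (G.F p q x y) e * C := Finset.sum_le_sum fun e _ => by
              rw [← mul_neg]
              exact mul_le_mul_of_nonneg_left (hl e).2 (perronProduct_pos hirr e).le
        _ = C := by rw [← Finset.sum_mul, h1, one_mul]
  exact ⟨aux _ fun e => (h e).1, aux _ fun e => (h e).2⟩

/-- Bounded subgradients at both points bound the difference from both sides, so `logRad` is
Lipschitz. -/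
theorem continuous_logRad [Nonempty V] {p : E → ℝ} (hp : ∀ e, 0 < p e)
    (hconn : G.StronglyConnected) (q : ℝ) : Continuous fun z : ℝ × ℝ => G.logRad p q z.1 z.2 := by
  obtain ⟨c, hc, C, hC, h⟩ := G.exists_mean_bounds hp hconn q
  have aux : ∀ r m : ℝ, c ≤ -m → -m ≤ C → -(C * |r|) ≤ r * m := by
    intro r m h1 h2
    have : |r * m| ≤ C * |r| := by
      rw [abs_mul, mul_comm]
      exact mul_le_mul_of_nonneg_right (abs_le.2 ⟨by linarith, by linarith⟩) (abs_nonneg r)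
    linarith [neg_abs_le (r * m)]
  have key : ∀ z z₀ : ℝ × ℝ, -(C * |z.1 - z₀.1| + C * |z.2 - z₀.2|) ≤
      G.logRad p q z.1 z.2 - G.logRad p q z₀.1 z₀.2 := by
    intro z z₀
    have h1 := G.logRad_sub_ge hp hconn q z.1 z.2 z₀.1 z₀.2
    have h2 := h z₀.1 z₀.2
    have h3 := aux (z.1 - z₀.1) _ h2.1.1 h2.1.2
    have h4 := aux (z.2 - z₀.2) _ h2.2.1 h2.2.2
    linarith
  rw [continuous_iff_continuousAt]
  intro z₀
  have hlim : Tendsto (fun z : ℝ × ℝ => C * |z.1 - z₀.1| + C * |z.2 - z₀.2|) (𝓝 z₀) (𝓝 0) := by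
    have : Continuous fun z : ℝ × ℝ => C * |z.1 - z₀.1| + C * |z.2 - z₀.2| := by fun_prop
    simpa using this.tendsto z₀
  rw [ContinuousAt, tendsto_iff_dist_tendsto_zero]
  refine squeeze_zero (fun _ => dist_nonneg) (fun z => ?_) hlim
  rw [Real.dist_eq, abs_le]
  refine ⟨key z z₀, ?_⟩
  have := key z₀ z
  rw [abs_sub_comm z₀.1, abs_sub_comm z₀.2] at this
  linarith

theorem perronRoot_F_eq_exp [Nonempty V] {p : E → ℝ} (hp : ∀ e, 0 < p e)
    (hconn : G.StronglyConnected) (q x y : ℝ) :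
    perronRoot (G.F p q x y) = Real.exp (G.logRad p q x y) := by
  have := hconn.nonempty_edge
  rw [logRad, Real.exp_log (G.F_isIrreducible hp hconn q x y).perron.1]

theorem specRadius_F_eq_one_iff [Nonempty V] {p : E → ℝ} (hp : ∀ e, 0 < p e)
    (hconn : G.StronglyConnected) (q x y : ℝ) :
    specRadius (G.F p q x y) = 1 ↔ G.logRad p q x y = 0 := by
  have := hconn.nonempty_edge
  rw [(G.F_isIrreducible hp hconn q x y).perron.2.1, G.perronRoot_F_eq_exp hp hconn,
    ENNReal.ofReal_eq_one, Real.exp_eq_one_iff]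

theorem continuous_perronProduct_F [Nonempty V] {p : E → ℝ} (hp : ∀ e, 0 < p e)
    (hconn : G.StronglyConnected) (q : ℝ) (e : E) :
    Continuous fun z : ℝ × ℝ => perronProduct (G.F p q z.1 z.2) e := by
  have := hconn.nonempty_edge
  have hr : Continuous fun z : ℝ × ℝ => perronRoot (G.F p q z.1 z.2) := by
    simp only [G.perronRoot_F_eq_exp hp hconn]
    exact Real.continuous_exp.comp (G.continuous_logRad hp hconn q)
  exact continuous_perronProduct (A := fun z : ℝ × ℝ => G.F p q z.1 z.2)
    (fun z => G.F_isIrreducible hp hconn q z.1 z.2) (G.continuous_F p q) hr e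

/-- The mean of `log (a / b)` with respect to the product of the Perron vectors of `F_{x,y}`. -/
def drift (p : E → ℝ) (q x y : ℝ) : ℝ :=
  ∑ e, perronProduct (G.F p q x y) e * Real.log (G.a e / G.b e)

theorem drift_eq (p : E → ℝ) (q x y : ℝ) :
    G.drift p q x y = G.meanA p q x y - G.meanB p q x y := by
  simp only [drift, meanA, meanB, ← Finset.sum_sub_distrib, ← mul_sub]
  exact Finset.sum_congr rfl fun e _ => by rw [Real.log_div (G.a_pos e).ne' (G.b_pos e).ne']

theorem continuous_drift [Nonempty V] {p : E → ℝ} (hp : ∀ e, 0 < p e)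
    (hconn : G.StronglyConnected) (q : ℝ) : Continuous fun z : ℝ × ℝ => G.drift p q z.1 z.2 :=
  continuous_finsetSum _ fun e _ =>
    (G.continuous_perronProduct_F hp hconn q e).mul continuous_const

/-- Along the antidiagonal direction the drift is a subgradient of `logRad`. -/
theorem drift_mul_le [Nonempty V] {p : E → ℝ} (hp : ∀ e, 0 < p e) (hconn : G.StronglyConnected)
    (q s x x₀ : ℝ) : (x - x₀) * G.drift p q x₀ (s - x₀) ≤
      G.logRad p q x (s - x) - G.logRad p q x₀ (s - x₀) := by
  have := G.logRad_sub_ge hp hconn q x (s - x) x₀ (s - x₀)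
  rw [drift_eq]
  linarith

end BoxLikeGIFS

end

noncomputable section

namespace BoxLikeGIFS

variable {V E : Type*} (G : BoxLikeGIFS V E)

/-! ### Words and sections -/

/-- The terminal vertex of a path that starts at `v`. -/
def wordEnd : V → List E → V
  | v, [] => v
  | _, e :: w => wordEnd (G.tgt e) w

/-- The edges of `w` form a path that starts at `v`. -/
def IsPath : V → List E → Prop
  | _, [] => True
  | v, e :: w => G.src e = v ∧ IsPath (G.tgt e) w

/-- Prepending an edge to a word. -/
def consEmb (e : E) : List E ↪ List E := ⟨List.cons e, List.cons_injective⟩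

/-- The sum of `l e` over the edges `e` of a word. -/
def wsum (l : E → ℝ) (w : List E) : ℝ := (w.map l).sum

theorem wsum_cons (l : E → ℝ) (e : E) (w : List E) : wsum l (e :: w) = l e + wsum l w := by
  simp [wsum]

theorem wsum_bounds {l : E → ℝ} {c C : ℝ} (h : ∀ e, c ≤ l e ∧ l e ≤ C) (w : List E) :
    c * w.length ≤ wsum l w ∧ wsum l w ≤ C * w.length := by
  induction w with
  | nil => simp [wsum]
  | cons e w ih =>
    rw [wsum_cons, List.length_cons]
    push_cast
    constructor <;> nlinarith [h e]

variable [DecidableEq V] [Fintype E]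

open Classical in
/-- The words that start with an edge `e` leaving `v` and continue with a word of `S e`. -/
def extendWords (v : V) (S : E → Finset (List E)) : Finset (List E) :=
  (Finset.univ.filter fun e => G.src e = v).biUnion fun e => (S e).map (consEmb e)

theorem mem_extendWords {v : V} {S : E → Finset (List E)} {w : List E} :
    w ∈ G.extendWords v S ↔ ∃ e w', G.src e = v ∧ w' ∈ S e ∧ w = e :: w' := by
  simp only [extendWords, Finset.mem_biUnion, Finset.mem_filter, Finset.mem_univ, true_and,
    Finset.mem_map, consEmb, Function.Embedding.coeFn_mk]
  constructor
  · rintro ⟨e, he, w', hw', rfl⟩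
    exact ⟨e, w', he, hw', rfl⟩
  · rintro ⟨e, w', he, hw', rfl⟩
    exact ⟨e, he, w', hw', rfl⟩

theorem sum_extendWords {M : Type*} [AddCommMonoid M] (v : V) (S : E → Finset (List E))
    (f : List E → M) :
    ∑ w ∈ G.extendWords v S, f w = ∑ e with G.src e = v, ∑ w ∈ S e, f (e :: w) := by
  classical
  rw [extendWords, Finset.sum_biUnion]
  · exact Finset.sum_congr rfl fun e _ => by rw [Finset.sum_map]; rfl
  · intro e _ e' _ hne
    rw [Function.onFun, Finset.disjoint_left]
    intro w h1 h2
    obtain ⟨w₁, -, rfl⟩ := Finset.mem_map.1 h1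
    obtain ⟨w₂, -, h⟩ := Finset.mem_map.1 h2
    exact hne (List.cons_eq_cons.1 h).1.symm

/-- Finite maximal antichains of paths starting at a vertex. -/
inductive IsSection : V → Finset (List E) → Prop
  | nil (v : V) : IsSection v {[]}
  | extend (v : V) (S : E → Finset (List E)) (h : ∀ e, G.src e = v → IsSection (G.tgt e) (S e)) :
      IsSection v (G.extendWords v S)

/-- A weight function that is harmonic for one step is harmonic for every section. -/
theorem IsSection.sum_eq {G : BoxLikeGIFS V E} {v : V} {S : Finset (List E)}
    (hS : G.IsSection v S) {g : E → ℝ} {h : V → ℝ}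
    (hh : ∀ v, ∑ e with G.src e = v, g e * h (G.tgt e) = h v) :
    ∑ w ∈ S, (w.map g).prod * h (G.wordEnd v w) = h v := by
  induction hS with
  | nil v => simp [wordEnd]
  | extend v S _ ih =>
    rw [G.sum_extendWords, ← hh v]
    refine Finset.sum_congr rfl fun e he => ?_
    rw [← ih e (Finset.mem_filter.1 he).2, Finset.mul_sum]
    exact Finset.sum_congr rfl fun w _ => by
      simp only [List.map_cons, List.prod_cons, wordEnd]; ring

/-- All paths of length `k` starting at `v`. -/
def levelWords : ℕ → V → Finset (List E)
  | 0, _ => {[]}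
  | k + 1, v => G.extendWords v fun e => levelWords k (G.tgt e)

theorem isSection_levelWords (k : ℕ) (v : V) : G.IsSection v (G.levelWords k v) := by
  induction k generalizing v with
  | zero => exact .nil v
  | succ k ih => exact .extend v _ fun e _ => ih _

theorem mem_levelWords {k : ℕ} {v : V} {w : List E} :
    w ∈ G.levelWords k v ↔ w.length = k ∧ G.IsPath v w := by
  induction k generalizing v w with
  | zero =>
    simp only [levelWords, Finset.mem_singleton, List.length_eq_zero_iff]
    exact ⟨fun h => ⟨h, h ▸ trivial⟩, fun h => h.1⟩
  | succ k ih =>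
    simp only [levelWords, mem_extendWords, ih]
    constructor
    · rintro ⟨e, w', h1, ⟨h2, h3⟩, rfl⟩
      exact ⟨by simp [h2], h1, h3⟩
    · rintro ⟨h1, h2⟩
      cases w with
      | nil => simp at h1
      | cons e w' => exact ⟨e, w', h2.1, ⟨by simpa using h1, h2.2⟩, rfl⟩

/-- Sections that stop a decreasing quantity `m` as soon as it is at most `δ`. -/
theorem exists_stopping_section {m : List E → ℝ} {c κ : ℝ} (hc : 0 ≤ c) (hκ : 0 ≤ κ) (hκ1 : κ < 1)
    (hm0 : m [] = 1) (hm : ∀ w e, c * m w ≤ m (w ++ [e]) ∧ m (w ++ [e]) ≤ κ * m w) (hc1 : c ≤ 1)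
    {δ : ℝ} (hδ : 0 < δ) (hδ1 : δ ≤ 1) (v : V) :
    ∃ S, G.IsSection v S ∧ ∀ w ∈ S, c * δ ≤ m w ∧ m w ≤ δ := by
  -- n bounds the number of edges still to be appended to u. A word is extended only while m exceeds
  -- δ, so each extension by one edge still has m at least c δ.
  have key : ∀ (n : ℕ) (u : List E) (v : V), c * δ ≤ m u → κ ^ n * m u ≤ δ →
      ∃ S, G.IsSection v S ∧ ∀ w ∈ S, c * δ ≤ m (u ++ w) ∧ m (u ++ w) ≤ δ := by
    intro n
    induction n with
    | zero =>
      intro u v h1 h2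
      exact ⟨{[]}, .nil v, by simpa using ⟨h1, by simpa using h2⟩⟩
    | succ n ih =>
      intro u v h1 h2
      by_cases hu : m u ≤ δ
      · exact ⟨{[]}, .nil v, by simpa using ⟨h1, hu⟩⟩
      · have hstep : ∀ e, ∃ S, G.IsSection (G.tgt e) S ∧
            ∀ w ∈ S, c * δ ≤ m (u ++ [e] ++ w) ∧ m (u ++ [e] ++ w) ≤ δ := by
          intro e
          refine ih (u ++ [e]) (G.tgt e) ?_ ?_
          · exact (mul_le_mul_of_nonneg_left (not_le.1 hu).le hc).trans (hm u e).1
          · refine le_trans ?_ h2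
            rw [pow_succ, mul_assoc]
            exact mul_le_mul_of_nonneg_left (hm u e).2 (pow_nonneg hκ n)
        choose S hS1 hS2 using hstep
        refine ⟨G.extendWords v S, .extend v S fun e _ => hS1 e, fun w hw => ?_⟩
        obtain ⟨e, w', -, hw', rfl⟩ := G.mem_extendWords.1 hw
        simpa using hS2 e w' hw'
  obtain ⟨n, hn⟩ := exists_pow_lt_of_lt_one hδ hκ1
  have := key n [] v (by rw [hm0]; nlinarith) (by rw [hm0, mul_one]; exact hn.le)
  simpa using this

end BoxLikeGIFS

end

noncomputable section

namespace BoxLikeGIFS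

variable {V E : Type*} (G : BoxLikeGIFS V E)

/-! ### Growth of the sums over sections -/

/-- The logarithm of the product of `a` over a word. -/
def logA (w : List E) : ℝ := wsum (fun e => Real.log (G.a e)) w

/-- The logarithm of the product of `b` over a word. -/
def logB (w : List E) : ℝ := wsum (fun e => Real.log (G.b e)) w

/-- The logarithm of the product of `p` over a word. -/
def logP (p : E → ℝ) (w : List E) : ℝ := wsum (fun e => Real.log (p e)) w

/-- The exponential of the logarithmic weight of a word at the parameters `x`, `y`, relative to the
growth rate `r`. -/
def wordWeight (p : E → ℝ) (q x y r : ℝ) (w : List E) : ℝ :=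
  Real.exp (q * logP p w + x * G.logA w + y * G.logB w - r * w.length)

/-- The modified singular value function of a word, in terms of the spectra `α` and `β` of the
projections onto the two axes. -/
def wordPhi (p : E → ℝ) (q α β s : ℝ) (w : List E) : ℝ :=
  Real.exp (q * logP p w + if G.logB w ≤ G.logA w then α * G.logA w + (s - α) * G.logB w
    else (s - β) * G.logA w + β * G.logB w)

theorem wordWeight_eq_prod {p : E → ℝ} (q x y r : ℝ) (w : List E) :
    G.wordWeight p q x y r w = (w.map fun e => Real.exp (q * Real.log (p e) + x * Real.log (G.a e) +
      y * Real.log (G.b e) - r)).prod := by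
  induction w with
  | nil => simp [wordWeight, logA, logB, logP, wsum]
  | cons e w ih =>
    rw [List.map_cons, List.prod_cons, ← ih, wordWeight, wordWeight, ← Real.exp_add]
    simp only [logA, logB, logP, wsum_cons, List.length_cons]
    push_cast
    ring_nf

theorem StronglyConnected.exists_src {G : BoxLikeGIFS V E} (h : G.StronglyConnected) (v : V) :
    ∃ e, G.src e = v := by
  obtain ⟨_, ⟨e, he⟩, _⟩ := (Relation.TransGen.head'_iff).1 (h v v)
  exact ⟨e, he.1⟩

variable [DecidableEq V] [Fintype E] [DecidableEq E]

/-- A positive function on the vertices that is harmonic for the weights `p^q a^x b^y`, normalized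
by the spectral radius. -/
theorem exists_harmonic [Nonempty V] {p : E → ℝ} (hp : ∀ e, 0 < p e) (hconn : G.StronglyConnected)
    (q x y : ℝ) : ∃ h : V → ℝ, (∀ v, 0 < h v) ∧ ∀ v, ∑ e with G.src e = v,
      Real.exp (q * Real.log (p e) + x * Real.log (G.a e) + y * Real.log (G.b e) -
        G.logRad p q x y) * h (G.tgt e) = h v := by
  have := hconn.nonempty_edge
  obtain ⟨-, hup, hu⟩ := (G.F_isIrreducible hp hconn q x y).perronVec_spec
  rw [G.perronRoot_F_eq_exp hp hconn] at hu
  set u := perronVec (G.F p q x y)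
  set g : E → ℝ := fun e => Real.exp (q * Real.log (p e) + x * Real.log (G.a e) +
    y * Real.log (G.b e) - G.logRad p q x y) with hg
  have hgF : ∀ e e', G.F p q x y e e' =
      if G.tgt e = G.src e' then Real.exp (G.logRad p q x y) * g e' else 0 := by
    intro e e'
    simp only [F, Matrix.of_apply, hg]
    rw [← Real.exp_add, Real.rpow_def_of_pos (hp e'), Real.rpow_def_of_pos (G.a_pos e'),
      Real.rpow_def_of_pos (G.b_pos e'), ← Real.exp_add, ← Real.exp_add]
    ring_nf
  have hu' : ∀ e, ∑ e' with G.src e' = G.tgt e, g e' * u e' = u e := by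
    intro e
    have h1 := congrFun hu e
    simp only [mulVec, dotProduct, hgF, Pi.smul_apply, smul_eq_mul, ite_mul, zero_mul] at h1
    rw [← Finset.sum_filter] at h1
    simp only [mul_assoc, ← Finset.mul_sum] at h1
    rw [← mul_left_cancel₀ (Real.exp_pos _).ne' h1]
    simp only [eq_comm]
  -- Row e of F depends only on the end of e, so the Perron equation says that u_e is the value of
  -- this function at the end of e. Substituting this back is harmonicity.
  refine ⟨fun v => ∑ e with G.src e = v, g e * u e, fun v => ?_, fun v => ?_⟩
  · obtain ⟨e, he⟩ := hconn.exists_src v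
    exact Finset.sum_pos (fun e _ => mul_pos (Real.exp_pos _) (hup e))
      ⟨e, Finset.mem_filter.2 ⟨Finset.mem_univ _, he⟩⟩
  · exact Finset.sum_congr rfl fun e _ => congrArg (g e * ·) (hu' e)

variable [Fintype V]

/-- The normalized weights of the words of a section have total mass bounded above and below. -/
theorem exists_section_bounds [Nonempty V] {p : E → ℝ} (hp : ∀ e, 0 < p e)
    (hconn : G.StronglyConnected) (q x y : ℝ) : ∃ c > 0, ∃ C > 0, ∀ v S, G.IsSection v S →
      c ≤ ∑ w ∈ S, G.wordWeight p q x y (G.logRad p q x y) w ∧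
      ∑ w ∈ S, G.wordWeight p q x y (G.logRad p q x y) w ≤ C := by
  obtain ⟨h, hpos, hh⟩ := G.exists_harmonic hp hconn q x y
  obtain ⟨v₁, -, h1⟩ := Finset.exists_min_image Finset.univ h Finset.univ_nonempty
  obtain ⟨v₂, -, h2⟩ := Finset.exists_max_image Finset.univ h Finset.univ_nonempty
  replace h1 := fun v => h1 v (Finset.mem_univ v)
  replace h2 := fun v => h2 v (Finset.mem_univ v)
  refine ⟨h v₁ / h v₂, div_pos (hpos _) (hpos _), h v₂ / h v₁, div_pos (hpos _) (hpos _),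
    fun v S hS => ?_⟩
  have hsum := hS.sum_eq hh
  simp only [← G.wordWeight_eq_prod] at hsum
  rw [div_le_iff₀ (hpos _), le_div_iff₀ (hpos _), Finset.sum_mul, Finset.sum_mul]
  constructor
  · refine (h1 v).trans (hsum.symm.le.trans (Finset.sum_le_sum fun w _ => ?_))
    exact mul_le_mul_of_nonneg_left (h2 _) (Real.exp_pos _).le
  · refine le_trans (Finset.sum_le_sum fun w _ => ?_) (hsum.le.trans (h2 v))
    exact mul_le_mul_of_nonneg_left (h1 _) (Real.exp_pos _).le

open Classical in
/-- Words whose `log (a / b)` deviates too far in the direction of `θ` have small total weight in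
every section of long words. -/
theorem exists_deviation_bound [Nonempty V] {p : E → ℝ} (hp : ∀ e, 0 < p e)
    (hconn : G.StronglyConnected) (q s x θ : ℝ) {η : ℝ} (hθ : θ ≠ 0) (hη : 0 < η)
    (hr : G.logRad p q (x + θ) (s - (x + θ)) - G.logRad p q x (s - x) ≤ |θ| * (η / 2))
    {κ : ℝ} (hκ : 0 < κ) : ∃ k₀ : ℕ, ∀ v S, G.IsSection v S → (∀ w ∈ S, k₀ ≤ w.length) →
      ∑ w ∈ S with |θ| * (η * w.length) < θ * (G.logA w - G.logB w),
        G.wordWeight p q x (s - x) (G.logRad p q x (s - x)) w ≤ κ := by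
  obtain ⟨_, _, C, hC, hsec⟩ := G.exists_section_bounds hp hconn q (x + θ) (s - (x + θ))
  have hθ' : 0 < |θ| := abs_pos.2 hθ
  set d := |θ| * (η / 2) with hd
  have hd0 : 0 < d := by positivity
  have hlim : Tendsto (fun k : ℕ => Real.exp (-(d * k)) * C) atTop (𝓝 0) := by
    rw [← zero_mul C]
    refine Tendsto.mul_const C (Real.tendsto_exp_neg_atTop_nhds_zero.comp ?_)
    exact tendsto_natCast_atTop_atTop.const_mul_atTop hd0
  obtain ⟨k₀, hk₀⟩ := (hlim.eventually (gt_mem_nhds hκ)).exists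
  refine ⟨k₀, fun v S hS hlen => le_trans ?_ hk₀.le⟩
  refine le_trans ?_ (mul_le_mul_of_nonneg_left (hsec v S hS).2 (Real.exp_pos _).le)
  rw [Finset.mul_sum]
  -- Chernoff's argument: moving from x to x + θ multiplies the normalized weight of w by exp(θ
  -- (`logA w` - `logB w`)) and divides it by exp of the change of `logRad` times the length. On the
  -- deviating words this is a gain of at least exp(d k₀), while the tilted weights have total mass
  -- at most C.
  refine le_trans (Finset.sum_le_sum (g := fun w => Real.exp (-(d * k₀)) *
      G.wordWeight p q (x + θ) (s - (x + θ)) (G.logRad p q (x + θ) (s - (x + θ))) w)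
      fun w hw => ?_)
    (Finset.sum_le_sum_of_subset_of_nonneg (Finset.filter_subset _ _)
      fun w _ _ => mul_nonneg (Real.exp_pos _).le (Real.exp_pos _).le)
  obtain ⟨hw, hdev⟩ := Finset.mem_filter.1 hw
  have hlen' : (k₀ : ℝ) ≤ w.length := by exact_mod_cast hlen w hw
  rw [wordWeight, wordWeight, ← Real.exp_add]
  refine Real.exp_le_exp.2 ?_
  have h1 := mul_le_mul_of_nonneg_left hlen' hd0.le
  have h2 := mul_le_mul_of_nonneg_right hr (Nat.cast_nonneg (α := ℝ) w.length)
  have h3 : |θ| * (η * w.length) = d * w.length + d * w.length := by rw [hd]; ring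
  nlinarith

/-- The growth rate of the sums of the modified singular value function over sections. -/
theorem exists_growth_rate [Nonempty V] {p : E → ℝ} (hp : ∀ e, 0 < p e)
    (hconn : G.StronglyConnected) (q α β s : ℝ) :
    ∃ r : ℝ, (∃ C, ∀ v S, G.IsSection v S →
        ∑ w ∈ S, G.wordPhi p q α β s w * Real.exp (-r * w.length) ≤ C) ∧
      (∀ ε > 0, ∃ c > 0, ∃ k₀ : ℕ, ∀ v S, G.IsSection v S → (∀ w ∈ S, k₀ ≤ w.length) →
        c ≤ ∑ w ∈ S, G.wordPhi p q α β s w * Real.exp ((-r + ε) * w.length)) ∧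
      (s ≤ α + β → r = max (G.logRad p q α (s - α)) (G.logRad p q (s - β) β)) ∧
      (α + β ≤ s → ∃ x ∈ Set.Icc α (s - β), r = G.logRad p q x (s - x) ∧
        (∀ x' ∈ Set.Icc α (s - β), r ≤ G.logRad p q x' (s - x')) ∧
        (α < x → G.drift p q x (s - x) ≤ 0) ∧ (x < s - β → 0 ≤ G.drift p q x (s - x))) := by
  classical
  -- With A, B for `logA w`, `logB w`, the two exponents in `wordPhi` differ by (α + β - s)(A - B).
  -- Hence `wordPhi` is the larger of two multiplicative weights in the first case and the smaller
  -- one in the second.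
  rcases lt_or_ge s (α + β) with hs | hs
  · obtain ⟨cA, hcA, CA, hCA, hA⟩ := G.exists_section_bounds hp hconn q α (s - α)
    obtain ⟨cB, hcB, CB, hCB, hB⟩ := G.exists_section_bounds hp hconn q (s - β) β
    set rA := G.logRad p q α (s - α)
    set rB := G.logRad p q (s - β) β
    refine ⟨max rA rB, ⟨CA + CB, fun v S hS => ?_⟩, fun ε hε => ?_, fun _ => rfl,
      fun h => absurd hs (not_lt.2 h)⟩
    · refine le_trans ?_ (add_le_add (hA v S hS).2 (hB v S hS).2)
      rw [← Finset.sum_add_distrib]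
      refine Finset.sum_le_sum fun w _ => ?_
      have hn : (0 : ℝ) ≤ w.length := Nat.cast_nonneg _
      rw [wordPhi, ← Real.exp_add]
      split_ifs with hw
      · refine le_trans (Real.exp_le_exp.2 ?_) (le_add_of_nonneg_right (Real.exp_pos _).le)
        nlinarith [mul_le_mul_of_nonneg_right (le_max_left rA rB) hn]
      · refine le_trans (Real.exp_le_exp.2 ?_) (le_add_of_nonneg_left (Real.exp_pos _).le)
        nlinarith [mul_le_mul_of_nonneg_right (le_max_right rA rB) hn]
    -- `wordPhi` dominates both weights, so the one with the larger radius alone gives the lower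
    -- bound, even without the loss ε.
    · rcases le_total rB rA with hm | hm
      · refine ⟨cA, hcA, 0, fun v S hS _ => (hA v S hS).1.trans (Finset.sum_le_sum fun w _ => ?_)⟩
        have hn : (0 : ℝ) ≤ w.length := Nat.cast_nonneg _
        rw [wordPhi, ← Real.exp_add, max_eq_left hm]
        refine Real.exp_le_exp.2 ?_
        split_ifs with hw
        · nlinarith
        · have := not_le.1 hw
          nlinarith [mul_pos (sub_pos.2 hs) (sub_pos.2 this)]
      · refine ⟨cB, hcB, 0, fun v S hS _ => (hB v S hS).1.trans (Finset.sum_le_sum fun w _ => ?_)⟩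
        have hn : (0 : ℝ) ≤ w.length := Nat.cast_nonneg _
        rw [wordPhi, ← Real.exp_add, max_eq_right hm]
        refine Real.exp_le_exp.2 ?_
        split_ifs with hw
        · nlinarith [mul_nonneg (sub_pos.2 hs).le (sub_nonneg.2 hw)]
        · nlinarith
  · have hcont : Continuous fun x : ℝ => G.logRad p q x (s - x) :=
      Continuous.comp (g := fun z : ℝ × ℝ => G.logRad p q z.1 z.2) (f := fun x : ℝ => (x, s - x))
        (G.continuous_logRad hp hconn q) (by fun_prop)
    have hdcont : Continuous fun x : ℝ => G.drift p q x (s - x) :=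
      Continuous.comp (g := fun z : ℝ × ℝ => G.drift p q z.1 z.2) (f := fun x : ℝ => (x, s - x))
        (G.continuous_drift hp hconn q) (by fun_prop)
    -- For x in this interval the exponent x A + (s - x) B is a convex combination of the two
    -- exponents, hence at least their minimum. The minimizer gives the best upper bound; the rest
    -- shows that it is sharp.
    obtain ⟨x, hx, hmin⟩ := isCompact_Icc.exists_isMinOn
      (f := fun x : ℝ => G.logRad p q x (s - x))
      (Set.nonempty_Icc.2 (by linarith : α ≤ s - β)) hcont.continuousOn
    replace hmin : ∀ x' ∈ Set.Icc α (s - β), G.logRad p q x (s - x) ≤ G.logRad p q x' (s - x') :=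
      fun x' hx' => hmin hx'
    -- A positive drift would persist slightly to the left of x, and the subgradient inequality
    -- there would make `logRad` smaller than at the minimizer.
    have hdup : α < x → G.drift p q x (s - x) ≤ 0 := by
      intro hlt
      by_contra! hpos
      have h1 : ∀ᶠ z in 𝓝[<] x, 0 < G.drift p q z (s - z) :=
        nhdsWithin_le_nhds (hdcont.tendsto x (lt_mem_nhds hpos))
      obtain ⟨z, hz, hz'⟩ := (h1.and (Ioo_mem_nhdsLT hlt)).exists
      have h2 := G.drift_mul_le hp hconn q s x z
      have h3 := hmin z ⟨hz'.1.le, hz'.2.le.trans hx.2⟩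
      nlinarith [mul_pos (sub_pos.2 hz'.2) hz]
    have hddown : x < s - β → 0 ≤ G.drift p q x (s - x) := by
      intro hlt
      by_contra! hneg
      have h1 : ∀ᶠ z in 𝓝[>] x, G.drift p q z (s - z) < 0 :=
        nhdsWithin_le_nhds (hdcont.tendsto x (gt_mem_nhds hneg))
      obtain ⟨z, hz, hz'⟩ := (h1.and (Ioo_mem_nhdsGT hlt)).exists
      have h2 := G.drift_mul_le hp hconn q s x z
      have h3 := hmin z ⟨hx.1.trans hz'.1.le, hz'.2.le⟩
      nlinarith [mul_pos (sub_pos.2 hz'.1) (neg_pos.2 hz)]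
    obtain ⟨c, hc, C, hC, hsec⟩ := G.exists_section_bounds hp hconn q x (s - x)
    refine ⟨G.logRad p q x (s - x), ⟨C, fun v S hS => ?_⟩, fun ε hε => ?_, fun h => ?_, fun _ =>
      ⟨x, hx, rfl, hmin, hdup, hddown⟩⟩
    · refine le_trans (Finset.sum_le_sum fun w _ => ?_) (hsec v S hS).2
      rw [wordPhi, ← Real.exp_add]
      refine Real.exp_le_exp.2 ?_
      split_ifs with hw
      · nlinarith [mul_nonneg (sub_nonneg.2 hx.1) (sub_nonneg.2 hw)]
      · nlinarith [mul_nonneg (sub_nonneg.2 hx.2) (sub_pos.2 (not_le.1 hw)).le]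
    -- If |A - B| is at most η times the length, the exponents of `wordPhi` and of the weight at x
    -- differ by at most ε times the length. The summand 1 keeps the denominator positive when s = α
    -- + β.
    · set η := ε / (s - β - α + 1) with hη
      have hden : 0 < s - β - α + 1 := by linarith
      have hη0 : 0 < η := div_pos hε hden
      have hηε : η * (s - β - α + 1) = ε := div_mul_cancel₀ _ hden.ne'
      -- The condition α < x belongs to the filter because for x = α the weight agrees with
      -- `wordPhi`, up to normalization, on all words with A ≥ B. Deviations upwards are then
      -- harmless and need not be rare.
      have hup : ∃ k₀ : ℕ, ∀ v S, G.IsSection v S → (∀ w ∈ S, k₀ ≤ w.length) →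
          ∑ w ∈ S with α < x ∧ η * w.length < G.logA w - G.logB w,
            G.wordWeight p q x (s - x) (G.logRad p q x (s - x)) w ≤ c / 4 := by
        by_cases hlt : α < x
        · have h1 : ∀ᶠ z in 𝓝[>] x, G.drift p q z (s - z) < η / 2 :=
            nhdsWithin_le_nhds (hdcont.tendsto x
              (gt_mem_nhds ((hdup hlt).trans_lt (half_pos hη0))))
          -- The subgradient at z, rather than at x, bounds the growth of `logRad` from x to z by (z
          -- - x) η/2, as `exists_deviation_bound` requires.
          obtain ⟨z, hz, hz'⟩ := (h1.and self_mem_nhdsWithin).exists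
          have hz' : x < z := hz'
          have hθ : 0 < z - x := sub_pos.2 hz'
          obtain ⟨k₀, hk₀⟩ := G.exists_deviation_bound hp hconn q s x (z - x) (η := η) hθ.ne' hη0
            (by
              rw [add_sub_cancel, abs_of_pos hθ]
              have h2 := G.drift_mul_le hp hconn q s x z
              nlinarith [mul_lt_mul_of_pos_left hz hθ]) (κ := c / 4) (by positivity)
          refine ⟨k₀, fun v S hS hlen => le_trans (le_of_eq ?_) (hk₀ v S hS hlen)⟩
          refine Finset.sum_congr (Finset.filter_congr fun w _ => ?_) fun _ _ => rfl
          rw [abs_of_pos hθ, mul_lt_mul_iff_right₀ hθ]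
          exact and_iff_right hlt
        · exact ⟨0, fun v S _ _ => by simp [hlt]; positivity⟩
      have hdown : ∃ k₀ : ℕ, ∀ v S, G.IsSection v S → (∀ w ∈ S, k₀ ≤ w.length) →
          ∑ w ∈ S with x < s - β ∧ G.logA w - G.logB w < -(η * w.length),
            G.wordWeight p q x (s - x) (G.logRad p q x (s - x)) w ≤ c / 4 := by
        by_cases hlt : x < s - β
        · have h1 : ∀ᶠ z in 𝓝[<] x, -(η / 2) < G.drift p q z (s - z) :=
            nhdsWithin_le_nhds (hdcont.tendsto x
              (lt_mem_nhds ((neg_neg_of_pos (half_pos hη0)).trans_le (hddown hlt))))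
          obtain ⟨z, hz, hz'⟩ := (h1.and self_mem_nhdsWithin).exists
          have hz' : z < x := hz'
          have hθ : z - x < 0 := sub_neg.2 hz'
          obtain ⟨k₀, hk₀⟩ := G.exists_deviation_bound hp hconn q s x (z - x) (η := η) hθ.ne hη0
            (by
              rw [add_sub_cancel, abs_of_neg hθ]
              have h2 := G.drift_mul_le hp hconn q s x z
              nlinarith [mul_lt_mul_of_pos_left hz (neg_pos.2 hθ)]) (κ := c / 4) (by positivity)
          refine ⟨k₀, fun v S hS hlen => le_trans (le_of_eq ?_) (hk₀ v S hS hlen)⟩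
          refine Finset.sum_congr (Finset.filter_congr fun w _ => ?_) fun _ _ => rfl
          rw [abs_of_neg hθ, neg_mul_comm, mul_lt_mul_left_of_neg hθ]
          exact and_iff_right hlt
        · exact ⟨0, fun v S _ _ => by simp [hlt]; positivity⟩
      obtain ⟨k₁, hk₁⟩ := hup
      obtain ⟨k₂, hk₂⟩ := hdown
      -- The two kinds of deviation take away at most c/4 each from a total weight of at least c.
      refine ⟨c / 2, half_pos hc, max k₁ k₂, fun v S hS hlen => ?_⟩
      have e1 := hk₁ v S hS fun w hw => (le_max_left _ _).trans (hlen w hw)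
      have e2 := hk₂ v S hS fun w hw => (le_max_right _ _).trans (hlen w hw)
      have e3 := (hsec v S hS).1
      rw [Finset.sum_filter] at e1 e2
      have e4 : ∑ w ∈ S, G.wordWeight p q x (s - x) (G.logRad p q x (s - x)) w ≤
          ∑ w ∈ S, G.wordPhi p q α β s w *
            Real.exp ((-G.logRad p q x (s - x) + ε) * w.length) +
          ∑ w ∈ S, (if α < x ∧ η * w.length < G.logA w - G.logB w then
            G.wordWeight p q x (s - x) (G.logRad p q x (s - x)) w else 0) +
          ∑ w ∈ S, (if x < s - β ∧ G.logA w - G.logB w < -(η * w.length) then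
            G.wordWeight p q x (s - x) (G.logRad p q x (s - x)) w else 0) := by
        rw [← Finset.sum_add_distrib, ← Finset.sum_add_distrib]
        refine Finset.sum_le_sum fun w _ => ?_
        have hn : (0 : ℝ) ≤ w.length := Nat.cast_nonneg _
        have hwpos : 0 < G.wordWeight p q x (s - x) (G.logRad p q x (s - x)) w := Real.exp_pos _
        have hppos : 0 < G.wordPhi p q α β s w *
          Real.exp ((-G.logRad p q x (s - x) + ε) * w.length) :=
          mul_pos (Real.exp_pos _) (Real.exp_pos _)
        by_cases hu : α < x ∧ η * w.length < G.logA w - G.logB w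
        · rw [if_pos hu]
          split_ifs <;> linarith
        by_cases hd : x < s - β ∧ G.logA w - G.logB w < -(η * w.length)
        · rw [if_pos hd, if_neg hu]
          linarith
        rw [if_neg hu, if_neg hd, add_zero, add_zero, wordPhi, ← Real.exp_add]
        refine Real.exp_le_exp.2 ?_
        have hεn : 0 ≤ η * w.length := by positivity
        have hsplit : ε * w.length = η * w.length * (s - β - α + 1) := by rw [← hηε]; ring
        split_ifs with hw
        · have : (x - α) * (G.logA w - G.logB w) ≤ ε * w.length := by
            rcases hx.1.eq_or_lt with h0 | h0
            · rw [← h0, sub_self, zero_mul]; positivity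
            · have h4 : G.logA w - G.logB w ≤ η * w.length := by
                by_contra h; exact hu ⟨h0, not_le.1 h⟩
              rw [hsplit]
              nlinarith [mul_le_mul_of_nonneg_left h4 (sub_pos.2 h0).le, hx.2,
                mul_nonneg hεn (sub_nonneg.2 hx.2)]
          linarith
        · have : -((s - β - x) * (G.logA w - G.logB w)) ≤ ε * w.length := by
            rcases hx.2.eq_or_lt with h0 | h0
            · rw [← h0, sub_self, zero_mul, neg_zero]; positivity
            · have h4 : -(η * w.length) ≤ G.logA w - G.logB w := by
                by_contra h; exact hd ⟨h0, not_le.1 h⟩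
              rw [hsplit]
              nlinarith [mul_le_mul_of_nonneg_left h4 (sub_pos.2 h0).le, hx.1,
                mul_nonneg hεn (sub_nonneg.2 hx.1)]
          linarith
      linarith
    -- The two regimes overlap only in s = α + β, where the interval shrinks to the point α.
    · have hsα : s = α + β := le_antisymm h hs
      have hxα : x = α := le_antisymm (by have := hx.2; linarith) hx.1
      rw [hxα, hsα]
      simp

end BoxLikeGIFS

end

/-! ### Growth rate of the level sums as a function of s. -/

noncomputable section

/-- The exponential growth rate of a sequence from two-sided exponential bounds. -/
theorem tendsto_log_div_of_exp_bounds {Z : ℕ → ℝ} {r : ℝ} (hZ : ∀ k, 0 < Z k)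
    (hup : ∃ C, ∀ k : ℕ, Z k * Real.exp (-r * k) ≤ C)
    (hlow : ∀ ε > 0, ∃ c > 0, ∃ k₀ : ℕ, ∀ k ≥ k₀, c ≤ Z k * Real.exp ((-r + ε) * k)) :
    Tendsto (fun k : ℕ => Real.log (Z k) / k) atTop (𝓝 r) := by
  obtain ⟨C, hC⟩ := hup
  have hlim : ∀ c : ℝ, Tendsto (fun k : ℕ => c / (k : ℝ)) atTop (𝓝 0) := fun c =>
    tendsto_const_nhds.div_atTop tendsto_natCast_atTop_atTop
  rw [tendsto_order]
  constructor
  · intro r' hr'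
    obtain ⟨c, hc, k₀, hk₀⟩ := hlow ((r - r') / 2) (by linarith)
    have h1 : ∀ᶠ k : ℕ in atTop, -((r - r') / 2) < Real.log c / k :=
      (hlim _).eventually (lt_mem_nhds (by linarith))
    filter_upwards [h1, eventually_ge_atTop k₀, eventually_gt_atTop 0] with k h2 h3 h4
    have hk : (0 : ℝ) < k := by exact_mod_cast h4
    have h5 := Real.log_le_log hc (hk₀ k h3)
    rw [Real.log_mul (hZ k).ne' (Real.exp_pos _).ne', Real.log_exp] at h5
    rw [lt_div_iff₀ hk] at h2 ⊢
    nlinarith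
  · intro r' hr'
    have hC0 : 0 < C := lt_of_lt_of_le (mul_pos (hZ 0) (Real.exp_pos _)) (hC 0)
    have h1 : ∀ᶠ k : ℕ in atTop, Real.log C / k < r' - r :=
      (hlim _).eventually (gt_mem_nhds (by linarith))
    filter_upwards [h1, eventually_gt_atTop 0] with k h2 h4
    have hk : (0 : ℝ) < k := by exact_mod_cast h4
    have h5 := Real.log_le_log (mul_pos (hZ k) (Real.exp_pos _)) (hC k)
    rw [Real.log_mul (hZ k).ne' (Real.exp_pos _).ne', Real.log_exp] at h5
    rw [div_lt_iff₀ hk] at h2 ⊢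
    nlinarith

namespace BoxLikeGIFS

variable {V E : Type*} (G : BoxLikeGIFS V E) [DecidableEq V] [Fintype E]

theorem levelWords_nonempty {G : BoxLikeGIFS V E} (hconn : G.StronglyConnected) (k : ℕ) (v : V) :
    (G.levelWords k v).Nonempty := by
  induction k generalizing v with
  | zero => exact ⟨[], Finset.mem_singleton_self _⟩
  | succ k ih =>
    obtain ⟨e, he⟩ := hconn.exists_src v
    obtain ⟨w, hw⟩ := ih (G.tgt e)
    exact ⟨e :: w, G.mem_extendWords.2 ⟨e, w, he, hw, rfl⟩⟩

variable [Fintype V]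

/-- The sum of the modified singular value function over all words of length `k`. -/
def levelSum (p : E → ℝ) (q α β s : ℝ) (k : ℕ) : ℝ :=
  ∑ v, ∑ w ∈ G.levelWords k v, G.wordPhi p q α β s w

theorem levelSum_pos [Nonempty V] (hconn : G.StronglyConnected) (p : E → ℝ) (q α β s : ℝ) (k : ℕ) :
    0 < G.levelSum p q α β s k :=
  Finset.sum_pos (fun v _ => Finset.sum_pos (fun _ _ => Real.exp_pos _)
    (levelWords_nonempty hconn k v)) Finset.univ_nonempty

variable [DecidableEq E]

/-- The rate of growth of the sums of the modified singular value function. -/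
def growthRate [Nonempty V] {p : E → ℝ} (hp : ∀ e, 0 < p e) (hconn : G.StronglyConnected)
    (q α β s : ℝ) : ℝ := (G.exists_growth_rate hp hconn q α β s).choose

/-- The words of length k form a section of constant length, so the exponential factor leaves the
sum. The lower bound needs only one vertex. -/
theorem tendsto_log_levelSum [Nonempty V] {p : E → ℝ} (hp : ∀ e, 0 < p e)
    (hconn : G.StronglyConnected) (q α β s : ℝ) :
    Tendsto (fun k : ℕ => Real.log (G.levelSum p q α β s k) / k) atTop
      (𝓝 (G.growthRate hp hconn q α β s)) := by
  obtain ⟨⟨C, hC⟩, hlow, -⟩ := (G.exists_growth_rate hp hconn q α β s).choose_spec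
  have hlen : ∀ (k : ℕ) (v : V) (t : ℝ), ∑ w ∈ G.levelWords k v,
      G.wordPhi p q α β s w * Real.exp (t * w.length) =
      (∑ w ∈ G.levelWords k v, G.wordPhi p q α β s w) * Real.exp (t * k) := by
    intro k v t
    rw [Finset.sum_mul]
    exact Finset.sum_congr rfl fun w hw => by rw [(G.mem_levelWords.1 hw).1]
  refine tendsto_log_div_of_exp_bounds (G.levelSum_pos hconn p q α β s)
    ⟨Fintype.card V • C, fun k => ?_⟩ fun ε hε => ?_
  · rw [levelSum, Finset.sum_mul]
    refine Finset.sum_le_card_nsmul _ _ C fun v _ => ?_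
    have := hC v _ (G.isSection_levelWords k v)
    rwa [hlen] at this
  · obtain ⟨c, hc, k₀, hk₀⟩ := hlow ε hε
    refine ⟨c, hc, k₀, fun k hk => ?_⟩
    obtain ⟨v⟩ := ‹Nonempty V›
    have h1 := hk₀ v _ (G.isSection_levelWords k v) fun w hw => by
      rwa [(G.mem_levelWords.1 hw).1]
    rw [hlen] at h1
    refine h1.trans (mul_le_mul_of_nonneg_right ?_ (Real.exp_pos _).le)
    exact Finset.single_le_sum (f := fun v => ∑ w ∈ G.levelWords k v, G.wordPhi p q α β s w)
      (fun v _ => Finset.sum_nonneg fun _ _ => (Real.exp_pos _).le) (Finset.mem_univ v)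

/-- The rate of growth decreases in `s` at a linear speed. -/
theorem exists_growthRate_slope [Nonempty V] {p : E → ℝ} (hp : ∀ e, 0 < p e)
    (hconn : G.StronglyConnected) (q α β : ℝ) : ∃ c > 0, ∃ C > 0, ∀ s s', s ≤ s' →
      c * (s' - s) ≤ G.growthRate hp hconn q α β s - G.growthRate hp hconn q α β s' ∧
      G.growthRate hp hconn q α β s - G.growthRate hp hconn q α β s' ≤ C * (s' - s) := by
  have := hconn.nonempty_edge
  obtain ⟨c, hc, C, hC, hcC⟩ := G.exists_log_bounds
  refine ⟨c, hc, C, hC, fun s s' hs => ?_⟩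
  -- Raising s multiplies `wordPhi` by a power of the short side, whose logarithm lies between -C
  -- and -c times the length.
  have hphi : ∀ w, G.wordPhi p q α β s' w ≤
      G.wordPhi p q α β s w * Real.exp (-(c * (s' - s)) * w.length) ∧
      G.wordPhi p q α β s w * Real.exp (-(C * (s' - s)) * w.length) ≤ G.wordPhi p q α β s' w := by
    intro w
    have hA := wsum_bounds (l := fun e => Real.log (G.a e)) (c := -C) (C := -c)
      (fun e => ⟨by linarith [(hcC e).1.2], by linarith [(hcC e).1.1]⟩) w
    have hB := wsum_bounds (l := fun e => Real.log (G.b e)) (c := -C) (C := -c)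
      (fun e => ⟨by linarith [(hcC e).2.2], by linarith [(hcC e).2.1]⟩) w
    change -C * w.length ≤ G.logA w ∧ G.logA w ≤ -c * w.length at hA
    change -C * w.length ≤ G.logB w ∧ G.logB w ≤ -c * w.length at hB
    have hs' := sub_nonneg.2 hs
    rw [wordPhi, wordPhi, ← Real.exp_add, ← Real.exp_add]
    constructor <;> refine Real.exp_le_exp.2 ?_ <;> split_ifs
    · nlinarith [mul_le_mul_of_nonneg_left hB.2 hs']
    · nlinarith [mul_le_mul_of_nonneg_left hA.2 hs']
    · nlinarith [mul_le_mul_of_nonneg_left hB.1 hs']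
    · nlinarith [mul_le_mul_of_nonneg_left hA.1 hs']
  have hsum : ∀ (k : ℕ) (t : ℝ), ∑ v, ∑ w ∈ G.levelWords k v,
      G.wordPhi p q α β s w * Real.exp (t * w.length) =
      G.levelSum p q α β s k * Real.exp (t * k) := by
    intro k t
    rw [levelSum, Finset.sum_mul]
    refine Finset.sum_congr rfl fun v _ => ?_
    rw [Finset.sum_mul]
    exact Finset.sum_congr rfl fun w hw => by rw [(G.mem_levelWords.1 hw).1]
  have hlog : ∀ (k : ℕ) (t : ℝ), 0 < k →
      Real.log (G.levelSum p q α β s k * Real.exp (t * k)) / k =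
      Real.log (G.levelSum p q α β s k) / k + t := by
    intro k t hk
    have : (k : ℝ) ≠ 0 := by exact_mod_cast hk.ne'
    rw [Real.log_mul (G.levelSum_pos hconn p q α β s k).ne' (Real.exp_pos _).ne', Real.log_exp]
    field_simp
  have ht := G.tendsto_log_levelSum hp hconn q α β s
  have ht' := G.tendsto_log_levelSum hp hconn q α β s'
  constructor
  · have h1 := le_of_tendsto_of_tendsto ht' (ht.add_const (-(c * (s' - s)))) (by
      filter_upwards [eventually_gt_atTop 0] with k hk
      rw [← hlog k _ hk, ← hsum]
      refine div_le_div_of_nonneg_right (Real.log_le_log (G.levelSum_pos hconn p q α β s' k) ?_)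
        (Nat.cast_nonneg k)
      exact Finset.sum_le_sum fun v _ => Finset.sum_le_sum fun w _ => (hphi w).1)
    linarith
  · have h1 := le_of_tendsto_of_tendsto (ht.add_const (-(C * (s' - s)))) ht' (by
      filter_upwards [eventually_gt_atTop 0] with k hk
      rw [← hlog k _ hk]
      refine div_le_div_of_nonneg_right (Real.log_le_log
        (mul_pos (G.levelSum_pos hconn p q α β s k) (Real.exp_pos _)) ?_) (Nat.cast_nonneg k)
      rw [← hsum]
      exact Finset.sum_le_sum fun v _ => Finset.sum_le_sum fun w _ => (hphi w).2)
    linarith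

theorem exists_growthRate_zero [Nonempty V] {p : E → ℝ} (hp : ∀ e, 0 < p e)
    (hconn : G.StronglyConnected) (q α β : ℝ) :
    ∃ γ, ∀ s, G.growthRate hp hconn q α β s = 0 ↔ s = γ := by
  obtain ⟨c, hc, C, hC, h⟩ := G.exists_growthRate_slope hp hconn q α β
  refine exists_forall_eq_zero_iff ?_ hc fun s s' hs => (h s s' hs).1
  refine (LipschitzWith.of_dist_le_mul (K := C.toNNReal) fun s s' => ?_).continuous
  rw [Real.coe_toNNReal C hC.le, Real.dist_eq, Real.dist_eq]
  rcases le_total s s' with hs | hs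
  · have := h s s' hs
    rw [abs_of_nonneg (by nlinarith), abs_sub_comm, abs_of_nonneg (by linarith)]
    exact this.2
  · have := h s' s hs
    rw [abs_sub_comm, abs_of_nonneg (by nlinarith), abs_of_nonneg (by linarith)]
    exact this.2

end BoxLikeGIFS

end

/-! ### The curve ρ(F_{x,y}) = 1 and the formulas for γ. -/

noncomputable section

namespace BoxLikeGIFS

variable {V E : Type*} (G : BoxLikeGIFS V E) [DecidableEq V] [Fintype E] [DecidableEq E]

/-- `logRad` decreases at a linear speed in both variables. -/
theorem exists_logRad_slope [Nonempty V] {p : E → ℝ} (hp : ∀ e, 0 < p e)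
    (hconn : G.StronglyConnected) (q : ℝ) : ∃ c > 0, ∀ x y x' y', x ≤ x' → y ≤ y' →
      c * ((x' - x) + (y' - y)) ≤ G.logRad p q x y - G.logRad p q x' y' := by
  obtain ⟨c, hc, C, hC, h⟩ := G.exists_mean_bounds hp hconn q
  refine ⟨c, hc, fun x y x' y' hx hy => ?_⟩
  have h1 := G.logRad_sub_ge hp hconn q x y x' y'
  have h2 := h x' y'
  nlinarith [mul_le_mul_of_nonneg_left h2.1.1 (sub_nonneg.2 hx),
    mul_le_mul_of_nonneg_left h2.2.1 (sub_nonneg.2 hy)]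

/-- The zero of the growth rate in terms of the curve `ρ(F_{x,y}) = 1`. -/
theorem exists_variational_formula [Fintype V] [Nonempty V] {p : E → ℝ} (hp : ∀ e, 0 < p e)
    (hconn : G.StronglyConnected) (q α β : ℝ) :
    ∃ (γA γB γ : ℝ) (Y : ℝ → ℝ) (f : ℝ → E → ℝ),
      (∀ s, specRadius (G.F p q α (s - α)) = 1 ↔ s = γA) ∧
      (∀ s, specRadius (G.F p q (s - β) β) = 1 ↔ s = γB) ∧
      (∀ x y, specRadius (G.F p q x y) = 1 ↔ y = Y x) ∧
      (∀ x g, IsPerronProduct (G.F p q x (Y x)) g ↔ g = f x) ∧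
      (∀ s, G.growthRate hp hconn q α β s = 0 ↔ s = γ) ∧
      (max γA γB ≤ α + β ∨ α + β ≤ min γA γB) ∧
      (max γA γB ≤ α + β →
        γ = max γA γB ∧
        IsGreatest {s | ∃ x y, specRadius (G.F p q x y) = 1 ∧
          γB - β ≤ x ∧ x ≤ α ∧ s = x + y} γ ∧
        IsGreatest {s | ∃ x y, specRadius (G.F p q x y) = 1 ∧
          γA - α ≤ y ∧ y ≤ β ∧ s = x + y} γ) ∧
      (α + β ≤ min γA γB →
        IsLeast {s | ∃ x y, specRadius (G.F p q x y) = 1 ∧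
          α ≤ x ∧ x ≤ γB - β ∧ s = x + y} γ ∧
        IsLeast {s | ∃ x y, specRadius (G.F p q x y) = 1 ∧
          β ≤ y ∧ y ≤ γA - α ∧ s = x + y} γ ∧
        (0 ≤ ∑ e, f α e * Real.log (G.a e / G.b e) → γ = γA) ∧
        (∑ e, f (γB - β) e * Real.log (G.a e / G.b e) ≤ 0 → γ = γB) ∧
        (¬ 0 ≤ ∑ e, f α e * Real.log (G.a e / G.b e) →
          ¬ ∑ e, f (γB - β) e * Real.log (G.a e / G.b e) ≤ 0 →
          ∃ x ∈ Set.Icc α (γB - β), ∃ y ∈ Set.Icc β (γA - α),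
            specRadius (G.F p q x y) = 1 ∧
            ∑ e, f x e * Real.log (G.a e / G.b e) = 0 ∧ γ = x + y)) := by
  have := hconn.nonempty_edge
  obtain ⟨c, hc, hslope⟩ := G.exists_logRad_slope hp hconn q
  have hR := G.continuous_logRad hp hconn q
  -- Along a path that is monotone in both coordinates and along which their sum grows at unit
  -- speed, `logRad` falls at least at speed c. Horizontal and vertical lines then give γA, γB and Y
  -- at once.
  have hzero : ∀ u w : ℝ → ℝ, Continuous u → Continuous w → (∀ s s', s ≤ s' → u s ≤ u s' ∧ w s ≤ w s' ∧
      s' - s = (u s' - u s) + (w s' - w s)) → ∃ r, ∀ s, specRadius (G.F p q (u s) (w s)) = 1 ↔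
        s = r := by
    intro u w hu hw h
    obtain ⟨r, hr⟩ := exists_forall_eq_zero_iff (g := fun s => G.logRad p q (u s) (w s))
      (Continuous.comp (g := fun z : ℝ × ℝ => G.logRad p q z.1 z.2) (f := fun s => (u s, w s))
        hR (hu.prodMk hw)) hc
      (fun s s' hs => by
        obtain ⟨h1, h2, h3⟩ := h s s' hs
        rw [h3]
        exact hslope _ _ _ _ h1 h2)
    exact ⟨r, fun s => (G.specRadius_F_eq_one_iff hp hconn q _ _).trans (hr s)⟩
  obtain ⟨γA, hγA⟩ := hzero (fun _ => α) (fun s => s - α) continuous_const (by fun_prop)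
    fun s s' hs => ⟨le_rfl, by linarith, by ring⟩
  obtain ⟨γB, hγB⟩ := hzero (fun s => s - β) (fun _ => β) (by fun_prop) continuous_const
    fun s s' hs => ⟨by linarith, le_rfl, by ring⟩
  choose Y hY using fun x => hzero (fun _ => x) (fun s => s) continuous_const (by fun_prop)
    fun s s' hs => ⟨le_rfl, hs, by ring⟩
  obtain ⟨γ, hγ⟩ := G.exists_growthRate_zero hp hconn q α β
  obtain ⟨d, hd, D, hD, hgr⟩ := G.exists_growthRate_slope hp hconn q α β
  have hiff := G.specRadius_F_eq_one_iff hp hconn q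
  refine ⟨γA, γB, γ, Y, fun x => perronProduct (G.F p q x (Y x)), hγA, hγB, hY, fun x g => ?_, hγ, ?_⟩
  · refine isPerronProduct_iff (G.F_isIrreducible hp hconn q x (Y x)) ?_ g
    rw [G.perronRoot_F_eq_exp hp hconn, (hiff _ _).1 ((hY x _).2 rfl), Real.exp_zero]
  -- basic properties of the curve
  have hA0 : G.logRad p q α (γA - α) = 0 := (hiff _ _).1 ((hγA γA).2 rfl)
  have hB0 : G.logRad p q (γB - β) β = 0 := (hiff _ _).1 ((hγB γB).2 rfl)
  have hYA : Y α = γA - α := ((hY α _).1 ((hγA γA).2 rfl)).symm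
  have hYB : Y (γB - β) = β := ((hY (γB - β) _).1 ((hγB γB).2 rfl)).symm
  have hanti : ∀ x y x' y', G.logRad p q x y = 0 → G.logRad p q x' y' = 0 → x ≤ x' → y' ≤ y := by
    intro x y x' y' h1 h2 hx
    by_contra! hlt
    have := hslope x y x' y' hx hlt.le
    rw [h1, h2] at this
    nlinarith
  have hanti' : ∀ x y x' y', G.logRad p q x y = 0 → G.logRad p q x' y' = 0 → y ≤ y' → x' ≤ x := by
    intro x y x' y' h1 h2 hy
    by_contra! hlt
    have := hslope x y x' y' hlt.le hy
    rw [h1, h2] at this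
    nlinarith
  have hcaseA : ∀ s, G.logRad p q α (s - α) ≤ 0 ↔ γA ≤ s := by
    intro s
    constructor
    · intro h
      by_contra! hlt
      have := hslope α (s - α) α (γA - α) le_rfl (by linarith)
      nlinarith
    · intro h
      have := hslope α (γA - α) α (s - α) le_rfl (by linarith)
      nlinarith
  have hcaseB : ∀ s, G.logRad p q (s - β) β ≤ 0 ↔ γB ≤ s := by
    intro s
    constructor
    · intro h
      by_contra! hlt
      have := hslope (s - β) β (γB - β) β (by linarith) le_rfl
      nlinarith
    · intro h
      have := hslope (γB - β) β (s - β) β (by linarith) le_rfl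
      nlinarith
  -- Both γA ≤ α + β and γB ≤ α + β say that `logRad` is at most 0 at the single point (α, β). This
  -- is the source of the dichotomy.
  have hAt : γA ≤ α + β ↔ G.logRad p q α β ≤ 0 := by
    rw [← hcaseA, add_sub_cancel_left]
  have hBt : γB ≤ α + β ↔ G.logRad p q α β ≤ 0 := by
    rw [← hcaseB, add_sub_cancel_right]
  have hmono : ∀ s s', G.growthRate hp hconn q α β s ≤ G.growthRate hp hconn q α β s' → s' ≤ s := by
    intro s s' h
    by_contra! hlt
    have := (hgr s s' hlt.le).1
    nlinarith
  have hspec := fun s => (G.exists_growth_rate hp hconn q α β s).choose_spec.2.2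
  change ∀ s, (s ≤ α + β → G.growthRate hp hconn q α β s = max _ _) ∧ (α + β ≤ s →
    ∃ x ∈ Set.Icc α (s - β), G.growthRate hp hconn q α β s = _ ∧
      (∀ x' ∈ Set.Icc α (s - β), G.growthRate hp hconn q α β s ≤ _) ∧ _) at hspec
  have hγ0 : G.growthRate hp hconn q α β γ = 0 := (hγ γ).2 rfl
  refine ⟨?_, fun ha => ?_, fun hb => ?_⟩
  · rcases le_total (G.logRad p q α β) 0 with h | h
    · exact Or.inl (max_le (hAt.2 h) (hBt.2 h))
    · right
      refine le_min ?_ ?_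
      · by_contra! hlt
        exact absurd ((hAt.1 hlt.le).antisymm h) fun h0 => by
          have := (hγA (α + β)).1 ((hiff _ _).2 (by rw [add_sub_cancel_left]; exact h0))
          linarith
      · by_contra! hlt
        exact absurd ((hBt.1 hlt.le).antisymm h) fun h0 => by
          have := (hγB (α + β)).1 ((hiff _ _).2 (by rw [add_sub_cancel_right]; exact h0))
          linarith
  · have hAle := (le_max_left _ _).trans ha
    have hBle := (le_max_right _ _).trans ha
    have hmax : γ = max γA γB := by
      refine ((hγ _).1 ?_).symm
      rw [(hspec _).1 ha]
      rcases le_total γA γB with h | h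
      · rw [max_eq_right h, hB0]
        exact max_eq_right ((hcaseA _).2 h)
      · rw [max_eq_left h, hA0]
        exact max_eq_left ((hcaseB _).2 h)
    have hmem : ∃ x y, G.logRad p q x y = 0 ∧ (γB - β ≤ x ∧ x ≤ α) ∧ (γA - α ≤ y ∧ y ≤ β) ∧
        γ = x + y := by
      rcases le_total γA γB with h | h
      · refine ⟨γB - β, β, hB0, ⟨le_rfl, by linarith⟩, ⟨by linarith, le_rfl⟩, ?_⟩
        rw [hmax, max_eq_right h]; ring
      · refine ⟨α, γA - α, hA0, ⟨by linarith, le_rfl⟩, ⟨le_rfl, by linarith⟩, ?_⟩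
        rw [hmax, max_eq_left h]; ring
    -- Convexity on the antidiagonal x + y = s: if s > γ, both of its points on the lines x = α and
    -- y = β have negative `logRad`, so a point between them cannot lie on the curve. The sign of
    -- the drift tells which end to compare with.
    have hbound : ∀ x y, G.logRad p q x y = 0 → γB - β ≤ x → x ≤ α → x + y ≤ γ := by
      intro x y h0 h1 h2
      set s := x + y with hs
      have hy : y = s - x := by rw [hs]; ring
      by_contra! hlt
      have hA : G.logRad p q α (s - α) < 0 := by
        have := hslope α (γA - α) α (s - α) le_rfl (by linarith [le_max_left γA γB])
        nlinarith [le_max_left γA γB]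
      have hB : G.logRad p q (s - β) β < 0 := by
        have := hslope (γB - β) β (s - β) β (by linarith [le_max_right γA γB]) le_rfl
        nlinarith [le_max_right γA γB]
      rw [hy] at h0
      have e1 := G.drift_mul_le hp hconn q s α x
      have e2 := G.drift_mul_le hp hconn q s (s - β) x
      rw [sub_sub_cancel] at e2
      rcases le_total 0 (G.drift p q x (s - x)) with h3 | h3
      · nlinarith [mul_nonneg (sub_nonneg.2 h2) h3]
      · have h4 : s - β ≤ x := by
          have := hanti _ _ _ _ hB0 (hy ▸ h0 : G.logRad p q x y = 0) h1
          linarith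
        nlinarith [mul_nonneg_of_nonpos_of_nonpos (sub_nonpos.2 h4) h3]
    obtain ⟨x, y, h0, hx, hy, hxy⟩ := hmem
    refine ⟨hmax, ⟨⟨x, y, (hiff _ _).2 h0, hx.1, hx.2, hxy⟩, ?_⟩,
      ⟨⟨x, y, (hiff _ _).2 h0, hy.1, hy.2, hxy⟩, ?_⟩⟩
    · rintro s ⟨x', y', h1, h2, h3, rfl⟩
      exact hbound x' y' ((hiff _ _).1 h1) h2 h3
    · rintro s ⟨x', y', h1, h2, h3, rfl⟩
      have h1' := (hiff _ _).1 h1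
      exact hbound x' y' h1' (hanti' _ _ _ _ h1' hB0 h3) (hanti' _ _ _ _ hA0 h1' h2)
  · have hAge := hb.trans (min_le_left _ _)
    have hBge := hb.trans (min_le_right _ _)
    have hRt : 0 ≤ G.logRad p q α β := by
      have := hslope α β α (γA - α) le_rfl (by linarith)
      nlinarith
    have hγt : α + β ≤ γ := by
      apply hmono
      rw [hγ0, (hspec _).1 le_rfl]
      rw [add_sub_cancel_left, add_sub_cancel_right, max_self]
      exact hRt
    -- The minimizer on the antidiagonal of γ has `logRad` equal to 0: it is the point of the curve
    -- at which γ is attained.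
    obtain ⟨x, hx, hrx, -, hdup, hddown⟩ := (hspec γ).2 hγt
    rw [hγ0] at hrx
    have hx2 : x ≤ γB - β := hanti' _ _ _ _ hB0 hrx.symm (by linarith [hx.2])
    have hy2 : γ - x ≤ γA - α := hanti _ _ _ _ hA0 hrx.symm hx.1
    -- A point of the curve on the antidiagonal of x + y shows that the growth rate at x + y, a
    -- minimum, is at most 0. Monotonicity in s concludes.
    have hbound : ∀ x y, G.logRad p q x y = 0 → α ≤ x → x ≤ γB - β → γ ≤ x + y := by
      intro x y h0 h1 h2
      have h3 : β ≤ y := hanti _ _ _ _ h0 hB0 h2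
      obtain ⟨-, -, -, hm, -⟩ := (hspec (x + y)).2 (by linarith)
      apply hmono
      rw [hγ0]
      refine (hm x ⟨h1, by linarith⟩).trans ?_
      rw [add_sub_cancel_left, h0]
    have hYx : Y x = γ - x := ((hY x _).1 ((hiff _ _).2 hrx.symm)).symm
    have hdr : ∀ x, ∑ e, perronProduct (G.F p q x (Y x)) e * Real.log (G.a e / G.b e) =
        G.drift p q x (Y x) := fun x => rfl
    refine ⟨⟨⟨x, γ - x, (hiff _ _).2 hrx.symm, hx.1, hx2, by ring⟩, ?_⟩,
      ⟨⟨x, γ - x, (hiff _ _).2 hrx.symm, by linarith [hx.2], hy2, by ring⟩, ?_⟩, ?_, ?_, ?_⟩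
    · rintro s ⟨x', y', h1, h2, h3, rfl⟩
      exact hbound x' y' ((hiff _ _).1 h1) h2 h3
    · rintro s ⟨x', y', h1, h2, h3, rfl⟩
      have h1' := (hiff _ _).1 h1
      exact hbound x' y' h1' (hanti' _ _ _ _ h1' hA0 h3) (hanti' _ _ _ _ hB0 h1' h2)
    · intro h
      rw [hdr, hYA] at h
      refine le_antisymm ?_ ?_
      · have := hbound α (γA - α) hA0 le_rfl (by linarith)
        linarith
      -- By convexity a nonnegative drift at the left end keeps `logRad` nonnegative along the
      -- antidiagonal of γA to the right of α. If γ < γA, strict decrease in y contradicts this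
      -- above the minimizer x.
      · have h1 := G.drift_mul_le hp hconn q γA x α
        rw [hA0] at h1
        by_contra! hlt
        have h2 := hslope x (γ - x) x (γA - x) le_rfl (by linarith)
        nlinarith [mul_nonneg (sub_nonneg.2 hx.1) h]
    · intro h
      rw [hdr, hYB] at h
      refine le_antisymm ?_ ?_
      · have := hbound (γB - β) β hB0 (by linarith) le_rfl
        linarith
      · have h1 := G.drift_mul_le hp hconn q γB x (γB - β)
        rw [sub_sub_cancel, hB0] at h1
        by_contra! hlt
        have h2 := hslope x (γ - x) x (γB - x) le_rfl (by linarith)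
        nlinarith [mul_nonneg_of_nonpos_of_nonpos (sub_nonpos.2 hx2) h]
    · intro h1 h2
      rw [hdr, hYA] at h1
      rw [hdr, hYB] at h2
      -- Once the minimizer is known to be interior, its two one-sided drift conditions force the
      -- drift to vanish.
      have hxα : α < x := by
        rcases hx.1.eq_or_lt with h | h
        · exfalso
          rw [← h, hYA] at hYx
          have hγA' : γ = γA := by linarith
          rw [← h, hγA'] at hddown
          -- In the degenerate case the curve passes through (α, β), so the two excluded
          -- inequalities concern the same drift and cannot both fail.
          rcases (show α ≤ γA - β by linarith).eq_or_lt with h3 | h3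
          · refine h2 ?_
            have e2 : γB - β = α := by
              refine le_antisymm ?_ (by linarith)
              refine hanti' _ _ _ _ hA0 hB0 (by linarith)
            have e3 : β = γA - α := by linarith
            rw [e2]
            have := le_of_lt (not_le.1 h1)
            rwa [e3]
          · exact h1 (hddown h3)
        · exact h
      have hxβ : x < γ - β := by
        rcases hx.2.eq_or_lt with h | h
        · exfalso
          have hx' : x = γB - β := by
            refine le_antisymm hx2 ?_
            refine hanti' _ _ _ _ hrx.symm hB0 (by linarith)
          have := hdup hxα
          rw [← hYx, hx', hYB] at this
          exact h2 this
        · exact h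
      refine ⟨x, ⟨hx.1, hx2⟩, γ - x, ⟨by linarith [hx.2], hy2⟩, (hiff _ _).2 hrx.symm, ?_, by ring⟩
      rw [hdr, hYx]
      exact le_antisymm (hdup hxα) (hddown hxβ)

end BoxLikeGIFS

end

noncomputable section

/-! ### Comparison of moment sums -/

open Classical in
/-- The power `x ^ q` with the convention that zero is sent to zero also for `q = 0`. -/
def powZ (q : ℝ) (x : ENNReal) : ENNReal := if x = 0 then 0 else x ^ q

theorem momentSum_eq_tsum_powZ {n : ℕ} (ν : Measure (Fin n → ℝ)) (q δ : ℝ) :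
    momentSum ν q δ = ∑' k, powZ q (ν (meshCube δ k)) := rfl

theorem powZ_zero (q : ℝ) : powZ q 0 = 0 := if_pos rfl

theorem powZ_of_ne_zero (q : ℝ) {x : ENNReal} (h : x ≠ 0) : powZ q x = x ^ q := if_neg h

theorem powZ_one (q : ℝ) : powZ q 1 = 1 := by rw [powZ_of_ne_zero q one_ne_zero, ENNReal.one_rpow]

theorem powZ_mono {q : ℝ} (hq : 0 ≤ q) : Monotone (powZ q) := by
  intro x y h
  by_cases hx : x = 0
  · rw [hx, powZ_zero]; exact zero_le
  · have hy : y ≠ 0 := fun h0 => hx (le_antisymm (h0 ▸ h) zero_le)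
    rw [powZ_of_ne_zero q hx, powZ_of_ne_zero q hy]
    exact ENNReal.rpow_le_rpow h hq

theorem powZ_mul {q : ℝ} (hq : 0 ≤ q) {c : ENNReal} (hc : c ≠ 0) (x : ENNReal) :
    powZ q (c * x) = c ^ q * powZ q x := by
  by_cases hx : x = 0
  · rw [hx, mul_zero, powZ_zero, mul_zero]
  · rw [powZ_of_ne_zero q hx, powZ_of_ne_zero q (mul_ne_zero hc hx), ENNReal.mul_rpow_of_nonneg _ _ hq]

/-- The sum is at most K times its largest term. This is valid for all q ≥ 0, whether the power is
convex or concave. -/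
theorem powZ_sum_le {q : ℝ} (hq : 0 ≤ q) {ι : Type*} (s : Finset ι) (y : ι → ENNReal) {K : ℕ}
    (hK : s.card ≤ K) : powZ q (∑ j ∈ s, y j) ≤ (K : ENNReal) ^ q * ∑ j ∈ s, powZ q (y j) := by
  rcases s.eq_empty_or_nonempty with rfl | hs
  · simp [powZ_zero]
  · obtain ⟨j, hj, hmax⟩ := s.exists_max_image y hs
    have hK0 : (K : ENNReal) ≠ 0 := by
      have := hs.card_pos
      exact_mod_cast (by omega : K ≠ 0)
    have h1 : ∑ j ∈ s, y j ≤ K * y j := by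
      refine (Finset.sum_le_card_nsmul s y (y j) hmax).trans ?_
      rw [nsmul_eq_mul]
      gcongr
    refine (powZ_mono hq h1).trans ?_
    rw [powZ_mul hq hK0]
    gcongr
    exact Finset.single_le_sum (f := fun j => powZ q (y j)) (fun _ _ => zero_le) hj

open Classical in
/-- Comparison of sums of powers along a relation of bounded multiplicity. -/
theorem tsum_powZ_le {q : ℝ} (hq : 0 ≤ q) {I J : Type*} (R : I → J → Prop) {x : I → ENNReal}
    {y : J → ENNReal} {K K' : ℕ} (hx : ∀ i, x i ≤ ∑' j, if R i j then y j else 0)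
    (hN : ∀ i, ∃ N : Finset J, N.card ≤ K ∧ ∀ j, R i j → j ∈ N)
    (hN' : ∀ j, ∃ N : Finset I, N.card ≤ K' ∧ ∀ i, R i j → i ∈ N) :
    ∑' i, powZ q (x i) ≤ (K : ENNReal) ^ q * K' * ∑' j, powZ q (y j) := by
  -- Each x i collects at most K of the y j; after interchanging the sums each y j is counted at
  -- most K' times.
  have h1 : ∀ i, powZ q (x i) ≤ (K : ENNReal) ^ q * ∑' j, if R i j then powZ q (y j) else 0 := by
    intro i
    obtain ⟨N, hNK, hNR⟩ := hN i
    have h2 : ∀ f : J → ENNReal, ∑' j, (if R i j then f j else 0) =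
        ∑ j ∈ N with R i j, f j := by
      intro f
      rw [Finset.sum_filter]
      exact tsum_eq_sum fun j hj => if_neg fun h => hj (hNR j h)
    rw [h2]
    refine (powZ_mono hq ((hx i).trans_eq (h2 y))).trans (powZ_sum_le hq _ _ ?_)
    exact (Finset.card_filter_le _ _).trans hNK
  calc ∑' i, powZ q (x i)
      ≤ ∑' i, (K : ENNReal) ^ q * ∑' j, (if R i j then powZ q (y j) else 0) :=
        ENNReal.tsum_le_tsum h1
    _ = (K : ENNReal) ^ q * ∑' j, ∑' i, (if R i j then powZ q (y j) else 0) := by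
        rw [ENNReal.tsum_mul_left, ENNReal.tsum_comm]
    _ ≤ (K : ENNReal) ^ q * ∑' j, K' * powZ q (y j) := by
        gcongr with j
        obtain ⟨N, hNK, hNR⟩ := hN' j
        rw [tsum_eq_sum (s := N) fun i hi => if_neg fun h => hi (hNR i h)]
        calc ∑ i ∈ N, (if R i j then powZ q (y j) else 0) ≤ ∑ i ∈ N, powZ q (y j) :=
              Finset.sum_le_sum fun i _ => by split_ifs <;> simp
          _ = N.card * powZ q (y j) := by rw [Finset.sum_const, nsmul_eq_mul]
          _ ≤ _ := by gcongr
    _ = _ := by rw [ENNReal.tsum_mul_left, mul_assoc]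

/-- A set of integer vectors of bounded diameter is contained in a finite set of bounded
cardinality. -/
theorem exists_finset_of_pairwise_le {n : ℕ} (T : (Fin n → ℤ) → Prop) (M : ℕ)
    (h : ∀ k k', T k → T k' → ∀ i, k i ≤ k' i + M) :
    ∃ N : Finset (Fin n → ℤ), N.card ≤ (2 * M + 1) ^ n ∧ ∀ k, T k → k ∈ N := by
  by_cases hT : ∃ k₀, T k₀
  · obtain ⟨k₀, hk₀⟩ := hT
    refine ⟨Fintype.piFinset fun i => Finset.Icc (k₀ i - M) (k₀ i + M), ?_, fun k hk => ?_⟩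
    · rw [Fintype.card_piFinset]
      simp only [Int.card_Icc]
      have : ∀ i, (k₀ i + M + 1 - (k₀ i - M)).toNat = 2 * M + 1 := fun i => by omega
      simp [this]
    · rw [Fintype.mem_piFinset]
      intro i
      rw [Finset.mem_Icc]
      have := h k k₀ hk hk₀ i
      have := h k₀ k hk₀ hk i
      omega
  · exact ⟨∅, by simp, fun k hk => absurd ⟨k, hk⟩ hT⟩

/-- The lower face of one cell is compared with the upper face of the other, which costs one mesh
width: hence L + 1 and not L. -/
theorem mesh_index_le {δ : ℝ} (hδ : 0 < δ) {k k' : ℤ} {z z' : ℝ} (hz : δ * k ≤ z)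
    (hz' : z' ≤ δ * (k' + 1)) {L : ℕ} (h : z - z' ≤ L * δ) : k ≤ k' + (L + 1 : ℕ) := by
  have h1 : δ * (k : ℝ) ≤ δ * (k' + 1 + L) := by nlinarith
  have h2 := le_of_mul_le_mul_left h1 hδ
  have h3 : (k : ℝ) ≤ ((k' + (L + 1 : ℕ) : ℤ) : ℝ) := by push_cast; linarith
  exact_mod_cast h3

theorem exists_mem_meshCube {n : ℕ} {δ : ℝ} (hδ : 0 < δ) (ξ : Fin n → ℝ) :
    ξ ∈ meshCube δ fun i => ⌊ξ i / δ⌋ := by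
  intro i
  constructor
  · rw [mul_comm, ← le_div_iff₀ hδ]; exact Int.floor_le _
  · rw [mul_comm, ← div_le_iff₀ hδ]; exact (Int.lt_floor_add_one _).le

theorem measurableSet_meshCube {n : ℕ} (δ : ℝ) (k : Fin n → ℤ) : MeasurableSet (meshCube δ k) := by
  simp only [meshCube, Set.ofPred_forall]
  exact MeasurableSet.iInter fun i => MeasurableSet.inter
    (measurableSet_le measurable_const (measurable_pi_apply i))
    (measurableSet_le (measurable_pi_apply i) measurable_const)

open Classical in
/-- A measure of a set is bounded by the sum over a countable family covering almost all of it. -/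
theorem measure_le_tsum_ite {Ω J : Type*} [MeasurableSpace Ω] [Countable J] (ν : Measure Ω)
    {A K : Set Ω} (hK : ν Kᶜ = 0) (B : J → Set Ω) (R : J → Prop)
    (h : ∀ ξ ∈ A, ξ ∈ K → ∃ j, R j ∧ ξ ∈ B j) :
    ν A ≤ ∑' j, if R j then ν (B j) else 0 := by
  have h1 : A ⊆ (⋃ j, if R j then B j else ∅) ∪ Kᶜ := by
    intro ξ hξ
    by_cases hk : ξ ∈ K
    · obtain ⟨j, hj, hξj⟩ := h ξ hξ hk
      exact Or.inl (Set.mem_iUnion.2 ⟨j, by rwa [if_pos hj]⟩)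
    · exact Or.inr hk
  calc ν A ≤ ν (⋃ j, if R j then B j else ∅) + ν Kᶜ := (measure_mono h1).trans (measure_union_le _ _)
    _ ≤ ∑' j, ν (if R j then B j else ∅) := by rw [hK, add_zero]; exact measure_iUnion_le _
    _ = _ := by
        congr 1; funext j; split_ifs <;> simp

/-- Moment sums of an affine image on the line. -/
theorem momentSum_map_affine {q : ℝ} (hq : 0 ≤ q) (ν : Measure (Fin 1 → ℝ)) {s t δ δ' : ℝ}
    (hδ : 0 < δ) (hδ' : 0 < δ') {L : ℕ} (h1 : |s| * δ' ≤ L * δ)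
    (h2 : δ ≤ L * (|s| * δ')) (hs : s ≠ 0) :
    momentSum (ν.map fun ξ i => s * ξ i + t) q δ ≤
      ((2 * L + 3 : ℕ) : ENNReal) ^ q * (2 * L + 3 : ℕ) * momentSum ν q δ' ∧
    momentSum ν q δ' ≤ ((2 * L + 3 : ℕ) : ENNReal) ^ q * (2 * L + 3 : ℕ) *
      momentSum (ν.map fun ξ i => s * ξ i + t) q δ := by
  have hmeas : Measurable fun (ξ : Fin 1 → ℝ) (i : Fin 1) => s * ξ i + t := by fun_prop
  -- A cell of the δ-mesh is related to the cells of the δ'-mesh whose images meet it. As δ and |s|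
  -- δ' agree up to the factor L, each cell has at most 2(L + 1) + 1 partners on either side.
  set R : (Fin 1 → ℤ) → (Fin 1 → ℤ) → Prop := fun k j =>
    ∃ ξ : Fin 1 → ℝ, ξ ∈ meshCube δ' j ∧ (fun i => s * ξ i + t) ∈ meshCube δ k with hR
  have hs0 : 0 < |s| := abs_pos.2 hs
  have hN : ∀ k, ∃ N : Finset (Fin 1 → ℤ), N.card ≤ 2 * L + 3 ∧ ∀ j, R k j → j ∈ N := by
    intro k
    have := exists_finset_of_pairwise_le (R k) (L + 1) ?_
    · simpa [mul_add] using this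
    · rintro j j' ⟨ξ, hξ, hk⟩ ⟨ξ', hξ', hk'⟩ i
      refine mesh_index_le hδ' (hξ i).1 (hξ' i).2 ?_
      have e1 : s * ξ i - s * ξ' i ≤ δ := by have := (hk i).2; have := (hk' i).1; simp at *; linarith
      have e2 : s * ξ' i - s * ξ i ≤ δ := by have := (hk' i).2; have := (hk i).1; simp at *; linarith
      have e3 : |s| * |ξ i - ξ' i| ≤ δ := by
        rw [← abs_mul, abs_le]; constructor <;> linarith
      have e4 : |s| * |ξ i - ξ' i| ≤ |s| * (L * δ') := e3.trans (by linarith)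
      exact (le_abs_self _).trans (le_of_mul_le_mul_left e4 hs0)
  have hN' : ∀ j, ∃ N : Finset (Fin 1 → ℤ), N.card ≤ 2 * L + 3 ∧ ∀ k, R k j → k ∈ N := by
    intro j
    have := exists_finset_of_pairwise_le (fun k => R k j) (L + 1) ?_
    · simpa [mul_add] using this
    · rintro k k' ⟨ξ, hξ, hk⟩ ⟨ξ', hξ', hk'⟩ i
      refine mesh_index_le hδ (hk i).1 (hk' i).2 ?_
      have e1 : |ξ i - ξ' i| ≤ δ' := by
        rw [abs_le]
        have := hξ i; have := hξ' i
        constructor <;> linarith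
      have e2 : s * ξ i + t - (s * ξ' i + t) ≤ |s| * |ξ i - ξ' i| := by
        rw [← abs_mul]; exact (by ring : s * ξ i + t - (s * ξ' i + t) = s * (ξ i - ξ' i)).le.trans
          (le_abs_self _)
      exact e2.trans ((mul_le_mul_of_nonneg_left e1 hs0.le).trans h1)
  rw [momentSum_eq_tsum_powZ, momentSum_eq_tsum_powZ]
  constructor
  · refine tsum_powZ_le hq R (fun k => ?_) hN hN'
    rw [Measure.map_apply hmeas (measurableSet_meshCube δ k)]
    exact measure_le_tsum_ite ν (K := Set.univ) (by simp) _ _ fun ξ hξ _ =>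
      ⟨_, ⟨ξ, exists_mem_meshCube hδ' ξ, hξ⟩, exists_mem_meshCube hδ' ξ⟩
  · refine tsum_powZ_le hq (fun j k => R k j) (fun j => ?_) hN' hN
    have hmap : ∀ k, (ν.map fun ξ i => s * ξ i + t) (meshCube δ k) = ν ((fun ξ i => s * ξ i + t) ⁻¹'
        meshCube δ k) := fun k => Measure.map_apply hmeas (measurableSet_meshCube δ k)
    simp only [hmap]
    exact measure_le_tsum_ite ν (K := Set.univ) (by simp) _ _ fun ξ hξ _ =>
      ⟨_, ⟨ξ, hξ, exists_mem_meshCube hδ _⟩, exists_mem_meshCube hδ _⟩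

/-- Moment sums of a planar measure that lives on a thin strip. -/
theorem momentSum_strip {q : ℝ} (hq : 0 ≤ q) (m : Measure (Fin 2 → ℝ)) {j j' : Fin 2} (hj : j ≠ j')
    {δ c : ℝ} (hδ : 0 < δ) (hm : m {ξ | c ≤ ξ j' ∧ ξ j' ≤ c + δ}ᶜ = 0) :
    momentSum m q δ ≤ ((5 ^ 2 : ℕ) : ENNReal) ^ q * (5 ^ 2 : ℕ) * momentSum (projMeasure m j) q δ ∧
    momentSum (projMeasure m j) q δ ≤ ((5 ^ 2 : ℕ) : ENNReal) ^ q * (5 ^ 2 : ℕ) * momentSum m q δ := by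
  have hjj : ∀ i : Fin 2, i = j ∨ i = j' := by
    intro i; omega
  have hmeas : Measurable fun (ξ : Fin 2 → ℝ) (_ : Fin 1) => ξ j := by fun_prop
  -- A square is related to the interval that it projects to, provided that its other side meets [c,
  -- c + δ]. Thus only a bounded stack of squares lies over each interval; 5² is the bound of
  -- `exists_finset_of_pairwise_le` for M = 2, n = 2.
  set R : (Fin 2 → ℤ) → (Fin 1 → ℤ) → Prop := fun k i =>
    i 0 = k j ∧ ∃ z : ℝ, (c ≤ z ∧ z ≤ c + δ) ∧ δ * k j' ≤ z ∧ z ≤ δ * (k j' + 1) with hR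
  have hN : ∀ k, ∃ N : Finset (Fin 1 → ℤ), N.card ≤ 5 ^ 2 ∧ ∀ i, R k i → i ∈ N := by
    intro k
    refine ⟨{fun _ => k j}, by simp, fun i hi => ?_⟩
    rw [Finset.mem_singleton]
    funext a
    rw [Subsingleton.elim a 0]
    exact hi.1
  have hN' : ∀ i, ∃ N : Finset (Fin 2 → ℤ), N.card ≤ 5 ^ 2 ∧ ∀ k, R k i → k ∈ N := by
    intro i
    refine exists_finset_of_pairwise_le (fun k => R k i) 2 ?_
    rintro k k' ⟨h1, z, hz, hz1, hz2⟩ ⟨h1', z', hz', hz1', hz2'⟩ a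
    rcases hjj a with rfl | rfl
    · rw [← h1, ← h1']; simp
    · have := mesh_index_le hδ hz1 hz2' (L := 1) (by push_cast; linarith [hz.2, hz'.1])
      simpa using this
  have hproj : ∀ i, projMeasure m j (meshCube δ i) = m ((fun (ξ : Fin 2 → ℝ) (_ : Fin 1) => ξ j) ⁻¹'
      meshCube δ i) := fun i => Measure.map_apply hmeas (measurableSet_meshCube δ i)
  rw [momentSum_eq_tsum_powZ, momentSum_eq_tsum_powZ]
  simp only [hproj]
  constructor
  · refine tsum_powZ_le hq R (fun k => ?_) hN hN'
    refine measure_le_tsum_ite m hm _ _ fun ξ hξ hK => ⟨fun _ => k j, ⟨rfl, ξ j', hK, hξ j'⟩, ?_⟩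
    exact fun _ => hξ j
  · refine tsum_powZ_le hq (fun i k => R k i) (fun i => ?_) hN' hN
    refine measure_le_tsum_ite m hm _ _ fun ξ hξ hK =>
      ⟨fun a => if a = j then i 0 else ⌊ξ a / δ⌋, ⟨by simp, ξ j', hK, ?_⟩, ?_⟩
    · simp only [if_neg hj.symm]
      exact exists_mem_meshCube hδ ξ j'
    · intro a
      simp only
      split_ifs with ha
      · rw [ha]; exact hξ 0
      · exact exists_mem_meshCube hδ ξ a

/-- Moment sums of a finite sum of measures of which boundedly many charge each cube. -/
theorem momentSum_sum {q : ℝ} (hq : 0 ≤ q) {n : ℕ} {ι : Type*} (S : Finset ι)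
    (m : ι → Measure (Fin n → ℝ)) {δ : ℝ} {N : ℕ}
    (h : ∀ k, ∃ S' : Finset ι, S'.card ≤ N ∧ ∀ w ∈ S, m w (meshCube δ k) ≠ 0 → w ∈ S') :
    momentSum (∑ w ∈ S, m w) q δ ≤ (N : ENNReal) ^ q * ∑ w ∈ S, momentSum (m w) q δ ∧
    ∑ w ∈ S, momentSum (m w) q δ ≤ N * momentSum (∑ w ∈ S, m w) q δ := by
  classical
  simp only [momentSum_eq_tsum_powZ]
  have hsum : ∀ k, (∑ w ∈ S, m w) (meshCube δ k) = ∑ w ∈ S, m w (meshCube δ k) := fun k => by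
    rw [Measure.finsetSum_apply]
  simp only [hsum]
  rw [← Summable.tsum_finsetSum fun _ _ => ENNReal.summable]
  constructor
  · rw [← ENNReal.tsum_mul_left]
    refine ENNReal.tsum_le_tsum fun k => ?_
    obtain ⟨S', hS', hmem⟩ := h k
    have e : ∀ f : ENNReal → ENNReal, f 0 = 0 → ∑ w ∈ S, f (m w (meshCube δ k)) =
        ∑ w ∈ S with w ∈ S', f (m w (meshCube δ k)) := by
      intro f hf
      rw [Finset.sum_filter_of_ne]
      intro w hw hne
      refine hmem w hw fun h0 => hne ?_
      rw [h0, hf]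
    rw [e (powZ q) (powZ_zero q)]
    have e' := e id rfl
    simp only [id] at e'
    rw [e']
    exact powZ_sum_le hq _ _ ((Finset.card_le_card fun w hw => (Finset.mem_filter.1 hw).2).trans hS')
  · rw [← ENNReal.tsum_mul_left]
    refine ENNReal.tsum_le_tsum fun k => ?_
    obtain ⟨S', hS', hmem⟩ := h k
    calc ∑ w ∈ S, powZ q (m w (meshCube δ k))
        = ∑ w ∈ S with w ∈ S', powZ q (m w (meshCube δ k)) := by
          rw [Finset.sum_filter_of_ne]
          intro w hw hne
          refine hmem w hw fun h0 => hne ?_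
          rw [h0, powZ_zero]
      _ ≤ ∑ w ∈ S with w ∈ S', powZ q (∑ w ∈ S, m w (meshCube δ k)) := by
          refine Finset.sum_le_sum fun w hw => powZ_mono hq ?_
          exact Finset.single_le_sum (f := fun w => m w (meshCube δ k)) (fun _ _ => zero_le)
            (Finset.mem_filter.1 hw).1
      _ ≤ N * powZ q (∑ w ∈ S, m w (meshCube δ k)) := by
          rw [Finset.sum_const, nsmul_eq_mul]
          gcongr
          exact (Finset.card_le_card fun w hw => (Finset.mem_filter.1 hw).2).trans hS'

theorem momentSum_smul {q : ℝ} (hq : 0 ≤ q) {n : ℕ} (ν : Measure (Fin n → ℝ)) {c : ENNReal}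
    (hc : c ≠ 0) (δ : ℝ) : momentSum (c • ν) q δ = c ^ q * momentSum ν q δ := by
  simp only [momentSum_eq_tsum_powZ, Measure.smul_apply, smul_eq_mul, powZ_mul hq hc,
    ENNReal.tsum_mul_left]

/-- Elementary bounds for the moment sums of a probability measure on the unit interval. -/
theorem momentSum_bounds {q : ℝ} (hq : 0 ≤ q) (ν : Measure (Fin 1 → ℝ)) [IsProbabilityMeasure ν]
    (hν : ν {ξ | ∀ i, 0 ≤ ξ i ∧ ξ i ≤ 1}ᶜ = 0) {δ : ℝ} (hδ : 0 < δ) {L : ℕ} (hL : 1 ≤ L * δ) :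
    momentSum ν q δ ≤ (2 * L + 3 : ℕ) ∧ 1 ≤ ((2 * L + 3 : ℕ) : ENNReal) ^ q * momentSum ν q δ := by
  -- The mesh is compared with a one-point index set of mass one.
  set R : (Fin 1 → ℤ) → Unit → Prop := fun k _ => ∃ ξ : Fin 1 → ℝ,
    (∀ i, 0 ≤ ξ i ∧ ξ i ≤ 1) ∧ ξ ∈ meshCube δ k with hR
  have hN' : ∀ u, ∃ N : Finset (Fin 1 → ℤ), N.card ≤ 2 * L + 3 ∧ ∀ k, R k u → k ∈ N := by
    intro u
    have := exists_finset_of_pairwise_le (fun k => R k u) (L + 1) ?_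
    · simpa [mul_add] using this
    · rintro k k' ⟨ξ, hξ, hk⟩ ⟨ξ', hξ', hk'⟩ i
      exact mesh_index_le hδ (hk i).1 (hk' i).2 (by linarith [(hξ i).2, (hξ' i).1])
  have hN : ∀ k, ∃ N : Finset Unit, N.card ≤ 1 ∧ ∀ u, R k u → u ∈ N := fun k =>
    ⟨{()}, by simp, by simp⟩
  rw [momentSum_eq_tsum_powZ]
  constructor
  · have := tsum_powZ_le hq R (x := fun k => ν (meshCube δ k)) (y := fun _ => 1) (fun k => ?_) hN hN'
    · simpa [powZ_one] using this
    · have := measure_le_tsum_ite ν (A := meshCube δ k) hν (fun _ : Unit => Set.univ) (R k)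
        fun ξ hξ hK => ⟨(), ⟨ξ, hK, hξ⟩, trivial⟩
      simpa using this
  · have := tsum_powZ_le hq (fun u k => R k u) (x := fun _ : Unit => 1)
      (y := fun k => ν (meshCube δ k)) (fun u => ?_) hN' hN
    · simpa [powZ_one] using this
    · have := measure_le_tsum_ite ν (A := Set.univ) hν (fun k => meshCube δ k) (fun k => R k u)
        fun ξ _ hK => ⟨_, ⟨ξ, hK, exists_mem_meshCube hδ ξ⟩, exists_mem_meshCube hδ ξ⟩
      simpa using this

end

noncomputable section

namespace BoxLikeGIFS

/-! ### Maps and measures of words -/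

variable {V E : Type*} (G : BoxLikeGIFS V E)

/-- The contraction of a word. -/
def wordMap : List E → (Fin 2 → ℝ) → Fin 2 → ℝ
  | [] => id
  | e :: w => G.psi e ∘ wordMap w

/-- The diagonal entry of the linear part of a word in the coordinate `j`. -/
def wordScale (j : Fin 2) (w : List E) : ℝ := (w.map fun e => G.T e j j).prod

/-- The translation part of a word in the coordinate `j`. -/
def wordShift (j : Fin 2) : List E → ℝ
  | [] => 0
  | e :: w => G.T e j j * wordShift j w + G.trans e j

/-- The logarithm of the side length of a word in the coordinate `j`. -/
def logSide (j : Fin 2) (w : List E) : ℝ := wsum (fun e => Real.log |G.T e j j|) w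

variable {G} in
theorem psi_apply (hdiag : ∀ e, (G.T e).IsDiag) (e : E) (ξ : Fin 2 → ℝ) (j : Fin 2) :
    G.psi e ξ j = G.T e j j * ξ j + G.trans e j := by
  have h1 : G.T e 0 1 = 0 := hdiag e (by decide)
  have h2 : G.T e 1 0 = 0 := hdiag e (by decide)
  simp only [psi, Pi.add_apply, mulVec, dotProduct, Fin.sum_univ_two]
  fin_cases j
  · simp [h1]
  · simp [h2]

variable {G} in
theorem abs_T_apply (hdiag : ∀ e, (G.T e).IsDiag) (e : E) :
    |G.T e 0 0| = G.a e ∧ |G.T e 1 1| = G.b e := by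
  rcases G.boxLike e with h | h
  · exact ⟨h.1, h.2.2.2⟩
  · have h1 : G.T e 0 1 = 0 := hdiag e (by decide)
    have := G.a_pos e
    rw [← h.2.1, h1] at this
    simp at this

variable {G} in
theorem abs_T_pos (hdiag : ∀ e, (G.T e).IsDiag) (e : E) (j : Fin 2) : 0 < |G.T e j j| := by
  fin_cases j
  · exact (abs_T_apply hdiag e).1 ▸ G.a_pos e
  · exact (abs_T_apply hdiag e).2 ▸ G.b_pos e

variable {G} in
theorem abs_T_lt_one (hdiag : ∀ e, (G.T e).IsDiag) (e : E) (j : Fin 2) : |G.T e j j| < 1 := by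
  fin_cases j
  · exact (abs_T_apply hdiag e).1 ▸ G.a_lt_one e
  · exact (abs_T_apply hdiag e).2 ▸ G.b_lt_one e

variable {G} in
theorem wordMap_apply (hdiag : ∀ e, (G.T e).IsDiag) (w : List E) (ξ : Fin 2 → ℝ) (j : Fin 2) :
    G.wordMap w ξ j = G.wordScale j w * ξ j + G.wordShift j w := by
  induction w with
  | nil => simp [wordMap, wordScale, wordShift]
  | cons e w ih =>
    simp only [wordMap, Function.comp_apply, psi_apply hdiag, ih, wordScale, wordShift,
      List.map_cons, List.prod_cons]
    ring

variable {G} in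
theorem abs_wordScale (hdiag : ∀ e, (G.T e).IsDiag) (j : Fin 2) (w : List E) :
    |G.wordScale j w| = Real.exp (G.logSide j w) := by
  induction w with
  | nil => simp [wordScale, logSide, wsum]
  | cons e w ih =>
    rw [logSide, wsum_cons, Real.exp_add, Real.exp_log (abs_T_pos hdiag e j), ← logSide, ← ih,
      ← abs_mul]
    simp [wordScale]

variable {G} in
theorem logSide_zero (hdiag : ∀ e, (G.T e).IsDiag) (w : List E) : G.logSide 0 w = G.logA w := by
  simp only [logSide, logA, (abs_T_apply hdiag _).1]

variable {G} in
theorem logSide_one (hdiag : ∀ e, (G.T e).IsDiag) (w : List E) : G.logSide 1 w = G.logB w := by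
  simp only [logSide, logB, (abs_T_apply hdiag _).2]

variable {G} in
theorem measurable_wordMap (hdiag : ∀ e, (G.T e).IsDiag) (w : List E) :
    Measurable (G.wordMap w) := by
  refine measurable_pi_lambda _ fun j => ?_
  simp only [wordMap_apply hdiag]
  fun_prop

variable {G} in
theorem measurable_psi (hdiag : ∀ e, (G.T e).IsDiag) (e : E) : Measurable (G.psi e) :=
  measurable_wordMap hdiag [e]

theorem wordMap_openSquare_subset {G : BoxLikeGIFS V E} (hrosc : G.ROSC) (w : List E) :
    G.wordMap w '' openSquare ⊆ openSquare := by
  induction w with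
  | nil => simp [wordMap]
  | cons e w ih =>
    rw [wordMap, Set.image_comp]
    exact (Set.image_mono ih).trans (hrosc.1 e)

theorem psi_injective {G : BoxLikeGIFS V E} (hdiag : ∀ e, (G.T e).IsDiag) (e : E) :
    Function.Injective (G.psi e) := by
  intro ξ ξ' h
  funext j
  have h1 := congrFun h j
  rw [psi_apply hdiag, psi_apply hdiag] at h1
  exact mul_left_cancel₀ (abs_pos.1 (abs_T_pos hdiag e j)) (add_right_cancel h1)

/-- The maps of an edge send the closed unit square into itself, coordinate by coordinate. -/
theorem ROSC.coord_mem {G : BoxLikeGIFS V E} (hdiag : ∀ e, (G.T e).IsDiag) (hrosc : G.ROSC) (e : E)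
    (j : Fin 2) {x : ℝ} (hx : x ∈ Set.Icc (0 : ℝ) 1) :
    G.T e j j * x + G.trans e j ∈ Set.Icc (0 : ℝ) 1 := by
  have h1 : ∀ x ∈ Set.Ioo (0 : ℝ) 1, G.T e j j * x + G.trans e j ∈ Set.Icc (0 : ℝ) 1 := by
    intro x hx
    have h2 : (fun _ => x : Fin 2 → ℝ) ∈ openSquare := fun _ => hx
    have h3 := hrosc.1 e ⟨_, h2, rfl⟩ j
    rw [psi_apply hdiag] at h3
    exact ⟨h3.1.le, h3.2.le⟩
  have h4 : Set.MapsTo (fun x : ℝ => G.T e j j * x + G.trans e j) (closure (Set.Ioo 0 1))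
      (closure (Set.Icc 0 1)) := Set.MapsTo.closure h1 (by fun_prop)
  rw [closure_Ioo zero_ne_one, isClosed_Icc.closure_eq] at h4
  exact h4 hx

/-- The square `[-r, 1 + r]²`. -/
def fatSquare (r : ℝ) : Set (Fin 2 → ℝ) := {ξ | ∀ j, -r ≤ ξ j ∧ ξ j ≤ 1 + r}

theorem measurableSet_fatSquare (r : ℝ) : MeasurableSet (fatSquare r) := by
  simp only [fatSquare, Set.ofPred_forall]
  exact MeasurableSet.iInter fun i => MeasurableSet.inter
    (measurableSet_le measurable_const (measurable_pi_apply i))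
    (measurableSet_le (measurable_pi_apply i) measurable_const)

variable {G} in
theorem projMeasure_map_wordMap (hdiag : ∀ e, (G.T e).IsDiag) (ν : Measure (Fin 2 → ℝ))
    (j : Fin 2) (w : List E) : projMeasure (ν.map (G.wordMap w)) j =
      (projMeasure ν j).map fun ξ i => G.wordScale j w * ξ i + G.wordShift j w := by
  rw [projMeasure, projMeasure, Measure.map_map (by fun_prop) (measurable_wordMap hdiag w),
    Measure.map_map (by fun_prop) (by fun_prop)]
  congr 1
  funext ξ i
  simp [wordMap_apply hdiag]

variable [Fintype E]

variable {G} in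
theorem exists_ratio_bounds [Nonempty E] (hdiag : ∀ e, (G.T e).IsDiag) : ∃ c > 0, ∃ κ < 1,
    c ≤ κ ∧ ∀ e j, c ≤ |G.T e j j| ∧ |G.T e j j| ≤ κ := by
  obtain ⟨z, -, hz⟩ := Finset.exists_min_image (Finset.univ : Finset (E × Fin 2))
    (fun z => |G.T z.1 z.2 z.2|) Finset.univ_nonempty
  obtain ⟨z', -, hz'⟩ := Finset.exists_max_image (Finset.univ : Finset (E × Fin 2))
    (fun z => |G.T z.1 z.2 z.2|) Finset.univ_nonempty
  exact ⟨_, abs_T_pos hdiag z.1 z.2, _, abs_T_lt_one hdiag z'.1 z'.2, hz z' (Finset.mem_univ _),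
    fun e j => ⟨hz (e, j) (Finset.mem_univ _), hz' (e, j) (Finset.mem_univ _)⟩⟩

variable [DecidableEq V]

/-- At the first edge where two words differ the open set condition separates them. A common prefix
is removed by injectivity. -/
theorem IsSection.disjoint {G : BoxLikeGIFS V E} (hdiag : ∀ e, (G.T e).IsDiag) (hrosc : G.ROSC)
    {v : V} {S : Finset (List E)} (hS : G.IsSection v S) : ∀ w ∈ S, ∀ w' ∈ S, w ≠ w' →
      Disjoint (G.wordMap w '' openSquare) (G.wordMap w' '' openSquare) := by
  induction hS with
  | nil v =>
    intro w hw w' hw' hne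
    rw [Finset.mem_singleton] at hw hw'
    exact absurd (hw.trans hw'.symm) hne
  | extend v S _ ih =>
    intro w hw w' hw' hne
    obtain ⟨e, u, he, hu, rfl⟩ := G.mem_extendWords.1 hw
    obtain ⟨e', u', he', hu', rfl⟩ := G.mem_extendWords.1 hw'
    rw [wordMap, wordMap, Set.image_comp, Set.image_comp]
    by_cases hee : e = e'
    · subst hee
      rw [Set.disjoint_image_iff (psi_injective hdiag e)]
      exact ih e he u hu u' hu' fun h => hne (by rw [h])
    · exact (hrosc.2 e e' (he.trans he'.symm) hee).mono
        (Set.image_mono (wordMap_openSquare_subset hrosc u))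
        (Set.image_mono (wordMap_openSquare_subset hrosc u'))

variable {G} {p : E → ℝ} {μ : V → Measure (Fin 2 → ℝ)}

theorem IsMeasureFamily.apply (hdiag : ∀ e, (G.T e).IsDiag) (hμ : G.IsMeasureFamily p μ) (v : V)
    {A : Set (Fin 2 → ℝ)} (hA : MeasurableSet A) :
    μ v A = ∑ e with G.src e = v, ENNReal.ofReal (p e) * μ (G.tgt e) (G.psi e ⁻¹' A) := by
  conv_lhs => rw [hμ.2 v]
  rw [Measure.finsetSum_apply]
  exact Finset.sum_congr rfl fun e _ => by
    rw [Measure.smul_apply, Measure.map_apply (measurable_psi hdiag e) hA, smul_eq_mul]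

theorem IsSection.measure_apply (hdiag : ∀ e, (G.T e).IsDiag) (hp : ∀ e, 0 < p e)
    (hμ : G.IsMeasureFamily p μ) {v : V} {S : Finset (List E)} (hS : G.IsSection v S)
    {A : Set (Fin 2 → ℝ)} (hA : MeasurableSet A) :
    μ v A = ∑ w ∈ S, ENNReal.ofReal (Real.exp (logP p w)) *
      μ (G.wordEnd v w) (G.wordMap w ⁻¹' A) := by
  induction hS generalizing A with
  | nil v => simp [logP, wsum, wordEnd, wordMap]
  | extend v S _ ih =>
    rw [hμ.apply hdiag v hA, G.sum_extendWords]
    refine Finset.sum_congr rfl fun e he => ?_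
    rw [ih e (Finset.mem_filter.1 he).2 (measurable_psi hdiag e hA), Finset.mul_sum]
    refine Finset.sum_congr rfl fun w _ => ?_
    rw [← mul_assoc, logP, logP, wsum_cons, Real.exp_add, Real.exp_log (hp e),
      ENNReal.ofReal_mul (hp e).le]
    rfl

theorem IsSection.measure_eq (hdiag : ∀ e, (G.T e).IsDiag) (hp : ∀ e, 0 < p e)
    (hμ : G.IsMeasureFamily p μ) {v : V} {S : Finset (List E)} (hS : G.IsSection v S) :
    μ v = ∑ w ∈ S, ENNReal.ofReal (Real.exp (logP p w)) •
      (μ (G.wordEnd v w)).map (G.wordMap w) := by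
  ext A hA
  rw [hS.measure_apply hdiag hp hμ hA, Measure.finsetSum_apply]
  exact Finset.sum_congr rfl fun w _ => by
    rw [Measure.smul_apply, Measure.map_apply (measurable_wordMap hdiag w) hA, smul_eq_mul]

theorem IsSection.projMeasure_eq (hdiag : ∀ e, (G.T e).IsDiag) (hp : ∀ e, 0 < p e)
    (hμ : G.IsMeasureFamily p μ) {v : V} {S : Finset (List E)} (hS : G.IsSection v S) (j : Fin 2) :
    projMeasure (μ v) j = ∑ w ∈ S, ENNReal.ofReal (Real.exp (logP p w)) •
      (projMeasure (μ (G.wordEnd v w)) j).map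
        fun ξ i => G.wordScale j w * ξ i + G.wordShift j w := by
  have hmeas : Measurable fun (ξ : Fin 2 → ℝ) (_ : Fin 1) => ξ j := by fun_prop
  ext A hA
  conv_lhs => rw [hS.measure_eq hdiag hp hμ]
  rw [projMeasure, Measure.map_apply hmeas hA, Measure.finsetSum_apply, Measure.finsetSum_apply]
  refine Finset.sum_congr rfl fun w _ => ?_
  rw [← projMeasure_map_wordMap hdiag, Measure.smul_apply, Measure.smul_apply, projMeasure,
    Measure.map_apply hmeas hA]

/-- The measures of the family live on the closed unit square. -/
theorem IsMeasureFamily.unitSquare [Fintype V] [Nonempty E] (hdiag : ∀ e, (G.T e).IsDiag)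
    (hrosc : G.ROSC) (hp : G.IsProbVector p) (hμ : G.IsMeasureFamily p μ) (v : V) :
    μ v {ξ | ∀ j, 0 ≤ ξ j ∧ ξ j ≤ 1}ᶜ = 0 := by
  have := hμ.1
  obtain ⟨c, hc, κ, hκ1, hcκ, hκ⟩ := exists_ratio_bounds hdiag
  have hκ0 : 0 < κ := hc.trans_le hcκ
  -- Each edge map sends the r-neighbourhood of the unit square into its κ r-neighbourhood, so mass
  -- far outside after n steps comes from mass far outside before.
  have hmap : ∀ e r, 0 ≤ r → G.psi e ⁻¹' (fatSquare (κ * r))ᶜ ⊆ (fatSquare r)ᶜ := by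
    intro e r hr ξ hξ hmem
    refine hξ fun j => ?_
    rw [psi_apply hdiag]
    -- The point of the unit interval nearest to `ξ j`.
    set x := max 0 (min (ξ j) 1) with hx
    have hx1 : x ∈ Set.Icc (0 : ℝ) 1 := ⟨le_max_left _ _, max_le zero_le_one (min_le_right _ _)⟩
    have hd : |ξ j - x| ≤ r := by
      have := hmem j
      rw [hx, abs_le]
      rcases le_total (ξ j) 1 with h1 | h1
      · rw [min_eq_left h1]
        rcases le_total 0 (ξ j) with h2 | h2
        · rw [max_eq_right h2]; constructor <;> linarith
        · rw [max_eq_left h2]; constructor <;> linarith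
      · rw [min_eq_right h1, max_eq_right zero_le_one]; constructor <;> linarith
    have h1 := hrosc.coord_mem hdiag e j hx1
    have h2 : |G.T e j j * (ξ j - x)| ≤ κ * r := by
      rw [abs_mul]
      exact mul_le_mul (hκ e j).2 hd (abs_nonneg _) hκ0.le
    rw [abs_le] at h2
    constructor <;> nlinarith [h1.1, h1.2, h2.1, h2.2]
  have hstep : ∀ (n : ℕ) (r : ℝ), 0 ≤ r → ∀ v, μ v (fatSquare (κ ^ n * r))ᶜ ≤
      ∑ v', μ v' (fatSquare r)ᶜ := by
    intro n
    induction n with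
    | zero =>
      intro r _ v
      rw [pow_zero, one_mul]
      exact Finset.single_le_sum (f := fun v' => μ v' (fatSquare r)ᶜ) (fun _ _ => zero_le)
        (Finset.mem_univ v)
    | succ n ih =>
      intro r hr v
      rw [hμ.apply hdiag v (measurableSet_fatSquare _).compl]
      calc _ ≤ ∑ e with G.src e = v, ENNReal.ofReal (p e) * ∑ v', μ v' (fatSquare r)ᶜ := by
            refine Finset.sum_le_sum fun e _ => ?_
            gcongr
            refine (measure_mono ?_).trans (ih r hr (G.tgt e))
            rw [pow_succ', mul_assoc]
            exact hmap e _ (by positivity)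
        _ = _ := by
            rw [← Finset.sum_mul, ← ENNReal.ofReal_sum_of_nonneg fun e _ => (hp.1 e).le, hp.2 v,
              ENNReal.ofReal_one, one_mul]
  have hlim : Tendsto (fun r : ℕ => ∑ v', μ v' (fatSquare (r : ℝ))ᶜ) atTop (𝓝 0) := by
    rw [← Finset.sum_const_zero (s := (Finset.univ : Finset V))]
    refine tendsto_finsetSum _ fun v' _ => ?_
    have h1 := tendsto_measure_iInter_atTop (μ := μ v') (s := fun r : ℕ => (fatSquare (r : ℝ))ᶜ)
      (fun r => (measurableSet_fatSquare _).compl.nullMeasurableSet)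
      (fun r r' hr => Set.compl_subset_compl.2 fun ξ hξ j => by
        have h2 : (r : ℝ) ≤ r' := by exact_mod_cast hr
        have := hξ j
        constructor <;> linarith)
      ⟨0, measure_ne_top _ _⟩
    have h2 : (⋂ r : ℕ, (fatSquare (r : ℝ))ᶜ) = ∅ := by
      rw [Set.eq_empty_iff_forall_notMem]
      intro ξ hξ
      obtain ⟨n, hn⟩ := exists_nat_ge (|ξ 0| + |ξ 1|)
      refine Set.mem_iInter.1 hξ n fun j => ?_
      have h3 : |ξ j| ≤ n := by
        refine le_trans ?_ hn
        fin_cases j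
        · simp
        · simp
      rw [abs_le] at h3
      constructor <;> linarith
    rwa [h2, measure_empty] at h1
  -- For each k, a power κ^n with κ^n k ≤ r bounds this mass by the total mass outside the square of
  -- size k, which tends to 0 in k.
  have hzero : ∀ r : ℝ, 0 < r → μ v (fatSquare r)ᶜ = 0 := by
    intro r hr
    refine le_antisymm (ge_of_tendsto' hlim fun k => ?_) zero_le
    obtain ⟨n, hn⟩ := exists_pow_lt_of_lt_one (div_pos hr (Nat.cast_add_one_pos (α := ℝ) k)) hκ1
    refine le_trans (measure_mono (Set.compl_subset_compl.2 ?_)) (hstep n k (Nat.cast_nonneg k) v)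
    have h1 : κ ^ n * k ≤ r := by
      rw [lt_div_iff₀ (Nat.cast_add_one_pos k)] at hn
      have : 0 < κ ^ n := pow_pos hκ0 n
      nlinarith
    intro ξ hξ j
    have := hξ j
    constructor <;> linarith
  have hsub : {ξ : Fin 2 → ℝ | ∀ j, 0 ≤ ξ j ∧ ξ j ≤ 1}ᶜ ⊆
      ⋃ n : ℕ, (fatSquare (1 / ((n : ℝ) + 1)))ᶜ := by
    intro ξ hξ
    by_contra hcon
    simp only [Set.mem_iUnion, Set.mem_compl_iff, not_exists, not_not] at hcon
    refine hξ fun j => ?_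
    have ht := tendsto_one_div_add_atTop_nhds_zero_nat (𝕜 := ℝ)
    constructor
    · refine le_of_tendsto' (x := atTop) (by simpa using ht.neg) fun n => (hcon n j).1
    · refine ge_of_tendsto' (x := atTop) (by simpa using ht.const_add 1) fun n => (hcon n j).2
  refine measure_mono_null hsub (measure_iUnion_null fun n => hzero _ (by positivity))

theorem IsMeasureFamily.proj_unitInterval [Fintype V] [Nonempty E] (hdiag : ∀ e, (G.T e).IsDiag)
    (hrosc : G.ROSC) (hp : G.IsProbVector p) (hμ : G.IsMeasureFamily p μ) (v : V) (j : Fin 2) :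
    projMeasure (μ v) j {ξ | ∀ i, 0 ≤ ξ i ∧ ξ i ≤ 1}ᶜ = 0 := by
  have hmeas : Measurable fun (ξ : Fin 2 → ℝ) (_ : Fin 1) => ξ j := by fun_prop
  have hset : MeasurableSet {ξ : Fin 1 → ℝ | ∀ i, 0 ≤ ξ i ∧ ξ i ≤ 1} := by
    have := measurableSet_meshCube (n := 1) 1 0
    simpa [meshCube] using this
  rw [projMeasure, Measure.map_apply hmeas hset.compl]
  refine measure_mono_null ?_ (hμ.unitSquare hdiag hrosc hp v)
  intro ξ hξ h
  exact hξ fun _ => h j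

theorem IsMeasureFamily.isProbabilityMeasure_proj (hμ : G.IsMeasureFamily p μ) (v : V)
    (j : Fin 2) : IsProbabilityMeasure (projMeasure (μ v) j) :=
  have := hμ.1 v
  Measure.isProbabilityMeasure_map
    (by fun_prop : Measurable fun (ξ : Fin 2 → ℝ) (_ : Fin 1) => ξ j).aemeasurable

end BoxLikeGIFS

end

noncomputable section

/-! ### Moment sums of mixtures on the line -/

theorem powZ_mean_le {q : ℝ} (hq : 1 ≤ q) {ι : Type*} (W : Finset ι) (w z : ι → ENNReal)
    (hw : ∑ i ∈ W, w i = 1) : powZ q (∑ i ∈ W, w i * z i) ≤ ∑ i ∈ W, w i * powZ q (z i) := by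
  have h : ∀ x, powZ q x = x ^ q := fun x => by
    by_cases hx : x = 0
    · rw [hx, powZ_zero, ENNReal.zero_rpow_of_pos (by linarith)]
    · exact powZ_of_ne_zero q hx
  simp only [h]
  exact ENNReal.rpow_arith_mean_le_arith_mean_rpow W w z hw hq

/-- The concave case is the convex one for the exponent 1/q. For q = 0 the power is the indicator of
the nonzero values and is treated by hand. -/
theorem le_powZ_mean {q : ℝ} (hq : 0 ≤ q) (hq1 : q ≤ 1) {ι : Type*} (W : Finset ι)
    (w z : ι → ENNReal) (hw : ∑ i ∈ W, w i = 1) :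
    ∑ i ∈ W, w i * powZ q (z i) ≤ powZ q (∑ i ∈ W, w i * z i) := by
  rcases hq.eq_or_lt with rfl | hq0
  · by_cases h0 : ∑ i ∈ W, w i * z i = 0
    · rw [h0, powZ_zero]
      rw [Finset.sum_eq_zero_iff] at h0
      refine le_of_eq (Finset.sum_eq_zero fun i hi => ?_)
      rcases mul_eq_zero.1 (h0 i hi) with h | h
      · rw [h, zero_mul]
      · rw [h, powZ_zero, mul_zero]
    · rw [powZ_of_ne_zero _ h0, ENNReal.rpow_zero, ← hw]
      refine Finset.sum_le_sum fun i _ => ?_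
      by_cases hz : z i = 0
      · rw [hz, powZ_zero, mul_zero]; exact zero_le
      · rw [powZ_of_ne_zero _ hz, ENNReal.rpow_zero, mul_one]
  · have h : ∀ x, powZ q x = x ^ q := fun x => by
      by_cases hx : x = 0
      · rw [hx, powZ_zero, ENNReal.zero_rpow_of_pos hq0]
      · exact powZ_of_ne_zero q hx
    simp only [h]
    have h1 := ENNReal.rpow_arith_mean_le_arith_mean_rpow W w (fun i => z i ^ q) hw
      (p := q⁻¹) ((one_le_inv₀ hq0).2 hq1)
    simp only [ENNReal.rpow_rpow_inv hq0.ne'] at h1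
    rwa [ENNReal.rpow_inv_le_iff hq0] at h1

section Mixture

variable {ι : Type*}

/-- Normalizes the weights, so that Jensen's inequality can be applied in each cube. -/
theorem momentSum_mixture_eq {q : ℝ} (hq : 0 ≤ q) {n : ℕ} (W : Finset ι) (P : ι → ENNReal)
    (m : ι → Measure (Fin n → ℝ)) (δ : ℝ) (h0 : ∑ w ∈ W, P w ≠ 0) (hT : ∑ w ∈ W, P w ≠ ⊤) :
    momentSum (∑ w ∈ W, P w • m w) q δ = (∑ w ∈ W, P w) ^ q *
      ∑' k, powZ q (∑ w ∈ W, (P w / ∑ w ∈ W, P w) * m w (meshCube δ k)) := by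
  rw [momentSum_eq_tsum_powZ, ← ENNReal.tsum_mul_left]
  congr 1
  funext k
  rw [← powZ_mul hq h0, Finset.mul_sum, Measure.finsetSum_apply]
  congr 1
  refine Finset.sum_congr rfl fun w _ => ?_
  rw [Measure.smul_apply, smul_eq_mul, ← mul_assoc, ENNReal.mul_div_cancel h0 hT]

/-- Jensen in each cube, then summation over the cubes first: overlaps between the components play
no role. -/
theorem momentSum_mixture_le {q : ℝ} (hq : 1 ≤ q) {n : ℕ} (W : Finset ι) (P : ι → ENNReal)
    (m : ι → Measure (Fin n → ℝ)) (δ : ℝ) (hT : ∑ w ∈ W, P w ≠ ⊤) {D : ENNReal}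
    (hD : ∀ w ∈ W, momentSum (m w) q δ ≤ D) :
    momentSum (∑ w ∈ W, P w • m w) q δ ≤ powZ q (∑ w ∈ W, P w) * D := by
  by_cases h0 : ∑ w ∈ W, P w = 0
  · have h1 : ∑ w ∈ W, P w • m w = 0 := Finset.sum_eq_zero fun w hw => by
      rw [Finset.sum_eq_zero_iff.1 h0 w hw, zero_smul]
    rw [h1, momentSum_eq_tsum_powZ]
    simp [powZ_zero]
  have hw1 : ∑ w ∈ W, P w / ∑ w ∈ W, P w = 1 := by
    simp only [div_eq_mul_inv]
    rw [← Finset.sum_mul, ENNReal.mul_inv_cancel h0 hT]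
  rw [momentSum_mixture_eq (by linarith) W P m δ h0 hT, powZ_of_ne_zero q h0]
  gcongr
  calc _ ≤ ∑' k, ∑ w ∈ W, (P w / ∑ w ∈ W, P w) * powZ q (m w (meshCube δ k)) :=
        ENNReal.tsum_le_tsum fun k => powZ_mean_le hq W _ _ hw1
    _ = ∑ w ∈ W, (P w / ∑ w ∈ W, P w) * momentSum (m w) q δ := by
        rw [Summable.tsum_finsetSum fun _ _ => ENNReal.summable]
        simp only [ENNReal.tsum_mul_left, momentSum_eq_tsum_powZ]
    _ ≤ ∑ w ∈ W, (P w / ∑ w ∈ W, P w) * D := Finset.sum_le_sum fun w hw => by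
        gcongr; exact hD w hw
    _ = D := by rw [← Finset.sum_mul, hw1, one_mul]

theorem le_momentSum_mixture {q : ℝ} (hq : 0 ≤ q) (hq1 : q ≤ 1) {n : ℕ} (W : Finset ι)
    (P : ι → ENNReal) (m : ι → Measure (Fin n → ℝ)) (δ : ℝ) (hT : ∑ w ∈ W, P w ≠ ⊤) {D : ENNReal}
    (hD : ∀ w ∈ W, D ≤ momentSum (m w) q δ) :
    powZ q (∑ w ∈ W, P w) * D ≤ momentSum (∑ w ∈ W, P w • m w) q δ := by
  by_cases h0 : ∑ w ∈ W, P w = 0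
  · rw [h0, powZ_zero, zero_mul]; exact zero_le
  have hw1 : ∑ w ∈ W, P w / ∑ w ∈ W, P w = 1 := by
    simp only [div_eq_mul_inv]
    rw [← Finset.sum_mul, ENNReal.mul_inv_cancel h0 hT]
  rw [momentSum_mixture_eq hq W P m δ h0 hT, powZ_of_ne_zero q h0]
  gcongr
  calc D = ∑ w ∈ W, (P w / ∑ w ∈ W, P w) * D := by rw [← Finset.sum_mul, hw1, one_mul]
    _ ≤ ∑ w ∈ W, (P w / ∑ w ∈ W, P w) * momentSum (m w) q δ := Finset.sum_le_sum fun w hw => by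
        gcongr; exact hD w hw
    _ = ∑' k, ∑ w ∈ W, (P w / ∑ w ∈ W, P w) * powZ q (m w (meshCube δ k)) := by
        rw [Summable.tsum_finsetSum fun _ _ => ENNReal.summable]
        simp only [ENNReal.tsum_mul_left, momentSum_eq_tsum_powZ]
    _ ≤ _ := ENNReal.tsum_le_tsum fun k => le_powZ_mean hq hq1 W _ _ hw1

open Classical in
/-- The part of a mixture whose components are centred in a given cell of the `δ₁`-mesh. -/
def cellMixture (S : Finset ι) (P : ι → ENNReal) (m : ι → Measure (Fin 1 → ℝ)) (c : ι → Fin 1 → ℝ)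
    (δ₁ : ℝ) (k : Fin 1 → ℤ) : Measure (Fin 1 → ℝ) :=
  ∑ w ∈ S with (fun i => ⌊c w i / δ₁⌋) = k, P w • m w

variable {S : Finset ι} {P : ι → ENNReal} {m : ι → Measure (Fin 1 → ℝ)} {c : ι → Fin 1 → ℝ} {δ₁ : ℝ}

theorem exists_of_cellMixture_ne_zero (hsupp : ∀ w ∈ S, m w {ξ | ∀ i, |ξ i - c w i| ≤ δ₁}ᶜ = 0)
    {k : Fin 1 → ℤ} {A : Set (Fin 1 → ℝ)} (hA : cellMixture S P m c δ₁ k A ≠ 0) :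
    ∃ w ∈ S, (fun i => ⌊c w i / δ₁⌋) = k ∧ ∃ ξ ∈ A, ∀ i, |ξ i - c w i| ≤ δ₁ := by
  classical
  rw [cellMixture, Measure.finsetSum_apply] at hA
  obtain ⟨w, hw, hne⟩ := Finset.exists_ne_zero_of_sum_ne_zero hA
  obtain ⟨hwS, hwk⟩ := Finset.mem_filter.1 hw
  refine ⟨w, hwS, hwk, ?_⟩
  by_contra! hcon
  apply hne
  rw [Measure.smul_apply, smul_eq_mul]
  refine mul_eq_zero_of_right _ (measure_mono_null ?_ (hsupp w hwS))
  intro ξ hξ hmem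
  obtain ⟨i, hi⟩ := hcon ξ hξ
  exact absurd (hmem i) (not_le.2 hi)

theorem sum_cellMixture (S : Finset ι) (P : ι → ENNReal) (m : ι → Measure (Fin 1 → ℝ))
    (c : ι → Fin 1 → ℝ) (δ₁ : ℝ) : open Classical in
    ∑ k ∈ S.image (fun w i => ⌊c w i / δ₁⌋), cellMixture S P m c δ₁ k = ∑ w ∈ S, P w • m w := by
  classical
  simp only [cellMixture]
  exact Finset.sum_fiberwise_of_maps_to (fun w hw => Finset.mem_image_of_mem _ hw) _

theorem cellMixture_le (S : Finset ι) (P : ι → ENNReal) (m : ι → Measure (Fin 1 → ℝ))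
    (c : ι → Fin 1 → ℝ) (δ₁ : ℝ) (k : Fin 1 → ℤ) (A : Set (Fin 1 → ℝ)) :
    cellMixture S P m c δ₁ k A ≤ (∑ w ∈ S, P w • m w) A := by
  classical
  rw [cellMixture, Measure.finsetSum_apply, Measure.finsetSum_apply]
  exact Finset.sum_le_sum_of_subset (Finset.filter_subset _ _)

theorem cellMixture_univ [∀ w, IsProbabilityMeasure (m w)] (k : Fin 1 → ℤ) : open Classical in
    cellMixture S P m c δ₁ k Set.univ = ∑ w ∈ S with (fun i => ⌊c w i / δ₁⌋) = k, P w := by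
  classical
  rw [cellMixture, Measure.finsetSum_apply]
  exact Finset.sum_congr rfl fun w _ => by simp

/-- Cells that charge cubes which are close to each other are close to each other. -/
theorem cell_index_le (hδ₁ : 0 < δ₁)
    (hsupp : ∀ w ∈ S, m w {ξ | ∀ i, |ξ i - c w i| ≤ δ₁}ᶜ = 0) {k k' : Fin 1 → ℤ}
    {A : Set (Fin 1 → ℝ)} (hA : ∀ ξ ∈ A, ∀ ξ' ∈ A, ∀ i, ξ i - ξ' i ≤ δ₁)
    (hk : cellMixture S P m c δ₁ k A ≠ 0) (hk' : cellMixture S P m c δ₁ k' A ≠ 0) (i : Fin 1) :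
    k i ≤ k' i + (4 : ℕ) := by
  obtain ⟨w, -, rfl, ξ, hξ, h1⟩ := exists_of_cellMixture_ne_zero hsupp hk
  obtain ⟨w', -, rfl, ξ', hξ', h2⟩ := exists_of_cellMixture_ne_zero hsupp hk'
  -- Three errors of size δ₁ add up: from each of the two centres to its point, and between the
  -- points.
  refine mesh_index_le hδ₁ (exists_mem_meshCube hδ₁ (c w) i).1
    (exists_mem_meshCube hδ₁ (c w') i).2 (L := 3) ?_
  have e1 := abs_le.1 (h1 i)
  have e2 := abs_le.1 (h2 i)
  have e3 := hA ξ hξ ξ' hξ' i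
  push_cast
  linarith

theorem meshCube_sub_le {n : ℕ} {δ : ℝ} {k : Fin n → ℤ} {ξ ξ' : Fin n → ℝ} (h : ξ ∈ meshCube δ k)
    (h' : ξ' ∈ meshCube δ k) (i : Fin n) : ξ i - ξ' i ≤ δ := by
  have := h i; have := h' i; linarith

/-- The powers of the masses of the cells are comparable to the moment sum. -/
theorem tsum_cellMixture_bounds {q : ℝ} (hq : 0 ≤ q) (hδ₁ : 0 < δ₁)
    (hsupp : ∀ w ∈ S, m w {ξ | ∀ i, |ξ i - c w i| ≤ δ₁}ᶜ = 0) :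
    ∑' k, powZ q (cellMixture S P m c δ₁ k Set.univ) ≤
      ((9 : ℕ) : ENNReal) ^ q * (9 : ℕ) * momentSum (∑ w ∈ S, P w • m w) q δ₁ ∧
    momentSum (∑ w ∈ S, P w • m w) q δ₁ ≤ ((9 : ℕ) : ENNReal) ^ q * (9 : ℕ) *
      ∑' k, powZ q (cellMixture S P m c δ₁ k Set.univ) := by
  classical
  -- A cell is related to the cubes that it charges. Indices differ by at most 4, which gives 9 = 2
  -- · 4 + 1 partners in both directions.
  set R : (Fin 1 → ℤ) → (Fin 1 → ℤ) → Prop := fun κ k =>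
    cellMixture S P m c δ₁ κ (meshCube δ₁ k) ≠ 0 with hR
  have hN : ∀ κ, ∃ N : Finset (Fin 1 → ℤ), N.card ≤ 9 ∧ ∀ k, R κ k → k ∈ N := by
    intro κ
    have := exists_finset_of_pairwise_le (R κ) 4 ?_
    · simpa using this
    · intro k k' hk hk' i
      obtain ⟨w, -, hw, ξ, hξ, h1⟩ := exists_of_cellMixture_ne_zero hsupp hk
      obtain ⟨w', -, hw', ξ', hξ', h2⟩ := exists_of_cellMixture_ne_zero hsupp hk'
      refine mesh_index_le hδ₁ (hξ i).1 (hξ' i).2 (L := 3) ?_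
      have e1 := abs_le.1 (h1 i)
      have e2 := abs_le.1 (h2 i)
      have e3 := meshCube_sub_le (hw ▸ exists_mem_meshCube hδ₁ (c w) :
        c w ∈ meshCube δ₁ κ) (hw' ▸ exists_mem_meshCube hδ₁ (c w') : c w' ∈ meshCube δ₁ κ) i
      push_cast
      linarith
  have hN' : ∀ k, ∃ N : Finset (Fin 1 → ℤ), N.card ≤ 9 ∧ ∀ κ, R κ k → κ ∈ N := by
    intro k
    have := exists_finset_of_pairwise_le (fun κ => R κ k) 4 ?_
    · simpa using this
    · intro κ κ' hκ hκ' i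
      exact cell_index_le hδ₁ hsupp (fun ξ hξ ξ' hξ' i => meshCube_sub_le hξ hξ' i) hκ hκ' i
  constructor
  · rw [momentSum_eq_tsum_powZ]
    refine tsum_powZ_le hq R (fun κ => ?_) hN hN'
    refine (measure_le_tsum_ite (cellMixture S P m c δ₁ κ) (A := Set.univ) (K := Set.univ) (by simp)
      (fun k => meshCube δ₁ k) (fun _ => True) fun ξ _ _ =>
        ⟨_, trivial, exists_mem_meshCube hδ₁ ξ⟩).trans ?_
    refine ENNReal.tsum_le_tsum fun k => ?_
    rw [if_pos trivial]
    split_ifs with h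
    · exact cellMixture_le S P m c δ₁ κ _
    · exact (not_not.1 h).le
  · rw [momentSum_eq_tsum_powZ]
    refine tsum_powZ_le hq (fun k κ => R κ k) (fun k => ?_) hN' hN
    rw [← sum_cellMixture S P m c δ₁, Measure.finsetSum_apply]
    refine le_trans ?_ (ENNReal.sum_le_tsum (S.image fun w i => ⌊c w i / δ₁⌋))
    refine Finset.sum_le_sum fun κ _ => ?_
    split_ifs with h
    · exact measure_mono (Set.subset_univ _)
    · exact (not_not.1 h).le

/-- Since δ ≤ δ₁, each δ-cube is charged by at most 9 cells, so moment sums are additive over the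
cells up to constants. -/
theorem momentSum_sum_cellMixture {q : ℝ} (hq : 0 ≤ q) (hδ₁ : 0 < δ₁) {δ : ℝ} (hδ : δ ≤ δ₁)
    (hsupp : ∀ w ∈ S, m w {ξ | ∀ i, |ξ i - c w i| ≤ δ₁}ᶜ = 0) : open Classical in
    momentSum (∑ w ∈ S, P w • m w) q δ ≤ ((9 : ℕ) : ENNReal) ^ q *
      ∑ k ∈ S.image (fun w i => ⌊c w i / δ₁⌋), momentSum (cellMixture S P m c δ₁ k) q δ ∧
    ∑ k ∈ S.image (fun w i => ⌊c w i / δ₁⌋), momentSum (cellMixture S P m c δ₁ k) q δ ≤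
      (9 : ℕ) * momentSum (∑ w ∈ S, P w • m w) q δ := by
  classical
  have h := momentSum_sum hq (S.image fun w i => ⌊c w i / δ₁⌋) (cellMixture S P m c δ₁) (δ := δ)
    (N := 9) fun k => ?_
  · rwa [sum_cellMixture] at h
  · obtain ⟨N, hN, hmem⟩ := exists_finset_of_pairwise_le
      (fun κ => cellMixture S P m c δ₁ κ (meshCube δ k) ≠ 0) 4 fun κ κ' hκ hκ' i =>
        cell_index_le hδ₁ hsupp (fun ξ hξ ξ' hξ' i => (meshCube_sub_le hξ hξ' i).trans hδ) hκ hκ' i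
    exact ⟨N, by simpa using hN, fun κ _ hκ => hmem κ hκ⟩

/-- Submultiplicativity of moment sums of mixtures for `q ≥ 1`. -/
theorem momentSum_mixture_submul [∀ w, IsProbabilityMeasure (m w)] {q : ℝ} (hq : 1 ≤ q)
    (hδ₁ : 0 < δ₁) {δ : ℝ} (hδ : δ ≤ δ₁)
    (hsupp : ∀ w ∈ S, m w {ξ | ∀ i, |ξ i - c w i| ≤ δ₁}ᶜ = 0) (hP : ∀ w, P w ≠ ⊤) {D : ENNReal}
    (hD : ∀ w ∈ S, momentSum (m w) q δ ≤ D) :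
    momentSum (∑ w ∈ S, P w • m w) q δ ≤ ((9 : ℕ) : ENNReal) ^ q * (((9 : ℕ) : ENNReal) ^ q *
      (9 : ℕ)) * (D * momentSum (∑ w ∈ S, P w • m w) q δ₁) := by
  classical
  have hq0 : 0 ≤ q := by linarith
  refine (momentSum_sum_cellMixture hq0 hδ₁ hδ hsupp).1.trans ?_
  rw [mul_assoc]
  gcongr
  -- Inside a cell Jensen bounds the moment sum by D times a power of its mass; the powers of the
  -- masses rebuild the moment sum at scale δ₁.
  calc _ ≤ ∑ k ∈ S.image (fun w i => ⌊c w i / δ₁⌋),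
        powZ q (cellMixture S P m c δ₁ k Set.univ) * D := by
        refine Finset.sum_le_sum fun k _ => ?_
        rw [cellMixture_univ]
        exact momentSum_mixture_le hq _ P m δ (ENNReal.sum_ne_top.2 fun w _ => hP w)
          fun w hw => hD w (Finset.mem_filter.1 hw).1
    _ ≤ (∑' k, powZ q (cellMixture S P m c δ₁ k Set.univ)) * D := by
        rw [← Finset.sum_mul]
        gcongr
        exact ENNReal.sum_le_tsum _
    _ ≤ _ := by
        refine (mul_le_mul_left (tsum_cellMixture_bounds hq0 hδ₁ hsupp).1 D).trans ?_
        rw [mul_assoc, mul_comm D]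

/-- Supermultiplicativity of moment sums of mixtures for `q ≤ 1`. -/
theorem momentSum_mixture_supermul [∀ w, IsProbabilityMeasure (m w)] {q : ℝ} (hq : 0 ≤ q)
    (hq1 : q ≤ 1) (hδ₁ : 0 < δ₁) {δ : ℝ} (hδ : δ ≤ δ₁)
    (hsupp : ∀ w ∈ S, m w {ξ | ∀ i, |ξ i - c w i| ≤ δ₁}ᶜ = 0) (hP : ∀ w, P w ≠ ⊤) {D : ENNReal}
    (hD : ∀ w ∈ S, D ≤ momentSum (m w) q δ) :
    D * momentSum (∑ w ∈ S, P w • m w) q δ₁ ≤ ((9 : ℕ) : ENNReal) ^ q * (9 : ℕ) * ((9 : ℕ) *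
      momentSum (∑ w ∈ S, P w • m w) q δ) := by
  classical
  calc _ ≤ D * (((9 : ℕ) : ENNReal) ^ q * (9 : ℕ) *
        ∑' k, powZ q (cellMixture S P m c δ₁ k Set.univ)) := by
        gcongr
        exact (tsum_cellMixture_bounds hq hδ₁ hsupp).2
    _ = ((9 : ℕ) : ENNReal) ^ q * (9 : ℕ) * ((∑' k, powZ q (cellMixture S P m c δ₁ k Set.univ)) *
        D) := by ring
    _ ≤ _ := by
        refine mul_le_mul_right (le_trans ?_ (momentSum_sum_cellMixture hq hδ₁ hδ hsupp).2) _
        -- Cells containing no centre carry the zero measure.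
        rw [tsum_eq_sum (s := S.image fun w i => ⌊c w i / δ₁⌋), Finset.sum_mul]
        · refine Finset.sum_le_sum fun k _ => ?_
          rw [cellMixture_univ]
          exact le_momentSum_mixture hq hq1 _ P m δ (ENNReal.sum_ne_top.2 fun w _ => hP w)
            fun w hw => hD w (Finset.mem_filter.1 hw).1
        · intro k hk
          have : cellMixture S P m c δ₁ k = 0 := by
            rw [cellMixture, Finset.filter_eq_empty_iff.2, Finset.sum_empty]
            intro w hw h
            exact hk (Finset.mem_image.2 ⟨w, hw, h⟩)
          rw [this]
          simp [powZ_zero]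

end Mixture

end

noncomputable section

/-! ### Existence of the spectra of the projections -/

/-- Fekete's lemma for sequences that are submultiplicative up to a constant. -/
theorem exists_tendsto_log_div_of_submul {Z : ℕ → ℝ} (hZ : ∀ n, 0 < Z n) {C : ℝ} (hC : 0 < C)
    (h : ∀ m n, Z (m + n) ≤ C * (Z m * Z n)) {D : ℝ} (hD : ∀ n : ℕ, |Real.log (Z n)| ≤ D * (n + 1)) :
    ∃ t, Tendsto (fun n : ℕ => Real.log (Z n) / n) atTop (𝓝 t) := by
  -- The constant C is absorbed by adding log C to the sequence.
  have hsub : Subadditive fun n => Real.log (Z n) + Real.log C := by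
    intro m n
    have h1 := Real.log_le_log (hZ _) (h m n)
    rw [Real.log_mul hC.ne' (mul_pos (hZ m) (hZ n)).ne', Real.log_mul (hZ m).ne' (hZ n).ne'] at h1
    linarith
  have hD0 : 0 ≤ D := by simpa using (abs_nonneg _).trans (hD 0)
  have hbdd : BddBelow (Set.range fun n : ℕ => (Real.log (Z n) + Real.log C) / n) := by
    refine ⟨-(2 * D + |Real.log C|), ?_⟩
    rintro _ ⟨n, rfl⟩
    rcases Nat.eq_zero_or_pos n with rfl | hn
    · simp only [Nat.cast_zero, div_zero]
      linarith [abs_nonneg (Real.log C)]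
    · have hn' : (1 : ℝ) ≤ n := by exact_mod_cast hn
      change -(2 * D + |Real.log C|) ≤ (Real.log (Z n) + Real.log C) / n
      rw [le_div_iff₀ (by linarith)]
      have h1 := (abs_le.1 (hD n)).1
      have h2 := neg_abs_le (Real.log C)
      nlinarith [abs_nonneg (Real.log C)]
  have hlim := hsub.tendsto_lim hbdd
  refine ⟨_, (hlim.sub (tendsto_const_nhds.div_atTop tendsto_natCast_atTop_atTop :
    Tendsto (fun n : ℕ => Real.log C / n) atTop (𝓝 0))).congr fun n => ?_⟩
  rw [← sub_div, add_sub_cancel_right]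

theorem exists_tendsto_log_div_of_supermul {Z : ℕ → ℝ} (hZ : ∀ n, 0 < Z n) {C : ℝ} (hC : 0 < C)
    (h : ∀ m n, Z m * Z n ≤ C * Z (m + n)) {D : ℝ} (hD : ∀ n : ℕ, |Real.log (Z n)| ≤ D * (n + 1)) :
    ∃ t, Tendsto (fun n : ℕ => Real.log (Z n) / n) atTop (𝓝 t) := by
  have h1 : ∀ m n, (Z (m + n))⁻¹ ≤ C * ((Z m)⁻¹ * (Z n)⁻¹) := by
    intro m n
    rw [← mul_inv, ← div_eq_mul_inv, inv_eq_one_div,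
      div_le_div_iff₀ (hZ _) (mul_pos (hZ m) (hZ n)), one_mul]
    exact h m n
  have h2 : ∀ n : ℕ, |Real.log (Z n)⁻¹| ≤ D * (n + 1) := by
    intro n
    rw [Real.log_inv, abs_neg]
    exact hD n
  obtain ⟨t, ht⟩ := exists_tendsto_log_div_of_submul (fun n => inv_pos.2 (hZ n)) hC h1 h2
  refine ⟨-t, ht.neg.congr fun n => ?_⟩
  rw [Real.log_inv, neg_div, neg_neg]

theorem log_toReal_le_of_le_mul {x y C : ENNReal} (hx : x ≠ 0) (hy : y ≠ 0) (hyT : y ≠ ⊤)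
    (hCT : C ≠ ⊤) (h : x ≤ C * y) :
    Real.log x.toReal ≤ Real.log C.toReal + Real.log y.toReal := by
  have hC : C ≠ 0 := by
    rintro rfl
    rw [zero_mul] at h
    exact hx (le_antisymm h zero_le)
  have h1 := ENNReal.toReal_mono (ENNReal.mul_ne_top hCT hyT) h
  rw [ENNReal.toReal_mul] at h1
  have hx' : 0 < x.toReal := ENNReal.toReal_pos hx (ne_top_of_le_ne_top (ENNReal.mul_ne_top hCT hyT) h)
  rw [← Real.log_mul (ENNReal.toReal_pos hC hCT).ne' (ENNReal.toReal_pos hy hyT).ne']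
  exact Real.log_le_log hx' h1

theorem tendsto_neg_log_nhdsGT_zero : Tendsto (fun δ : ℝ => -Real.log δ) (𝓝[>] 0) atTop :=
  tendsto_neg_atBot_atTop.comp Real.tendsto_log_nhdsGT_zero

/-- Functions whose logarithms differ by a bounded amount have the same logarithmic order. -/
theorem tendsto_div_neg_log_of_bounded_sub {f g : ℝ → ℝ} {t C : ℝ}
    (hg : Tendsto (fun δ => g δ / (-Real.log δ)) (𝓝[>] 0) (𝓝 t))
    (h : ∀ᶠ δ in 𝓝[>] (0 : ℝ), |f δ - g δ| ≤ C) :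
    Tendsto (fun δ => f δ / (-Real.log δ)) (𝓝[>] 0) (𝓝 t) := by
  have h1 : Tendsto (fun δ => (f δ - g δ) / (-Real.log δ)) (𝓝[>] 0) (𝓝 0) := by
    refine squeeze_zero_norm' (a := fun δ => C / (-Real.log δ)) ?_
      (tendsto_const_nhds.div_atTop tendsto_neg_log_nhdsGT_zero)
    filter_upwards [h, tendsto_neg_log_nhdsGT_zero.eventually_gt_atTop 0] with δ h2 h3
    rw [Real.norm_eq_abs, abs_div, abs_of_pos h3]
    exact div_le_div_of_nonneg_right h2 h3.le
  have h2 := hg.add h1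
  rw [add_zero] at h2
  refine h2.congr fun δ => ?_
  rw [← add_div, add_sub_cancel]

/-- Passage from dyadic scales to all scales. -/
theorem tendsto_of_dyadic {f : ℝ → ℝ} {t C : ℝ}
    (hf : Tendsto (fun n : ℕ => f ((1 / 2) ^ n) / n) atTop (𝓝 t))
    (h : ∀ (n : ℕ) (δ : ℝ), (1 / 2) ^ n / 2 ≤ δ → δ ≤ (1 / 2) ^ n → |f δ - f ((1 / 2) ^ n)| ≤ C) :
    Tendsto (fun δ => f δ / (-Real.log δ)) (𝓝[>] 0) (𝓝 (t / Real.log 2)) := by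
  have hl2 : 0 < Real.log 2 := Real.log_pos one_lt_two
  -- x is -log₂ δ, and its integer part n satisfies 2^{-n}/2 ≤ δ ≤ 2^{-n}.
  set x : ℝ → ℝ := fun δ => -Real.log δ / Real.log 2 with hx
  have hxt : Tendsto x (𝓝[>] 0) atTop := tendsto_neg_log_nhdsGT_zero.atTop_div_const hl2
  have hn : Tendsto (fun δ => ⌊x δ⌋₊) (𝓝[>] 0) atTop := tendsto_nat_floor_atTop.comp hxt
  have h1 : Tendsto (fun δ => f ((1 / 2) ^ ⌊x δ⌋₊) / (-Real.log δ)) (𝓝[>] 0)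
      (𝓝 (t / Real.log 2)) := by
    have h2 := ((hf.comp hn).mul ((tendsto_nat_floor_div_atTop (R := ℝ)).comp hxt)).div_const
      (Real.log 2)
    rw [mul_one] at h2
    refine h2.congr' ?_
    filter_upwards [hxt.eventually_ge_atTop 1] with δ hδ
    have hfl : (⌊x δ⌋₊ : ℝ) ≠ 0 := by
      have : 1 ≤ ⌊x δ⌋₊ := Nat.le_floor (by simpa using hδ)
      exact_mod_cast (by omega : ⌊x δ⌋₊ ≠ 0)
    have hx0 : x δ ≠ 0 := by linarith
    have hlog : -Real.log δ = x δ * Real.log 2 := by rw [hx]; field_simp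
    simp only [Function.comp_apply]
    rw [hlog]
    field_simp
  refine tendsto_div_neg_log_of_bounded_sub (C := C) h1 ?_
  filter_upwards [hxt.eventually_ge_atTop 1, self_mem_nhdsWithin] with δ hδ hδ0
  have hδ0 : 0 < δ := hδ0
  have hlog : Real.log δ = -(x δ * Real.log 2) := by rw [hx]; field_simp
  have hpow : ∀ n : ℕ, ((1 : ℝ) / 2) ^ n = Real.exp (-(n * Real.log 2)) := by
    intro n
    rw [Real.exp_neg, Real.exp_nat_mul, Real.exp_log two_pos, one_div, inv_pow]
  have hhalf : ((1 : ℝ) / 2) ^ ⌊x δ⌋₊ / 2 = (1 / 2) ^ (⌊x δ⌋₊ + 1) := by rw [pow_succ]; ring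
  refine h _ _ ?_ ?_
  · rw [hhalf, hpow, ← Real.le_log_iff_exp_le hδ0, hlog]
    have := Nat.lt_floor_add_one (x δ)
    push_cast
    nlinarith
  · rw [hpow, ← Real.log_le_iff_le_exp hδ0, hlog]
    have := Nat.floor_le (by linarith : 0 ≤ x δ)
    nlinarith

namespace BoxLikeGIFS

variable {V E : Type*} {G : BoxLikeGIFS V E}

theorem StronglyConnected.exists_path (hconn : G.StronglyConnected) (v u : V) :
    ∃ w, G.IsPath v w ∧ G.wordEnd v w = u := by
  induction hconn v u using Relation.TransGen.head_induction_on with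
  | single h =>
    obtain ⟨e, h1, h2⟩ := h
    exact ⟨[e], ⟨h1, trivial⟩, h2⟩
  | head h _ ih =>
    obtain ⟨e, h1, h2⟩ := h
    obtain ⟨w, h3, h4⟩ := ih
    exact ⟨e :: w, ⟨h1, by rwa [h2]⟩, by rw [wordEnd, h2, h4]⟩

theorem momentSum_mono {q : ℝ} (hq : 0 ≤ q) {n : ℕ} {ν ν' : Measure (Fin n → ℝ)} (δ : ℝ)
    (h : ∀ A, MeasurableSet A → ν A ≤ ν' A) : momentSum ν q δ ≤ momentSum ν' q δ := by
  rw [momentSum_eq_tsum_powZ, momentSum_eq_tsum_powZ]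
  exact ENNReal.tsum_le_tsum fun k => powZ_mono hq (h _ (measurableSet_meshCube δ k))

/-- Sections by side length in one coordinate direction. -/
theorem exists_side_section [DecidableEq V] [Fintype E] [Nonempty E]
    (hdiag : ∀ e, (G.T e).IsDiag) (j : Fin 2) : ∃ c > 0,
    c ≤ 1 ∧ ∀ δ, 0 < δ → δ ≤ 1 → ∀ v, ∃ S, G.IsSection v S ∧
      ∀ w ∈ S, c * δ ≤ |G.wordScale j w| ∧ |G.wordScale j w| ≤ δ := by
  obtain ⟨c, hc, κ, hκ1, hcκ, h⟩ := exists_ratio_bounds hdiag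
  refine ⟨c, hc, by linarith, fun δ hδ hδ1 v => ?_⟩
  refine G.exists_stopping_section (m := fun w => |G.wordScale j w|) hc.le (hc.le.trans hcκ) hκ1
    (by simp [wordScale]) (fun w e => ?_) (by linarith) hδ hδ1 v
  simp only [wordScale, List.map_append, List.prod_append, List.map_cons, List.map_nil,
    List.prod_cons, List.prod_nil, mul_one, abs_mul]
  rw [mul_comm c, mul_comm κ]
  exact ⟨mul_le_mul_of_nonneg_left (h e j).1 (abs_nonneg _),
    mul_le_mul_of_nonneg_left (h e j).2 (abs_nonneg _)⟩

variable [Fintype V] [DecidableEq V] [Fintype E] {p : E → ℝ} {μ : V → Measure (Fin 2 → ℝ)} {q : ℝ}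

theorem IsMeasureFamily.momentSum_proj_ne [Nonempty E] (hdiag : ∀ e, (G.T e).IsDiag)
    (hrosc : G.ROSC) (hp : G.IsProbVector p) (hμ : G.IsMeasureFamily p μ) (hq : 0 ≤ q) (v : V)
    (j : Fin 2) {δ : ℝ} (hδ : 0 < δ) :
    momentSum (projMeasure (μ v) j) q δ ≠ 0 ∧ momentSum (projMeasure (μ v) j) q δ ≠ ⊤ := by
  have := hμ.isProbabilityMeasure_proj v j
  obtain ⟨L, hL⟩ := exists_nat_ge (1 / δ)
  rw [div_le_iff₀ hδ] at hL
  obtain ⟨h1, h2⟩ := momentSum_bounds hq _ (hμ.proj_unitInterval hdiag hrosc hp v j) hδ hL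
  constructor
  · intro h0
    rw [h0, mul_zero] at h2
    exact absurd h2 (by simp)
  · exact ne_top_of_le_ne_top (ENNReal.natCast_ne_top _) h1

/-- The moment sums of the projections at different vertices are comparable. -/
theorem IsMeasureFamily.exists_vertex_bound (hdiag : ∀ e, (G.T e).IsDiag)
    (hconn : G.StronglyConnected) (hp : G.IsProbVector p) (hμ : G.IsMeasureFamily p μ) (hq : 0 ≤ q)
    (j : Fin 2) : ∃ C : ENNReal, C ≠ ⊤ ∧ ∀ u v δ, 0 < δ →
      momentSum (projMeasure (μ u) j) q δ ≤ C * momentSum (projMeasure (μ v) j) q δ := by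
  have key : ∀ u v, ∃ C : ENNReal, C ≠ ⊤ ∧ ∀ δ, 0 < δ →
      momentSum (projMeasure (μ u) j) q δ ≤ C * momentSum (projMeasure (μ v) j) q δ := by
    intro u v
    -- A path w from v to u shows that `μ v` dominates p_w times an affine copy of `μ u` of fixed
    -- ratio.
    obtain ⟨w, hw, rfl⟩ := hconn.exists_path v u
    have hs : G.wordScale j w ≠ 0 := by
      rw [← abs_pos, abs_wordScale hdiag]; exact Real.exp_pos _
    obtain ⟨L, hL⟩ := exists_nat_ge (max |G.wordScale j w| (1 / |G.wordScale j w|))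
    have hL1 := (le_max_left _ _).trans hL
    have hL2 := (le_max_right _ _).trans hL
    rw [div_le_iff₀ (abs_pos.2 hs)] at hL2
    set P := ENNReal.ofReal (Real.exp (logP p w)) with hP
    have hP0 : P ≠ 0 := by rw [hP, Ne, ENNReal.ofReal_eq_zero, not_le]; exact Real.exp_pos _
    have hPT : P ≠ ⊤ := ENNReal.ofReal_ne_top
    refine ⟨((2 * L + 3 : ℕ) : ENNReal) ^ q * (2 * L + 3 : ℕ) * (P ^ q)⁻¹, ?_, fun δ hδ => ?_⟩
    · refine ENNReal.mul_ne_top (ENNReal.mul_ne_top ?_ (ENNReal.natCast_ne_top _)) ?_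
      · exact ENNReal.rpow_ne_top_of_nonneg hq (ENNReal.natCast_ne_top _)
      · exact ENNReal.inv_ne_top.2 (ENNReal.rpow_pos (pos_iff_ne_zero.2 hP0) hPT).ne'
    · refine (momentSum_map_affine hq (projMeasure (μ (G.wordEnd v w)) j) (s := G.wordScale j w)
        (t := G.wordShift j w) hδ hδ (L := L) (by nlinarith) (by nlinarith) hs).2.trans ?_
      rw [mul_assoc _ (P ^ q)⁻¹]
      gcongr
      rw [← ENNReal.div_eq_inv_mul, ENNReal.le_div_iff_mul_le
        (Or.inl (ENNReal.rpow_pos (pos_iff_ne_zero.2 hP0) hPT).ne')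
        (Or.inl (ENNReal.rpow_ne_top_of_nonneg hq hPT)), mul_comm, ← momentSum_smul hq _ hP0]
      refine momentSum_mono hq δ fun A _ => ?_
      rw [(G.isSection_levelWords w.length v).projMeasure_eq hdiag hp.1 hμ, Measure.finsetSum_apply]
      exact Finset.single_le_sum (f := fun w => (ENNReal.ofReal (Real.exp (logP p w)) •
        (projMeasure (μ (G.wordEnd v w)) j).map
          fun ξ i => G.wordScale j w * ξ i + G.wordShift j w) A) (fun _ _ => zero_le)
        (G.mem_levelWords.2 ⟨rfl, hw⟩)
  choose C hC1 hC2 using key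
  refine ⟨∑ u, ∑ v, C u v, ENNReal.sum_ne_top.2 fun u _ => ENNReal.sum_ne_top.2 fun v _ => hC1 u v,
    fun u v δ hδ => (hC2 u v δ hδ).trans ?_⟩
  gcongr
  exact (Finset.single_le_sum (f := fun v => C u v) (fun _ _ => zero_le) (Finset.mem_univ v)).trans
    (Finset.single_le_sum (f := fun u => ∑ v, C u v) (fun _ _ => zero_le) (Finset.mem_univ u))

/-- Almost submultiplicativity (`q ≥ 1`) and supermultiplicativity (`q ≤ 1`) of the moment sums of
the projections. -/
theorem IsMeasureFamily.exists_mul_bound [Nonempty E] (hdiag : ∀ e, (G.T e).IsDiag)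
    (hconn : G.StronglyConnected) (hrosc : G.ROSC) (hp : G.IsProbVector p)
    (hμ : G.IsMeasureFamily p μ) (hq : 0 ≤ q) (j : Fin 2) (v : V) : ∃ C : ENNReal, C ≠ ⊤ ∧
      ∀ δ₁ δ₂, 0 < δ₁ → δ₁ ≤ 1 → 0 < δ₂ → δ₂ ≤ 1 →
        (1 ≤ q → momentSum (projMeasure (μ v) j) q (δ₁ * δ₂) ≤
          C * (momentSum (projMeasure (μ v) j) q δ₁ * momentSum (projMeasure (μ v) j) q δ₂)) ∧
        (q ≤ 1 → momentSum (projMeasure (μ v) j) q δ₁ * momentSum (projMeasure (μ v) j) q δ₂ ≤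
          C * momentSum (projMeasure (μ v) j) q (δ₁ * δ₂)) := by
  obtain ⟨c, hc, hc1, hsec⟩ := exists_side_section hdiag j
  obtain ⟨C₀, hC₀, hvert⟩ := hμ.exists_vertex_bound hdiag hconn hp hq j
  obtain ⟨L, hL⟩ := exists_nat_ge (1 / c)
  have hL' := hL
  rw [div_le_iff₀ hc] at hL
  have hL1 : (1 : ℝ) ≤ L := le_trans ((one_le_div hc).2 hc1) hL'
  set K : ENNReal := ((2 * L + 3 : ℕ) : ENNReal) ^ q * (2 * L + 3 : ℕ) with hK
  have hKT : K ≠ ⊤ := ENNReal.mul_ne_top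
    (ENNReal.rpow_ne_top_of_nonneg hq (ENNReal.natCast_ne_top _)) (ENNReal.natCast_ne_top _)
  set B : ENNReal := ((9 : ℕ) : ENNReal) ^ q with hB
  have hBT : B ≠ ⊤ := ENNReal.rpow_ne_top_of_nonneg hq (ENNReal.natCast_ne_top _)
  have h9 : ((9 : ℕ) : ENNReal) ≠ ⊤ := ENNReal.natCast_ne_top _
  have hprob := hμ.isProbabilityMeasure_proj
  -- The sum of the constants for q ≥ 1 and for q ≤ 1, so that one C serves both.
  refine ⟨B * (B * (9 : ℕ)) * (K * C₀) + C₀ * K * (B * (9 : ℕ) * (9 : ℕ)), ?_,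
    fun δ₁ δ₂ h1 h1' h2 h2' => ?_⟩
  · exact ENNReal.add_ne_top.2 ⟨ENNReal.mul_ne_top (ENNReal.mul_ne_top hBT
      (ENNReal.mul_ne_top hBT h9)) (ENNReal.mul_ne_top hKT hC₀), ENNReal.mul_ne_top
      (ENNReal.mul_ne_top hC₀ hKT) (ENNReal.mul_ne_top (ENNReal.mul_ne_top hBT h9) h9)⟩
  -- The projection is a mixture of copies of length about δ₁. Each lies within δ₁ of the image of
  -- 0, its centre, and at scale δ₁ δ₂ it has the moment sum of a projection at scale δ₂.
  obtain ⟨S, hS, hSw⟩ := hsec δ₁ h1 h1' v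
  set m : List E → Measure (Fin 1 → ℝ) := fun w => (projMeasure (μ (G.wordEnd v w)) j).map
    fun ξ i => G.wordScale j w * ξ i + G.wordShift j w with hm
  set P : List E → ENNReal := fun w => ENNReal.ofReal (Real.exp (logP p w)) with hP
  have hmp : ∀ w, IsProbabilityMeasure (m w) := fun w =>
    Measure.isProbabilityMeasure_map
      (by fun_prop : Measurable fun (ξ : Fin 1 → ℝ) (i : Fin 1) =>
        G.wordScale j w * ξ i + G.wordShift j w).aemeasurable
  have hsupp : ∀ w ∈ S, m w {ξ | ∀ i, |ξ i - (fun _ => G.wordShift j w : Fin 1 → ℝ) i| ≤ δ₁}ᶜ = 0 := by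
    intro w hw
    have hset : MeasurableSet {ξ : Fin 1 → ℝ | ∀ i, |ξ i - G.wordShift j w| ≤ δ₁} := by
      simp only [Set.ofPred_forall]
      exact MeasurableSet.iInter fun i => measurableSet_le (by fun_prop) measurable_const
    rw [hm, Measure.map_apply (by fun_prop) hset.compl]
    refine measure_mono_null ?_ (hμ.proj_unitInterval hdiag hrosc hp (G.wordEnd v w) j)
    intro ξ hξ hmem
    refine hξ fun i => ?_
    simp only [add_sub_cancel_right, abs_mul]
    have h3 : |ξ i| ≤ 1 := abs_le.2 ⟨by linarith [(hmem i).1], (hmem i).2⟩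
    have h4 := (hSw w hw).2
    nlinarith [abs_nonneg (G.wordScale j w), abs_nonneg (ξ i)]
  have haff : ∀ w ∈ S, momentSum (m w) q (δ₁ * δ₂) ≤
        K * momentSum (projMeasure (μ (G.wordEnd v w)) j) q δ₂ ∧
      momentSum (projMeasure (μ (G.wordEnd v w)) j) q δ₂ ≤ K * momentSum (m w) q (δ₁ * δ₂) := by
    intro w hw
    obtain ⟨h3, h4⟩ := hSw w hw
    have h5 : 0 < |G.wordScale j w| := lt_of_lt_of_le (mul_pos hc h1) h3
    refine momentSum_map_affine hq _ (mul_pos h1 h2) h2 ?_ ?_ (abs_pos.1 h5)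
    · nlinarith [mul_le_mul_of_nonneg_right h4 h2.le, mul_pos h1 h2]
    · have h6 : δ₁ ≤ L * |G.wordScale j w| := by
        nlinarith [mul_le_mul_of_nonneg_left h3 (by linarith : (0 : ℝ) ≤ L)]
      nlinarith [mul_le_mul_of_nonneg_right h6 h2.le]
  have heq : projMeasure (μ v) j = ∑ w ∈ S, P w • m w := hS.projMeasure_eq hdiag hp.1 hμ j
  have hδ : δ₁ * δ₂ ≤ δ₁ := mul_le_of_le_one_right h1.le h2'
  constructor
  · intro hq1
    have h3 := momentSum_mixture_submul (P := P) hq1 h1 hδ hsupp (fun w => ENNReal.ofReal_ne_top)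
      (D := K * C₀ * momentSum (projMeasure (μ v) j) q δ₂) fun w hw => by
        refine (haff w hw).1.trans ?_
        rw [mul_assoc K]
        exact mul_le_mul_right (hvert _ _ _ h2) K
    rw [← heq] at h3
    refine h3.trans ?_
    calc _ = B * (B * (9 : ℕ)) * (K * C₀) * (momentSum (projMeasure (μ v) j) q δ₁ *
            momentSum (projMeasure (μ v) j) q δ₂) := by ring
      _ ≤ _ := by gcongr; exact le_self_add
  · intro hq1
    -- Here K accounts for the affine change of scale and C₀ for the change of vertex.
    have h3 := momentSum_mixture_supermul (P := P) hq hq1 h1 hδ hsupp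
      (fun w => ENNReal.ofReal_ne_top)
      (D := (C₀ * K)⁻¹ * momentSum (projMeasure (μ v) j) q δ₂) fun w hw => by
        rw [← ENNReal.div_eq_inv_mul]
        refine ENNReal.div_le_of_le_mul ?_
        rw [mul_comm _ (C₀ * K), mul_assoc]
        refine (hvert v (G.wordEnd v w) _ h2).trans ?_
        gcongr
        exact (haff w hw).2
    rw [← heq] at h3
    have hne : C₀ * K ≠ 0 := by
      intro h0
      have h5 := hvert v v δ₂ h2
      have h6 := hμ.momentSum_proj_ne hdiag hrosc hp hq v j h2
      have hK0 : K ≠ 0 := by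
        rw [hK]
        refine mul_ne_zero (ENNReal.rpow_pos ?_ (ENNReal.natCast_ne_top _)).ne' ?_
        · exact_mod_cast (by omega : 0 < 2 * L + 3)
        · exact_mod_cast (by omega : 2 * L + 3 ≠ 0)
      rcases mul_eq_zero.1 h0 with h | h
      · rw [h, zero_mul] at h5
        exact h6.1 (le_antisymm h5 zero_le)
      · exact hK0 h
    calc momentSum (projMeasure (μ v) j) q δ₁ * momentSum (projMeasure (μ v) j) q δ₂
        = C₀ * K * ((C₀ * K)⁻¹ * momentSum (projMeasure (μ v) j) q δ₂ *
            momentSum (projMeasure (μ v) j) q δ₁) := by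
          rw [← mul_assoc, ← mul_assoc, ENNReal.mul_inv_cancel hne (ENNReal.mul_ne_top hC₀ hKT),
            one_mul, mul_comm]
      _ ≤ C₀ * K * (B * (9 : ℕ) * ((9 : ℕ) * momentSum (projMeasure (μ v) j) q (δ₁ * δ₂))) := by
          gcongr
      _ = C₀ * K * (B * (9 : ℕ) * (9 : ℕ)) * momentSum (projMeasure (μ v) j) q (δ₁ * δ₂) := by ring
      _ ≤ _ := by gcongr; exact le_add_self

/-- The spectra of the projections exist and do not depend on the vertex. -/
theorem IsMeasureFamily.exists_hasLqSpectrum_proj [Nonempty V] (hdiag : ∀ e, (G.T e).IsDiag)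
    (hconn : G.StronglyConnected) (hrosc : G.ROSC) (hp : G.IsProbVector p)
    (hμ : G.IsMeasureFamily p μ) (hq : 0 ≤ q) (j : Fin 2) :
    ∃ t, ∀ v, HasLqSpectrum (projMeasure (μ v) j) q t := by
  have := hconn.nonempty_edge
  obtain ⟨v₀⟩ := ‹Nonempty V›
  obtain ⟨C, hCT, hmul⟩ := hμ.exists_mul_bound hdiag hconn hrosc hp hq j v₀
  have hne := fun v {δ : ℝ} (hδ : 0 < δ) => hμ.momentSum_proj_ne hdiag hrosc hp hq v j hδ
  set Z : ℕ → ℝ := fun n => (momentSum (projMeasure (μ v₀) j) q ((1 / 2) ^ n)).toReal with hZ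
  have hZpos : ∀ n, 0 < Z n := fun n =>
    ENNReal.toReal_pos (hne v₀ (by positivity)).1 (hne v₀ (by positivity)).2
  have hhalf : ∀ n : ℕ, (0 : ℝ) < (1 / 2) ^ n ∧ ((1 : ℝ) / 2) ^ n ≤ 1 := fun n =>
    ⟨by positivity, pow_le_one₀ (by norm_num) (by norm_num)⟩
  have hZbound : ∀ n : ℕ, |Real.log (Z n)| ≤ (1 + q) * Real.log 5 * (n + 1) := by
    intro n
    have := hμ.isProbabilityMeasure_proj v₀ j
    obtain ⟨h1, h2⟩ := momentSum_bounds hq _ (hμ.proj_unitInterval hdiag hrosc hp v₀ j)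
      (hhalf n).1 (L := 2 ^ n) (by push_cast; rw [← mul_pow]; norm_num)
    have hN : ((2 * 2 ^ n + 3 : ℕ) : ℝ) ≤ 5 ^ (n + 1) := by
      have h3 : 2 * 2 ^ n + 3 ≤ 5 ^ (n + 1) := by
        have h4 : 2 ^ n ≤ 5 ^ n := Nat.pow_le_pow_left (by norm_num) n
        have h5 : 1 ≤ 5 ^ n := Nat.one_le_pow _ _ (by norm_num)
        rw [pow_succ]; omega
      exact_mod_cast h3
    have hlogN : Real.log ((2 * 2 ^ n + 3 : ℕ) : ℝ) ≤ (n + 1) * Real.log 5 := by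
      refine (Real.log_le_log (by positivity) hN).trans_eq ?_
      rw [Real.log_pow]; push_cast; ring
    have hl5 : 0 < Real.log 5 := Real.log_pos (by norm_num)
    have e1 := log_toReal_le_of_le_mul (hne v₀ (hhalf n).1).1 one_ne_zero ENNReal.one_ne_top
      (ENNReal.natCast_ne_top (2 * 2 ^ n + 3)) (by rwa [mul_one])
    have e2 := log_toReal_le_of_le_mul one_ne_zero (hne v₀ (hhalf n).1).1 (hne v₀ (hhalf n).1).2
      (ENNReal.rpow_ne_top_of_nonneg hq (ENNReal.natCast_ne_top _)) h2
    rw [ENNReal.toReal_one, Real.log_one] at e1 e2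
    rw [← ENNReal.toReal_rpow, ENNReal.toReal_natCast, Real.log_rpow (by positivity)] at e2
    rw [ENNReal.toReal_natCast] at e1
    have hn0 : (0 : ℝ) ≤ n := Nat.cast_nonneg n
    have e3 : q * Real.log ((2 * 2 ^ n + 3 : ℕ) : ℝ) ≤ q * ((n + 1) * Real.log 5) :=
      mul_le_mul_of_nonneg_left hlogN hq
    have e4 : 0 ≤ q * ((n + 1) * Real.log 5) := by positivity
    have e5 : 0 ≤ (n + 1) * Real.log 5 := by positivity
    change |Real.log (momentSum (projMeasure (μ v₀) j) q ((1 / 2) ^ n)).toReal| ≤ _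
    rw [abs_le]
    constructor <;> nlinarith
  have hlim : ∃ t, Tendsto (fun n : ℕ => Real.log (Z n) / n) atTop (𝓝 t) := by
    have hC0 : (0 : ℝ) < C.toReal + 1 := by positivity
    -- Convexity or concavity of the q-th power decides which form of Fekete's lemma applies.
    rcases le_total 1 q with h1 | h1
    · refine exists_tendsto_log_div_of_submul hZpos hC0 (fun m n => ?_) hZbound
      have h2 := (hmul _ _ (hhalf m).1 (hhalf m).2 (hhalf n).1 (hhalf n).2).1 h1
      have h3 := ENNReal.toReal_mono (ENNReal.mul_ne_top hCT (ENNReal.mul_ne_top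
        (hne v₀ (hhalf m).1).2 (hne v₀ (hhalf n).1).2)) h2
      rw [ENNReal.toReal_mul, ENNReal.toReal_mul, ← pow_add] at h3
      refine h3.trans (mul_le_mul_of_nonneg_right (by linarith)
        (mul_pos (hZpos m) (hZpos n)).le)
    · refine exists_tendsto_log_div_of_supermul hZpos hC0 (fun m n => ?_) hZbound
      have h2 := (hmul _ _ (hhalf m).1 (hhalf m).2 (hhalf n).1 (hhalf n).2).2 h1
      rw [← pow_add] at h2
      have h3 := ENNReal.toReal_mono (ENNReal.mul_ne_top hCT (hne v₀ (hhalf (m + n)).1).2) h2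
      rw [ENNReal.toReal_mul, ENNReal.toReal_mul] at h3
      refine h3.trans (mul_le_mul_of_nonneg_right (by linarith) (hZpos (m + n)).le)
  obtain ⟨t, ht⟩ := hlim
  have hdy : HasLqSpectrum (projMeasure (μ v₀) j) q (t / Real.log 2) := by
    set K : ENNReal := ((2 * 2 + 3 : ℕ) : ENNReal) ^ q * (2 * 2 + 3 : ℕ) with hK
    have hKT : K ≠ ⊤ := ENNReal.mul_ne_top
      (ENNReal.rpow_ne_top_of_nonneg hq (ENNReal.natCast_ne_top _)) (ENNReal.natCast_ne_top _)
    refine tendsto_of_dyadic (f := fun δ => Real.log (momentSum (projMeasure (μ v₀) j) q δ).toReal)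
      (C := Real.log K.toReal) ht fun n δ h1 h2 => ?_
    have hδ : 0 < δ := lt_of_lt_of_le (by have := (hhalf n).1; linarith) h1
    -- The identity, read as an affine map, compares two meshes whose sizes differ by a factor at
    -- most 2.
    have h3 := momentSum_map_affine hq (projMeasure (μ v₀) j) (s := 1) (t := 0) hδ (hhalf n).1
      (L := 2) (by rw [abs_one, one_mul]; push_cast; linarith)
      (by rw [abs_one, one_mul]; push_cast; linarith [(hhalf n).1]) one_ne_zero
    have hid : (projMeasure (μ v₀) j).map (fun ξ i => 1 * ξ i + 0) = projMeasure (μ v₀) j := by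
      simp only [one_mul, add_zero]
      exact Measure.map_id
    rw [hid] at h3
    have e1 := log_toReal_le_of_le_mul (hne v₀ hδ).1 (hne v₀ (hhalf n).1).1 (hne v₀ (hhalf n).1).2
      hKT h3.1
    have e2 := log_toReal_le_of_le_mul (hne v₀ (hhalf n).1).1 (hne v₀ hδ).1 (hne v₀ hδ).2 hKT h3.2
    rw [abs_le]
    constructor <;> linarith
  obtain ⟨C₀, hC₀, hvert⟩ := hμ.exists_vertex_bound hdiag hconn hp hq j
  refine ⟨_, fun v => tendsto_div_neg_log_of_bounded_sub (C := Real.log C₀.toReal) hdy ?_⟩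
  filter_upwards [self_mem_nhdsWithin] with δ hδ
  have hδ : 0 < δ := hδ
  have e1 := log_toReal_le_of_le_mul (hne v hδ).1 (hne v₀ hδ).1 (hne v₀ hδ).2 hC₀ (hvert v v₀ δ hδ)
  have e2 := log_toReal_le_of_le_mul (hne v₀ hδ).1 (hne v hδ).1 (hne v hδ).2 hC₀ (hvert v₀ v δ hδ)
  rw [abs_le]
  constructor <;> linarith

end BoxLikeGIFS

end

noncomputable section

/-! ### The spectrum of the planar measures -/

/-- An open interval that is not too short contains a grid point close to a given point of its
closure. -/
theorem exists_grid_point {s t η x₀ : ℝ} (hη : 0 < η) (hs : 2 * η ≤ |s|)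
    (hx : x₀ ∈ Set.Icc (0 : ℝ) 1) :
    ∃ g : ℤ, ∃ x ∈ Set.Ioo (0 : ℝ) 1, s * x + t = η * g ∧ |η * g - (s * x₀ + t)| ≤ 2 * η := by
  have key : ∀ s t x₀ : ℝ, 2 * η ≤ s → x₀ ∈ Set.Icc (0 : ℝ) 1 →
      ∃ g : ℤ, ∃ x ∈ Set.Ioo (0 : ℝ) 1, s * x + t = η * g ∧ |η * g - (s * x₀ + t)| ≤ 2 * η := by
    intro s t x₀ hs hx
    have hs0 : 0 < s := by linarith
    set z := s * x₀ + t with hz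
    have hz1 : t ≤ z := by rw [hz]; nlinarith [mul_nonneg hs0.le hx.1]
    have hz2 : z ≤ t + s := by rw [hz]; nlinarith [mul_le_mul_of_nonneg_left hx.2 hs0.le]
    -- The window [y, y + 2η] lies in [t, t + s] and within 2η of z. The first grid point beyond y
    -- is at distance at most η from y, hence interior.
    set y := max t (z - 2 * η) with hy
    have hy1 : t ≤ y := le_max_left _ _
    have hy2 : z - 2 * η ≤ y := le_max_right _ _
    have hy3 : y ≤ z := max_le hz1 (by linarith)
    have hy4 : y + 2 * η ≤ t + s := by
      rcases max_choice t (z - 2 * η) with h | h <;> rw [hy, h] <;> linarith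
    have h1 : y < η * (⌊y / η⌋ + 1 : ℤ) := by
      have := Int.lt_floor_add_one (y / η)
      rw [div_lt_iff₀ hη] at this
      push_cast
      linarith
    have h2 : η * (⌊y / η⌋ + 1 : ℤ) ≤ y + η := by
      have := Int.floor_le (y / η)
      rw [le_div_iff₀ hη] at this
      push_cast
      linarith
    refine ⟨⌊y / η⌋ + 1, (η * (⌊y / η⌋ + 1 : ℤ) - t) / s, ⟨?_, ?_⟩, ?_, ?_⟩
    · exact div_pos (by linarith) hs0
    · rw [div_lt_one hs0]; linarith
    · field_simp; ring
    · rw [abs_le]; constructor <;> linarith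
  rcases le_total 0 s with h | h
  · rw [abs_of_nonneg h] at hs
    exact key s t x₀ hs hx
  · rw [abs_of_nonpos h] at hs
    -- The reflection x ↦ 1 - x makes the slope positive.
    obtain ⟨g, x, hx', h1, h2⟩ := key (-s) (t + s) (1 - x₀) hs
      ⟨by linarith [hx.2], by linarith [hx.1]⟩
    refine ⟨g, 1 - x, ⟨by linarith [hx'.2], by linarith [hx'.1]⟩, by rw [← h1]; ring, ?_⟩
    rwa [show -s * (1 - x₀) + (t + s) = s * x₀ + t by ring] at h2

/-- A criterion for a logarithmic order in terms of errors that are small relative to `-log δ`. -/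
theorem tendsto_div_neg_log_of_forall_error {f : ℝ → ℝ} {t : ℝ}
    (h : ∀ ε > 0, ∃ K, ∀ᶠ δ in 𝓝[>] (0 : ℝ), |f δ + t * Real.log δ| ≤ ε * (-Real.log δ) + K) :
    Tendsto (fun δ => f δ / (-Real.log δ)) (𝓝[>] 0) (𝓝 t) := by
  rw [Metric.tendsto_nhds]
  intro ε hε
  obtain ⟨K, hK⟩ := h (ε / 3) (by positivity)
  have hKlim : ∀ᶠ δ in 𝓝[>] (0 : ℝ), K < ε / 3 * (-Real.log δ) :=
    (tendsto_neg_log_nhdsGT_zero.const_mul_atTop (by positivity : 0 < ε / 3)).eventually_gt_atTop K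
  filter_upwards [hK, hKlim, tendsto_neg_log_nhdsGT_zero.eventually_gt_atTop 0] with δ h1 h2 h3
  rw [Real.dist_eq]
  have h4 : f δ / (-Real.log δ) - t = (f δ + t * Real.log δ) / (-Real.log δ) := by
    have hne : Real.log δ ≠ 0 := (neg_pos.1 h3).ne
    field_simp
    ring
  rw [h4, abs_div, abs_of_pos h3, div_lt_iff₀ h3]
  nlinarith

namespace BoxLikeGIFS

variable {V E : Type*} {G : BoxLikeGIFS V E}

/-- The moment sum of the image of a measure under the map of a word with a short side. -/
theorem momentSum_map_wordMap (hdiag : ∀ e, (G.T e).IsDiag) {q : ℝ} (hq : 0 ≤ q)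
    (ν : Measure (Fin 2 → ℝ)) (hν : ν {ξ | ∀ j, 0 ≤ ξ j ∧ ξ j ≤ 1}ᶜ = 0) {j j' : Fin 2} (hj : j ≠ j')
    (w : List E) {δ : ℝ} (hδ : 0 < δ) (hw : |G.wordScale j' w| ≤ δ) :
    momentSum (ν.map (G.wordMap w)) q δ ≤ ((5 ^ 2 : ℕ) : ENNReal) ^ q * (5 ^ 2 : ℕ) *
      (((2 * 1 + 3 : ℕ) : ENNReal) ^ q * (2 * 1 + 3 : ℕ)) *
        momentSum (projMeasure ν j) q (δ / |G.wordScale j w|) ∧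
    momentSum (projMeasure ν j) q (δ / |G.wordScale j w|) ≤ ((5 ^ 2 : ℕ) : ENNReal) ^ q *
      (5 ^ 2 : ℕ) * (((2 * 1 + 3 : ℕ) : ENNReal) ^ q * (2 * 1 + 3 : ℕ)) *
        momentSum (ν.map (G.wordMap w)) q δ := by
  have hs : G.wordScale j w ≠ 0 := by
    rw [← abs_pos, abs_wordScale hdiag]; exact Real.exp_pos _
  have hset : ∀ c : ℝ, MeasurableSet {ξ : Fin 2 → ℝ | c ≤ ξ j' ∧ ξ j' ≤ c + δ} := fun c =>
    MeasurableSet.inter (measurableSet_le measurable_const (measurable_pi_apply j'))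
      (measurableSet_le (measurable_pi_apply j') measurable_const)
  have hstrip : (ν.map (G.wordMap w)) {ξ | G.wordShift j' w + min 0 (G.wordScale j' w) ≤ ξ j' ∧
      ξ j' ≤ G.wordShift j' w + min 0 (G.wordScale j' w) + δ}ᶜ = 0 := by
    rw [Measure.map_apply (measurable_wordMap hdiag w) (hset _).compl]
    refine measure_mono_null ?_ hν
    intro ξ hξ hmem
    refine hξ ?_
    have h1 := hmem j'
    change _ ≤ G.wordMap w ξ j' ∧ G.wordMap w ξ j' ≤ _
    rw [wordMap_apply hdiag]
    rw [abs_le] at hw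
    rcases le_total 0 (G.wordScale j' w) with h | h
    · rw [min_eq_left h]
      constructor <;> nlinarith [mul_nonneg h h1.1, mul_le_mul_of_nonneg_left h1.2 h]
    · rw [min_eq_right h]
      constructor <;> nlinarith [mul_nonneg (neg_nonneg.2 h) h1.1,
        mul_le_mul_of_nonneg_left h1.2 (neg_nonneg.2 h)]
  -- The short side is at most δ, so the image lies in a strip and only its projection matters; the
  -- affine change then rescales δ by the other side.
  have h1 := momentSum_strip hq (ν.map (G.wordMap w)) hj hδ hstrip
  have h2 := momentSum_map_affine hq (projMeasure ν j) (s := G.wordScale j w)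
    (t := G.wordShift j w) hδ (δ' := δ / |G.wordScale j w|) (div_pos hδ (abs_pos.2 hs)) (L := 1)
    (by rw [mul_div_cancel₀ _ (abs_pos.2 hs).ne']; simp)
    (by rw [mul_div_cancel₀ _ (abs_pos.2 hs).ne']; simp) hs
  rw [← projMeasure_map_wordMap hdiag] at h2
  exact ⟨h1.1.trans ((mul_le_mul_right h2.1 _).trans (le_of_eq (by ring))),
    h2.2.trans ((mul_le_mul_right h1.2 _).trans (le_of_eq (by ring)))⟩

variable [DecidableEq V] [Fintype E]

/-- Each mesh square meets boundedly many rectangles of a section whose sides are not shorter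
than a fixed multiple of the mesh size. -/
theorem exists_packing_bound (hdiag : ∀ e, (G.T e).IsDiag) (hrosc : G.ROSC) {c : ℝ} (hc : 0 < c) :
    ∃ N : ℕ, ∀ δ > 0, ∀ v S, G.IsSection v S → (∀ w ∈ S, ∀ j, c * δ ≤ |G.wordScale j w|) →
      ∀ k : Fin 2 → ℤ, ∃ S' : Finset (List E), S'.card ≤ N ∧ ∀ w ∈ S,
        (∃ ξ : Fin 2 → ℝ, (∀ j, 0 ≤ ξ j ∧ ξ j ≤ 1) ∧ G.wordMap w ξ ∈ meshCube δ k) → w ∈ S' := by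
  classical
  obtain ⟨L, hL⟩ := exists_nat_ge (2 / c)
  rw [div_le_iff₀ hc] at hL
  refine ⟨(2 * (L + 5) + 1) ^ 2, fun δ hδ v S hS hside k => ?_⟩
  -- Half the least side: every rectangle meeting the mesh square has a point of the η-grid in its
  -- interior, within 2η of the square. Disjoint interiors have different grid points, and only
  -- boundedly many of these are that near.
  set η := c * δ / 2 with hη
  have hη0 : 0 < η := by positivity
  have hgrid : ∀ w ∈ S.filter (fun w => ∃ ξ : Fin 2 → ℝ, (∀ j, 0 ≤ ξ j ∧ ξ j ≤ 1) ∧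
      G.wordMap w ξ ∈ meshCube δ k), ∃ (g : Fin 2 → ℤ) (ζ z : Fin 2 → ℝ), ζ ∈ openSquare ∧
      z ∈ meshCube δ k ∧ ∀ j, G.wordMap w ζ j = η * g j ∧ |η * g j - z j| ≤ 2 * η := by
    intro w hw
    obtain ⟨hwS, ξ, hξ, hmem⟩ := Finset.mem_filter.1 hw
    have h1 := fun j => exists_grid_point (s := G.wordScale j w) (t := G.wordShift j w) hη0
      (by rw [hη]; have := hside w hwS j; linarith) (hξ j)
    choose g ζ hζ h2 h3 using h1
    refine ⟨g, ζ, G.wordMap w ξ, hζ, hmem, fun j => ?_⟩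
    rw [wordMap_apply hdiag, wordMap_apply hdiag]
    exact ⟨h2 j, h3 j⟩
  choose! g ζ z hζ hz hg using hgrid
  refine ⟨S.filter (fun w => ∃ ξ : Fin 2 → ℝ, (∀ j, 0 ≤ ξ j ∧ ξ j ≤ 1) ∧
      G.wordMap w ξ ∈ meshCube δ k), ?_, fun w hw h => Finset.mem_filter.2 ⟨hw, h⟩⟩
  set S' := S.filter (fun w => ∃ ξ : Fin 2 → ℝ, (∀ j, 0 ≤ ξ j ∧ ξ j ≤ 1) ∧
      G.wordMap w ξ ∈ meshCube δ k) with hS'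
  obtain ⟨N, hN, hmem⟩ := exists_finset_of_pairwise_le (fun κ => ∃ w ∈ S', g w = κ) (L + 5) (by
    rintro κ κ' ⟨w, hw, rfl⟩ ⟨w', hw', rfl⟩ j
    have h1 := abs_le.1 (hg w hw j).2
    have h2 := abs_le.1 (hg w' hw' j).2
    have h3 := meshCube_sub_le (hz w hw) (hz w' hw') j
    have h4 : η * (g w j : ℝ) ≤ η * (g w' j + L + 4) := by
      have : δ ≤ η * L := by rw [hη]; nlinarith
      linarith
    have h5 := le_of_mul_le_mul_left h4 hη0
    have h6 : (g w j : ℝ) ≤ ((g w' j + (L + 5 : ℕ) : ℤ) : ℝ) := by push_cast; linarith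
    exact_mod_cast h6)
  refine (Finset.card_le_card_of_injOn g (fun w hw => hmem _ ⟨w, hw, rfl⟩) ?_).trans hN
  intro w hw w' hw' heq
  by_contra hne
  have hd := hS.disjoint hdiag hrosc w (Finset.mem_filter.1 hw).1 w' (Finset.mem_filter.1 hw').1 hne
  refine Set.disjoint_left.1 hd ⟨ζ w, hζ w hw, rfl⟩ ⟨ζ w', hζ w' hw', ?_⟩
  funext j
  rw [(hg w hw j).1, (hg w' hw' j).1, heq]

/-- Sections by the length of the shortest side. -/
theorem exists_min_side_section [Nonempty E] (hdiag : ∀ e, (G.T e).IsDiag) : ∃ c > 0, c ≤ 1 ∧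
    ∀ δ, 0 < δ → δ ≤ 1 → ∀ v, ∃ S, G.IsSection v S ∧
      ∀ w ∈ S, c * δ ≤ min |G.wordScale 0 w| |G.wordScale 1 w| ∧
        min |G.wordScale 0 w| |G.wordScale 1 w| ≤ δ := by
  obtain ⟨c, hc, κ, hκ1, hcκ, h⟩ := exists_ratio_bounds hdiag
  have hκ : 0 ≤ κ := hc.le.trans hcκ
  refine ⟨c, hc, by linarith, fun δ hδ hδ1 v => ?_⟩
  refine G.exists_stopping_section (m := fun w => min |G.wordScale 0 w| |G.wordScale 1 w|) hc.le
    hκ hκ1 (by simp [wordScale]) (fun w e => ?_) (by linarith) hδ hδ1 v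
  have hstep : ∀ j, G.wordScale j (w ++ [e]) = G.wordScale j w * G.T e j j := fun j => by
    simp [wordScale]
  simp only [hstep, abs_mul]
  rw [mul_min_of_nonneg _ _ hc.le, mul_min_of_nonneg _ _ hκ, mul_comm c, mul_comm c, mul_comm κ,
    mul_comm κ]
  exact ⟨min_le_min (mul_le_mul_of_nonneg_left (h e 0).1 (abs_nonneg _))
      (mul_le_mul_of_nonneg_left (h e 1).1 (abs_nonneg _)),
    min_le_min (mul_le_mul_of_nonneg_left (h e 0).2 (abs_nonneg _))
      (mul_le_mul_of_nonneg_left (h e 1).2 (abs_nonneg _))⟩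

variable [Fintype V] {p : E → ℝ} {μ : V → Measure (Fin 2 → ℝ)} {q : ℝ}

/-- Uniform bounds for the moment sums of the projections in terms of the spectrum. -/
theorem IsMeasureFamily.exists_proj_error [Nonempty E] (hdiag : ∀ e, (G.T e).IsDiag)
    (hrosc : G.ROSC) (hp : G.IsProbVector p) (hμ : G.IsMeasureFamily p μ) (hq : 0 ≤ q) (j : Fin 2)
    {t : ℝ} (ht : ∀ v, HasLqSpectrum (projMeasure (μ v) j) q t) {ε D : ℝ} (hε : 0 < ε)
    (hD : 1 ≤ D) : ∃ K, ∀ v δ, 0 < δ → δ ≤ D →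
      |Real.log (momentSum (projMeasure (μ v) j) q δ).toReal + t * Real.log δ| ≤
        ε * |Real.log δ| + K := by
  have key : ∀ v, ∃ K, 0 ≤ K ∧ ∀ δ, 0 < δ → δ ≤ D →
      |Real.log (momentSum (projMeasure (μ v) j) q δ).toReal + t * Real.log δ| ≤
        ε * |Real.log δ| + K := by
    intro v
    have := hμ.isProbabilityMeasure_proj v j
    -- The spectrum controls all scales below some δ₀. On [δ₀, D] every quantity is bounded, and the
    -- bounds go into the constant.
    have h1 : ∀ᶠ δ in 𝓝[>] (0 : ℝ), |lqQuotient (projMeasure (μ v) j) q δ - t| < ε ∧ δ < 1 := by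
      refine ((Metric.tendsto_nhds.1 (ht v)) ε hε).and ?_
      exact nhdsWithin_le_nhds (gt_mem_nhds one_pos)
    obtain ⟨δ₀, hδ₀, hsmall⟩ := mem_nhdsGT_iff_exists_Ioo_subset.1 h1
    have hδ₀ : 0 < δ₀ := hδ₀
    obtain ⟨L, hL⟩ := exists_nat_ge (1 / δ₀)
    rw [div_le_iff₀ hδ₀] at hL
    set N : ℝ := ((2 * L + 3 : ℕ) : ℝ) with hN
    have hN1 : 1 ≤ N := by rw [hN]; exact_mod_cast (by omega : 1 ≤ 2 * L + 3)
    have hlogN := Real.log_nonneg hN1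
    refine ⟨(1 + q) * Real.log N + |t| * (|Real.log δ₀| + Real.log D), by
      have := Real.log_nonneg hD; positivity, fun δ hδ hδD => ?_⟩
    have hlogD := Real.log_nonneg hD
    rcases lt_or_ge δ δ₀ with hlt | hge
    · obtain ⟨h2, h3⟩ := hsmall ⟨hδ, hlt⟩
      have hneg : Real.log δ < 0 := Real.log_neg hδ h3
      have h4 : Real.log (momentSum (projMeasure (μ v) j) q δ).toReal + t * Real.log δ =
          (lqQuotient (projMeasure (μ v) j) q δ - t) * (-Real.log δ) := by
        rw [lqQuotient]
        have := hneg.ne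
        field_simp
        ring
      rw [h4, abs_mul, abs_neg]
      have h5 := mul_le_mul_of_nonneg_right h2.le (abs_nonneg (Real.log δ))
      have : 0 ≤ (1 + q) * Real.log N + |t| * (|Real.log δ₀| + Real.log D) := by positivity
      linarith
    · have hne := hμ.momentSum_proj_ne hdiag hrosc hp hq v j hδ
      obtain ⟨h2, h3⟩ := momentSum_bounds hq _ (hμ.proj_unitInterval hdiag hrosc hp v j) hδ (L := L)
        (hL.trans (mul_le_mul_of_nonneg_left hge (Nat.cast_nonneg L)))
      have e1 := log_toReal_le_of_le_mul hne.1 one_ne_zero ENNReal.one_ne_top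
        (ENNReal.natCast_ne_top (2 * L + 3)) (by rwa [mul_one])
      have e2 := log_toReal_le_of_le_mul one_ne_zero hne.1 hne.2
        (ENNReal.rpow_ne_top_of_nonneg hq (ENNReal.natCast_ne_top _)) h3
      rw [ENNReal.toReal_one, Real.log_one] at e1 e2
      rw [← ENNReal.toReal_rpow, ENNReal.toReal_natCast, Real.log_rpow (by positivity)] at e2
      rw [ENNReal.toReal_natCast] at e1
      have e3 : |Real.log (momentSum (projMeasure (μ v) j) q δ).toReal| ≤ (1 + q) * Real.log N := by
        have := mul_nonneg hq hlogN
        rw [abs_le]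
        constructor <;> linarith
      have e4 : |Real.log δ| ≤ |Real.log δ₀| + Real.log D := by
        have h5 := Real.log_le_log hδ₀ hge
        have h6 := Real.log_le_log hδ hδD
        have h7 := neg_abs_le (Real.log δ₀)
        rw [abs_le]
        constructor <;> linarith [abs_nonneg (Real.log δ₀)]
      refine (abs_add_le _ _).trans ?_
      rw [abs_mul]
      have e5 := mul_le_mul_of_nonneg_left e4 (abs_nonneg t)
      have e6 : 0 ≤ ε * |Real.log δ| := by positivity
      linarith
  choose K hK0 hK using key
  refine ⟨∑ v, K v, fun v δ h1 h2 => (hK v δ h1 h2).trans ?_⟩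
  have := Finset.single_le_sum (f := K) (fun v _ => hK0 v) (Finset.mem_univ v)
  linarith

end BoxLikeGIFS

end

/-! ### Moment sums of the pieces of a section, and the spectrum of the planar measures. -/

noncomputable section

namespace BoxLikeGIFS

variable {V E : Type*} {G : BoxLikeGIFS V E} [Fintype V] [DecidableEq V] [Fintype E] {p : E → ℝ}
  {μ : V → Measure (Fin 2 → ℝ)} {q : ℝ}

/-- The moment sum at scale `δ` of the part of the measure carried by a word whose short side is
comparable to `δ`. -/
theorem IsMeasureFamily.exists_axis_error [Nonempty E] (hdiag : ∀ e, (G.T e).IsDiag)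
    (hrosc : G.ROSC) (hp : G.IsProbVector p) (hμ : G.IsMeasureFamily p μ) (hq : 0 ≤ q)
    {j j' : Fin 2} (hj : j ≠ j') {t : ℝ} (ht : ∀ v, HasLqSpectrum (projMeasure (μ v) j) q t)
    (s : ℝ) {ε c : ℝ} (hε : 0 < ε) (hc : 0 < c) (hc1 : c ≤ 1) :
    ∃ K, ∀ v w δ, 0 < δ → δ ≤ 1 → G.logSide j' w ≤ G.logSide j w → G.logSide j w ≤ 0 →
      Real.log c + Real.log δ ≤ G.logSide j' w → G.logSide j' w ≤ Real.log δ →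
      momentSum (ENNReal.ofReal (Real.exp (logP p w)) • (μ v).map (G.wordMap w)) q δ ≠ 0 ∧
      momentSum (ENNReal.ofReal (Real.exp (logP p w)) • (μ v).map (G.wordMap w)) q δ ≠ ⊤ ∧
      |Real.log (momentSum (ENNReal.ofReal (Real.exp (logP p w)) •
          (μ v).map (G.wordMap w)) q δ).toReal -
        (q * logP p w + t * G.logSide j w + (s - t) * G.logSide j' w - s * Real.log δ)| ≤
          ε * (-Real.log δ) + K := by
  obtain ⟨K₁, hK₁⟩ := hμ.exists_proj_error hdiag hrosc hp hq j ht hε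
    (D := 1 / c) (by rw [le_div_iff₀ hc]; linarith)
  set A : ENNReal := ((5 ^ 2 : ℕ) : ENNReal) ^ q * (5 ^ 2 : ℕ) *
      (((2 * 1 + 3 : ℕ) : ENNReal) ^ q * (2 * 1 + 3 : ℕ)) with hA
  have hAT : A ≠ ⊤ := by
    have h1 : ∀ n : ℕ, (n : ENNReal) ^ q * n ≠ ⊤ := fun n => ENNReal.mul_ne_top
      (ENNReal.rpow_ne_top_of_nonneg hq (ENNReal.natCast_ne_top n)) (ENNReal.natCast_ne_top n)
    exact ENNReal.mul_ne_top (h1 _) (h1 _)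
  refine ⟨Real.log A.toReal + ε * (-Real.log c) + K₁ + |s - t| * (-Real.log c),
    fun v w δ hδ hδ1 h12 h10 hlow hup => ?_⟩
  have hscale : ∀ i, |G.wordScale i w| = Real.exp (G.logSide i w) := fun i =>
    abs_wordScale hdiag i w
  have hδ' : 0 < δ / |G.wordScale j w| := by
    rw [hscale]; exact div_pos hδ (Real.exp_pos _)
  have hlogδ' : Real.log (δ / |G.wordScale j w|) = Real.log δ - G.logSide j w := by
    rw [hscale, Real.log_div hδ.ne' (Real.exp_pos _).ne', Real.log_exp]
  have hne := hμ.momentSum_proj_ne hdiag hrosc hp hq v j hδ'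
  obtain ⟨h1, h2⟩ := momentSum_map_wordMap hdiag hq (μ v) (hμ.unitSquare hdiag hrosc hp v) hj w hδ
    (by rw [hscale, ← Real.le_log_iff_exp_le hδ]; exact hup)
  rw [← hA] at h1 h2
  have hmT : momentSum ((μ v).map (G.wordMap w)) q δ ≠ ⊤ :=
    (h1.trans_lt (ENNReal.mul_lt_top hAT.lt_top hne.2.lt_top)).ne
  have hm0 : momentSum ((μ v).map (G.wordMap w)) q δ ≠ 0 := by
    intro h
    rw [h, mul_zero] at h2
    exact hne.1 (le_antisymm h2 zero_le)
  have hP0 : ENNReal.ofReal (Real.exp (logP p w)) ≠ 0 :=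
    (ENNReal.ofReal_pos.2 (Real.exp_pos _)).ne'
  have hPT : ENNReal.ofReal (Real.exp (logP p w)) ^ q ≠ ⊤ :=
    ENNReal.rpow_ne_top_of_nonneg hq ENNReal.ofReal_ne_top
  have hPq0 : ENNReal.ofReal (Real.exp (logP p w)) ^ q ≠ 0 := by
    rw [Ne, ENNReal.rpow_eq_zero_iff]
    rintro (h | h)
    · exact hP0 h.1
    · exact ENNReal.ofReal_ne_top h.1
  rw [momentSum_smul hq _ hP0]
  refine ⟨mul_ne_zero hPq0 hm0, ENNReal.mul_ne_top hPT hmT, ?_⟩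
  rw [ENNReal.toReal_mul, ← ENNReal.toReal_rpow, ENNReal.toReal_ofReal (Real.exp_pos _).le,
    Real.log_mul (Real.rpow_pos_of_pos (Real.exp_pos _) q).ne' (ENNReal.toReal_pos hm0 hmT).ne',
    Real.log_rpow (Real.exp_pos _), Real.log_exp]
  have e1 := log_toReal_le_of_le_mul hm0 hne.1 hne.2 hAT h1
  have e2 := log_toReal_le_of_le_mul hne.1 hm0 hmT hAT h2
  -- The long side is at least c δ, so the rescaled mesh size may exceed 1 but not 1/c. This is why
  -- scales up to D = 1/c were needed.
  have hD : δ / |G.wordScale j w| ≤ 1 / c := by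
    rw [← Real.log_le_log_iff hδ' (by positivity), hlogδ', one_div, Real.log_inv]
    linarith
  have e3 := abs_le.1 (hK₁ v _ hδ' hD)
  rw [hlogδ'] at e3
  have hlogc := Real.log_nonpos hc.le hc1
  have hlogδ := Real.log_nonpos hδ.le hδ1
  have e4 : |Real.log δ - G.logSide j w| ≤ -Real.log δ - Real.log c := by
    rw [abs_le]
    constructor <;> linarith
  have e5 := mul_le_mul_of_nonneg_left e4 hε.le
  -- The short side lies in [c δ, δ]; replacing it by δ in the power s - t costs a constant.
  have e6 : |(s - t) * (G.logSide j' w - Real.log δ)| ≤ |s - t| * (-Real.log c) := by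
    rw [abs_mul]
    refine mul_le_mul_of_nonneg_left ?_ (abs_nonneg _)
    rw [abs_le]
    constructor <;> linarith
  rw [abs_le] at e6 ⊢
  constructor <;> nlinarith [e1, e2, e3.1, e3.2, e6.1, e6.2, e5]

/-- Joins the two orientations of the rectangle and removes the logarithm, so that the bounds can be
summed over a section. -/
theorem IsMeasureFamily.exists_word_error [Nonempty E] (hdiag : ∀ e, (G.T e).IsDiag)
    (hrosc : G.ROSC) (hp : G.IsProbVector p) (hμ : G.IsMeasureFamily p μ) (hq : 0 ≤ q)
    {α β : ℝ} (hα : ∀ v, HasLqSpectrum (projMeasure (μ v) 0) q α)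
    (hβ : ∀ v, HasLqSpectrum (projMeasure (μ v) 1) q β)
    (s : ℝ) {ε c : ℝ} (hε : 0 < ε) (hc : 0 < c) (hc1 : c ≤ 1) :
    ∃ K, ∀ v w δ, 0 < δ → δ ≤ 1 → c * δ ≤ min |G.wordScale 0 w| |G.wordScale 1 w| →
      min |G.wordScale 0 w| |G.wordScale 1 w| ≤ δ →
      momentSum (ENNReal.ofReal (Real.exp (logP p w)) • (μ v).map (G.wordMap w)) q δ ≠ ⊤ ∧
      G.wordPhi p q α β s w * Real.exp (-s * Real.log δ - (ε * (-Real.log δ) + K)) ≤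
        (momentSum (ENNReal.ofReal (Real.exp (logP p w)) • (μ v).map (G.wordMap w)) q δ).toReal ∧
      (momentSum (ENNReal.ofReal (Real.exp (logP p w)) • (μ v).map (G.wordMap w)) q δ).toReal ≤
        G.wordPhi p q α β s w * Real.exp (-s * Real.log δ + (ε * (-Real.log δ) + K)) := by
  obtain ⟨K₀, hK₀⟩ := hμ.exists_axis_error hdiag hrosc hp hq (j := 0) (j' := 1) (by decide) hα s
    hε hc hc1
  obtain ⟨K₁, hK₁⟩ := hμ.exists_axis_error hdiag hrosc hp hq (j := 1) (j' := 0) (by decide) hβ s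
    hε hc hc1
  refine ⟨max K₀ K₁, fun v w δ hδ hδ1 hlow hup => ?_⟩
  have hneg : G.logA w ≤ 0 ∧ G.logB w ≤ 0 := by
    obtain ⟨c', hc', C', -, h⟩ := G.exists_log_bounds
    have hn : (0 : ℝ) ≤ w.length := Nat.cast_nonneg _
    have hA := wsum_bounds (l := fun e => Real.log (G.a e)) (c := -C') (C := -c')
      (fun e => ⟨by linarith [(h e).1.2], by linarith [(h e).1.1]⟩) w
    have hB := wsum_bounds (l := fun e => Real.log (G.b e)) (c := -C') (C := -c')
      (fun e => ⟨by linarith [(h e).2.2], by linarith [(h e).2.1]⟩) w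
    exact ⟨hA.2.trans (by nlinarith), hB.2.trans (by nlinarith)⟩
  rw [abs_wordScale hdiag, abs_wordScale hdiag, logSide_zero hdiag, logSide_one hdiag] at hlow hup
  have hmin : min (Real.exp (G.logA w)) (Real.exp (G.logB w)) =
      Real.exp (min (G.logA w) (G.logB w)) := (Real.exp_monotone.map_min).symm
  rw [hmin] at hlow hup
  rw [← Real.log_le_iff_le_exp (by positivity), Real.log_mul hc.ne' hδ.ne'] at hlow
  rw [← Real.le_log_iff_exp_le hδ] at hup
  suffices h : ∃ M, M = momentSum (ENNReal.ofReal (Real.exp (logP p w)) •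
      (μ v).map (G.wordMap w)) q δ ∧ M ≠ 0 ∧ M ≠ ⊤ ∧
      |Real.log M.toReal - (Real.log (G.wordPhi p q α β s w) - s * Real.log δ)| ≤
        ε * (-Real.log δ) + max K₀ K₁ by
    obtain ⟨M, rfl, h0, hT, h⟩ := h
    have hpos := ENNReal.toReal_pos h0 hT
    have hφ : 0 < G.wordPhi p q α β s w := Real.exp_pos _
    rw [abs_le] at h
    refine ⟨hT, ?_, ?_⟩
    · rw [← Real.log_le_log_iff (by positivity) hpos, Real.log_mul hφ.ne' (Real.exp_pos _).ne',
        Real.log_exp]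
      linarith
    · rw [← Real.log_le_log_iff hpos (by positivity), Real.log_mul hφ.ne' (Real.exp_pos _).ne',
        Real.log_exp]
      linarith
  refine ⟨_, rfl, ?_⟩
  rw [wordPhi, Real.log_exp]
  split_ifs with h
  · rw [min_eq_right h] at hlow hup
    rw [← logSide_zero hdiag, ← logSide_one hdiag] at *
    obtain ⟨h0, hT, h3⟩ := hK₀ v w δ hδ hδ1 h hneg.1 hlow hup
    refine ⟨h0, hT, le_trans (le_of_eq ?_) (h3.trans (by linarith [le_max_left K₀ K₁]))⟩
    congr 2
    ring
  · rw [not_le] at h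
    rw [min_eq_left h.le] at hlow hup
    rw [← logSide_zero hdiag, ← logSide_one hdiag] at *
    obtain ⟨h0, hT, h3⟩ := hK₁ v w δ hδ hδ1 h.le hneg.2 hlow hup
    refine ⟨h0, hT, le_trans (le_of_eq ?_) (h3.trans (by linarith [le_max_right K₀ K₁]))⟩
    congr 2
    ring

/-- The spectrum of the planar measures is the zero of the growth rate. -/
theorem IsMeasureFamily.hasLqSpectrum_of_growthRate_eq_zero [DecidableEq E] [Nonempty V]
    (hdiag : ∀ e, (G.T e).IsDiag) (hconn : G.StronglyConnected) (hrosc : G.ROSC)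
    (hp : G.IsProbVector p) (hμ : G.IsMeasureFamily p μ) (hq : 0 ≤ q)
    {α β : ℝ} (hα : ∀ v, HasLqSpectrum (projMeasure (μ v) 0) q α)
    (hβ : ∀ v, HasLqSpectrum (projMeasure (μ v) 1) q β) {s : ℝ}
    (hs : G.growthRate hp.1 hconn q α β s = 0) (v : V) : HasLqSpectrum (μ v) q s := by
  have := hconn.nonempty_edge
  obtain ⟨⟨C, hC⟩, hlow, -⟩ := (G.exists_growth_rate hp.1 hconn q α β s).choose_spec
  rw [growthRate] at hs
  rw [hs] at hC hlow
  obtain ⟨c, hc, hc1, hsec⟩ := exists_min_side_section hdiag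
  have hlogc := Real.log_nonpos hc.le hc1
  obtain ⟨c₀, hc₀, C₀, hC₀, hlog⟩ := G.exists_log_bounds
  obtain ⟨N, hN⟩ := exists_packing_bound hdiag hrosc hc
  refine tendsto_div_neg_log_of_forall_error fun ε hε => ?_
  obtain ⟨K, hK⟩ := hμ.exists_word_error hdiag hrosc hp hq hα hβ s (half_pos hε) hc hc1
  -- Word lengths will be at most (-log δ - log c)/c₀, so a loss of c₀ ε/2 per edge is a loss of ε/2
  -- per unit of -log δ.
  obtain ⟨c', hc', k₀, hk₀⟩ := hlow (ε / 2 * c₀) (by positivity)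
  refine ⟨|Real.log ((N : ENNReal) ^ q).toReal| + |Real.log N| + |Real.log C| + |Real.log c'| +
    |K| + ε / 2 * (-Real.log c), ?_⟩
  -- For δ this small all words of the section have length at least k₀.
  filter_upwards [tendsto_neg_log_nhdsGT_zero.eventually_ge_atTop (C₀ * k₀),
    self_mem_nhdsWithin, nhdsWithin_le_nhds (gt_mem_nhds one_pos)] with δ hδk hδ hδ1
  have hδ : 0 < δ := hδ
  have hδ1 : δ < 1 := hδ1
  obtain ⟨S, hS, hside⟩ := hsec δ hδ hδ1.le v
  set m : List E → Measure (Fin 2 → ℝ) := fun w => ENNReal.ofReal (Real.exp (logP p w)) •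
      (μ (G.wordEnd v w)).map (G.wordMap w) with hm
  have hμv : μ v = ∑ w ∈ S, m w := hS.measure_eq hdiag hp.1 hμ
  have hword : ∀ w ∈ S, _ := fun w hw =>
    hK (G.wordEnd v w) w δ hδ hδ1.le (hside w hw).1 (hside w hw).2
  obtain ⟨h1, h2⟩ := momentSum_sum hq S m (δ := δ) (N := N) fun k => by
    obtain ⟨S', hcard, hmem⟩ := hN δ hδ v S hS (fun w hw j => (hside w hw).1.trans (by
      fin_cases j
      · exact min_le_left _ _
      · exact min_le_right _ _)) k
    refine ⟨S', hcard, fun w hw hne => hmem w hw ?_⟩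
    by_contra hcon
    push Not at hcon
    refine hne ?_
    simp only [hm, Measure.smul_apply, smul_eq_mul]
    rw [Measure.map_apply (measurable_wordMap hdiag w) (measurableSet_meshCube δ k),
      measure_mono_null _ (hμ.unitSquare hdiag hrosc hp (G.wordEnd v w)), mul_zero]
    exact fun ξ hξ hmem => hcon ξ hmem hξ
  rw [← hμv] at h1 h2
  have hXT : ∑ w ∈ S, momentSum (m w) q δ ≠ ⊤ :=
    ENNReal.sum_ne_top.2 fun w hw => (hword w hw).1
  have hXreal : (∑ w ∈ S, momentSum (m w) q δ).toReal = ∑ w ∈ S, (momentSum (m w) q δ).toReal :=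
    ENNReal.toReal_sum fun w hw => (hword w hw).1
  have hsides : ∀ w ∈ S, c₀ * w.length ≤ -Real.log δ - Real.log c ∧ k₀ ≤ w.length := by
    intro w hw
    have hA := wsum_bounds (l := fun e => Real.log (G.a e)) (c := -C₀) (C := -c₀)
      (fun e => ⟨by linarith [(hlog e).1.2], by linarith [(hlog e).1.1]⟩) w
    have hB := wsum_bounds (l := fun e => Real.log (G.b e)) (c := -C₀) (C := -c₀)
      (fun e => ⟨by linarith [(hlog e).2.2], by linarith [(hlog e).2.1]⟩) w
    change -C₀ * w.length ≤ G.logA w ∧ G.logA w ≤ -c₀ * w.length at hA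
    change -C₀ * w.length ≤ G.logB w ∧ G.logB w ≤ -c₀ * w.length at hB
    obtain ⟨h3, h4⟩ := hside w hw
    rw [abs_wordScale hdiag, abs_wordScale hdiag, logSide_zero hdiag, logSide_one hdiag] at h3 h4
    have h5 := h3.trans (min_le_left _ _)
    rw [← Real.log_le_iff_le_exp (by positivity), Real.log_mul hc.ne' hδ.ne'] at h5
    refine ⟨by linarith, ?_⟩
    have h6 : -C₀ * w.length ≤ Real.log δ := by
      rcases min_le_iff.1 h4 with h | h <;> rw [← Real.le_log_iff_exp_le hδ] at h
      · exact hA.1.trans h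
      · exact hB.1.trans h
    have h7 : C₀ * (k₀ : ℝ) ≤ C₀ * w.length := by linarith
    exact_mod_cast le_of_mul_le_mul_left h7 hC₀
  set X := (∑ w ∈ S, momentSum (m w) q δ).toReal with hX
  have hlower : c' * Real.exp (-(ε / 2) * (-Real.log δ - Real.log c)) *
      Real.exp (-s * Real.log δ - (ε / 2 * (-Real.log δ) + K)) ≤ X := by
    have h3 := hk₀ v S hS fun w hw => (hsides w hw).2
    have h4 : c' * Real.exp (-(ε / 2) * (-Real.log δ - Real.log c)) ≤
        ∑ w ∈ S, G.wordPhi p q α β s w := by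
      refine (mul_le_mul_of_nonneg_right h3 (Real.exp_pos _).le).trans ?_
      rw [Finset.sum_mul]
      refine Finset.sum_le_sum fun w hw => ?_
      rw [mul_assoc, ← Real.exp_add]
      refine mul_le_of_le_one_right (Real.exp_pos _).le (Real.exp_le_one_iff.2 ?_)
      nlinarith [mul_le_mul_of_nonneg_left (hsides w hw).1 (half_pos hε).le]
    refine (mul_le_mul_of_nonneg_right h4 (Real.exp_pos _).le).trans ?_
    rw [hXreal, Finset.sum_mul]
    exact Finset.sum_le_sum fun w hw => (hword w hw).2.1
  have hupper : X ≤ C * Real.exp (-s * Real.log δ + (ε / 2 * (-Real.log δ) + K)) := by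
    have h3 := hC v S hS
    simp only [neg_zero, zero_mul, Real.exp_zero, mul_one] at h3
    refine le_trans ?_ (mul_le_mul_of_nonneg_right h3 (Real.exp_pos _).le)
    rw [hXreal, Finset.sum_mul]
    exact Finset.sum_le_sum fun w hw => (hword w hw).2.2
  have hX0 : 0 < X := lt_of_lt_of_le (by positivity) hlower
  have hC0 : 0 < C := pos_of_mul_pos_left (hX0.trans_le hupper) (Real.exp_pos _).le
  have hXne : ∑ w ∈ S, momentSum (m w) q δ ≠ 0 := fun h => by
    rw [hX, h] at hX0
    simp at hX0
  have hNqT : (N : ENNReal) ^ q ≠ ⊤ := ENNReal.rpow_ne_top_of_nonneg hq (ENNReal.natCast_ne_top _)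
  have hMT : momentSum (μ v) q δ ≠ ⊤ :=
    (h1.trans_lt (ENNReal.mul_lt_top hNqT.lt_top hXT.lt_top)).ne
  have hM0 : momentSum (μ v) q δ ≠ 0 := fun h => by
    rw [h, mul_zero] at h2
    exact hXne (le_antisymm h2 zero_le)
  have e1 := log_toReal_le_of_le_mul hM0 hXne hXT hNqT h1
  have e2 := log_toReal_le_of_le_mul hXne hM0 hMT (ENNReal.natCast_ne_top _) h2
  rw [ENNReal.toReal_natCast, ← hX] at e2
  rw [← hX] at e1
  have e3 := Real.log_le_log (by positivity) hlower
  rw [Real.log_mul (by positivity) (Real.exp_pos _).ne', Real.log_mul hc'.ne' (Real.exp_pos _).ne',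
    Real.log_exp, Real.log_exp] at e3
  have e4 := Real.log_le_log hX0 hupper
  rw [Real.log_mul hC0.ne' (Real.exp_pos _).ne', Real.log_exp] at e4
  have a1 := abs_le.1 (le_refl |Real.log ((N : ENNReal) ^ q).toReal|)
  have a2 := abs_le.1 (le_refl |Real.log N|)
  have a3 := abs_le.1 (le_refl |Real.log C|)
  have a4 := abs_le.1 (le_refl |Real.log c'|)
  have a5 := abs_le.1 (le_refl |K|)
  have a6 : 0 ≤ ε / 2 * (-Real.log c) := mul_nonneg (half_pos hε).le (neg_nonneg.2 hlogc)
  have a7 : 0 ≤ ε / 2 * (-Real.log δ) :=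
    mul_nonneg (half_pos hε).le (neg_nonneg.2 (Real.log_nonpos hδ.le hδ1.le))
  rw [abs_le]
  constructor <;> linarith

end BoxLikeGIFS

end

noncomputable section

/-! ### The pressure -/

theorem HasLqSpectrum.lqSpectrum_eq {n : ℕ} {ν : Measure (Fin n → ℝ)} {q τ : ℝ}
    (h : HasLqSpectrum ν q τ) : lqSpectrum ν q = τ :=
  Tendsto.limUnder_eq h

namespace BoxLikeGIFS

/-- The singular values of an invertible diagonal matrix. -/
theorem singVal_of_isDiag {T : Matrix (Fin 2) (Fin 2) ℝ} (hT : T.IsDiag) (h0 : T 0 0 ≠ 0)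
    (h1 : T 1 1 ≠ 0) :
    singVal T 0 = max |T 0 0| |T 1 1| ∧ singVal T 1 = min |T 0 0| |T 1 1| := by
  have h01 : T 0 1 = 0 := hT (by decide)
  have h10 : T 1 0 = 0 := hT (by decide)
  -- Squared singular values are eigenvalues of T*T, which is diagonal with entries T_ii².
  have heig : ∀ n < 2, singVal T n = |T 0 0| ∨ singVal T n = |T 1 1| := by
    intro n hn
    have h := (Matrix.toEuclideanLin T).hasEigenvalue_adjoint_comp_self_sq_singularValues
      (n := n) (by simpa using hn)
    obtain ⟨x, hx⟩ := h.exists_hasEigenvector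
    have hx1 := hx.apply_eq_smul
    rw [← Matrix.toEuclideanLin_conjTranspose_eq_adjoint, LinearMap.comp_apply] at hx1
    have hc : ∀ i, T i i * (T i i * x i) = singVal T n ^ 2 * x i := by
      intro i
      have := congrArg (fun z : EuclideanSpace ℝ (Fin 2) => z i) hx1
      simp only [Matrix.toLpLin_apply, Matrix.mulVec, dotProduct, Fin.sum_univ_two,
        Matrix.conjTranspose_apply, star_trivial] at this
      fin_cases i <;> simpa [h01, h10, singVal] using this
    have hx2 : x 0 ≠ 0 ∨ x 1 ≠ 0 := by
      by_contra hcon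
      push Not at hcon
      refine hx.2 ?_
      ext i
      fin_cases i
      · exact hcon.1
      · exact hcon.2
    have hnn : 0 ≤ singVal T n := LinearMap.singularValues_nonneg _ n
    have hsq : ∀ i, x i ≠ 0 → singVal T n = |T i i| := by
      intro i hi
      have h2 : singVal T n ^ 2 = T i i ^ 2 := mul_right_cancel₀ hi (by rw [← hc i]; ring)
      rw [← abs_of_nonneg hnn]
      exact (sq_eq_sq_iff_abs_eq_abs _ _).1 h2
    exact hx2.imp (hsq 0) (hsq 1)
  have hanti : singVal T 1 ≤ singVal T 0 :=
    (Matrix.toEuclideanLin T).singularValues_antitone (Nat.zero_le 1)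
  -- The product is |det T|; it settles the case in which both singular values were matched with the
  -- same entry.
  have hprod : singVal T 0 * singVal T 1 = |T 0 0| * |T 1 1| := by
    have h2 := (Matrix.toEuclideanLin T).normDet_eq_prod_singularValues
    have hdet : LinearMap.det (Matrix.toEuclideanLin T) = T.det := by
      rw [show Matrix.toEuclideanLin T = Matrix.toLin (PiLp.basisFun 2 ℝ (Fin 2))
        (PiLp.basisFun 2 ℝ (Fin 2)) T by rw [← Matrix.toLpLin_eq_toLin], LinearMap.det_toLin]
    rw [LinearMap.normDet_eq_norm_det, hdet, finrank_euclideanSpace_fin, Finset.prod_range_succ,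
      Finset.prod_range_one, Matrix.det_fin_two, h01, zero_mul, sub_zero, Real.norm_eq_abs,
      abs_mul] at h2
    exact h2.symm
  have hp0 := abs_pos.2 h0
  have hp1 := abs_pos.2 h1
  rcases heig 0 (by norm_num) with e0 | e0 <;> rcases heig 1 (by norm_num) with e1 | e1 <;>
    rw [e0, e1] at hanti hprod ⊢
  · have : |T 0 0| = |T 1 1| := mul_left_cancel₀ hp0.ne' hprod
    rw [this]; simp
  · rw [max_eq_left hanti, min_eq_right hanti]; exact ⟨rfl, rfl⟩
  · rw [max_eq_right hanti, min_eq_left hanti]; exact ⟨rfl, rfl⟩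
  · have : |T 1 1| = |T 0 0| := mul_right_cancel₀ hp1.ne' hprod
    rw [this]; simp

variable {V E : Type*} {G : BoxLikeGIFS V E}

theorem isDiag_wordT (hdiag : ∀ e, (G.T e).IsDiag) {k : ℕ} (w : Fin k → E) :
    (G.wordT w).IsDiag ∧ ∀ j, G.wordT w j j = G.wordScale j (List.ofFn w) := by
  have key : ∀ l : List E, (l.map G.T).prod.IsDiag ∧
      ∀ j, (l.map G.T).prod j j = G.wordScale j l := by
    intro l
    induction l with
    | nil => exact ⟨Matrix.isDiag_one, fun j => by simp [wordScale]⟩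
    | cons e l ih =>
      rw [List.map_cons, List.prod_cons]
      refine ⟨fun i j hij => ?_, fun j => ?_⟩
      · change (G.T e * (l.map G.T).prod) i j = 0
        rw [Matrix.mul_apply]
        refine Finset.sum_eq_zero fun m _ => ?_
        rcases eq_or_ne i m with rfl | h
        · rw [ih.1 hij, mul_zero]
        · rw [hdiag e h, zero_mul]
      have h : ∀ i, i ≠ j → G.T e j i * (l.map G.T).prod i j = 0 := fun i hi => by
        rw [hdiag e hi.symm, zero_mul]
      rw [Matrix.mul_apply, Finset.sum_eq_single j (fun i _ hi => h i hi) (by simp), ih.2 j]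
      simp [wordScale]
  have := key (List.ofFn w)
  rwa [List.map_ofFn] at this

theorem side_of_isDiag {T : Matrix (Fin 2) (Fin 2) ℝ} (hT : T.IsDiag) (j : Fin 2) :
    side T j = |T j j| := by
  fin_cases j
  · simp [side, hT (show (0 : Fin 2) ≠ 1 by decide)]
  · simp [side, hT (show (1 : Fin 2) ≠ 0 by decide)]

/-- For diagonal linear parts the singular values are the side lengths. Ties are broken alike:
`longAxis` and `wordPhi` both choose the x-axis. -/
theorem phi_eq_wordPhi (hdiag : ∀ e, (G.T e).IsDiag) {p : E → ℝ} (hp : ∀ e, 0 < p e)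
    {μ : V → Measure (Fin 2 → ℝ)} {q α β : ℝ}
    (hα : ∀ v, HasLqSpectrum (projMeasure (μ v) 0) q α)
    (hβ : ∀ v, HasLqSpectrum (projMeasure (μ v) 1) q β) (s : ℝ) {k : ℕ} (w : Fin (k + 1) → E) :
    G.phi p μ s q w = G.wordPhi p q α β s (List.ofFn w) := by
  obtain ⟨hT, hentry⟩ := isDiag_wordT hdiag w
  have habs : ∀ j, |G.wordT w j j| = Real.exp (G.logSide j (List.ofFn w)) := fun j => by
    rw [hentry, abs_wordScale hdiag]
  have hne : ∀ j, G.wordT w j j ≠ 0 := fun j => by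
    rw [← abs_pos, habs]; exact Real.exp_pos _
  obtain ⟨h0, h1⟩ := singVal_of_isDiag hT (hne 0) (hne 1)
  rw [habs, habs, logSide_zero hdiag, logSide_one hdiag] at h0 h1
  have hP : ∏ i, p (w i) = Real.exp (logP p (List.ofFn w)) := by
    rw [logP, wsum, List.map_ofFn, List.sum_ofFn, Real.exp_sum]
    exact Finset.prod_congr rfl fun i _ => (Real.exp_log (hp _)).symm
  have hlong : longAxis (G.wordT w) =
      if G.logB (List.ofFn w) ≤ G.logA (List.ofFn w) then 0 else 1 := by
    rw [longAxis, if_pos hT, side_of_isDiag hT, side_of_isDiag hT, habs, habs, logSide_zero hdiag,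
      logSide_one hdiag]
    simp only [Real.exp_le_exp]
  rw [phi, wordTau, hlong, h0, h1, hP, wordPhi]
  split_ifs with h
  · rw [(hα _).lqSpectrum_eq, max_eq_left (Real.exp_le_exp.2 h), min_eq_right (Real.exp_le_exp.2 h),
      ← Real.exp_mul, ← Real.exp_mul, ← Real.exp_mul, ← Real.exp_add, ← Real.exp_add]
    congr 1
    ring
  · have h := (not_le.1 h).le
    rw [(hβ _).lqSpectrum_eq, max_eq_right (Real.exp_le_exp.2 h), min_eq_left (Real.exp_le_exp.2 h),
      ← Real.exp_mul, ← Real.exp_mul, ← Real.exp_mul, ← Real.exp_add, ← Real.exp_add]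
    congr 1
    ring

theorem isPath_ofFn {k : ℕ} (v : V) (w : Fin (k + 1) → E) :
    G.IsPath v (List.ofFn w) ↔ G.Admissible w ∧ G.src (w 0) = v := by
  induction k generalizing v with
  | zero => simp [IsPath, Admissible]
  | succ k ih =>
    rw [List.ofFn_succ, IsPath, ih, Admissible, Admissible, Fin.forall_fin_succ]
    constructor
    · rintro ⟨h1, h2, h3⟩
      exact ⟨⟨h3.symm, h2⟩, h1⟩
    · rintro ⟨⟨h3, h2⟩, h1⟩
      exact ⟨h1, h2, h3.symm⟩

variable [Fintype V] [DecidableEq V] [Fintype E]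

/-- The entries are nonnegative, and summing over the terminal vertex undoes the grouping of the
words. -/
theorem sum_abs_modMatrix (hdiag : ∀ e, (G.T e).IsDiag) {p : E → ℝ} (hp : ∀ e, 0 < p e)
    {μ : V → Measure (Fin 2 → ℝ)} {q α β : ℝ}
    (hα : ∀ v, HasLqSpectrum (projMeasure (μ v) 0) q α)
    (hβ : ∀ v, HasLqSpectrum (projMeasure (μ v) 1) q β) (s : ℝ) (k : ℕ) :
    ∑ v, ∑ v', |G.modMatrix p μ s q (k + 1) v v'| = G.levelSum p q α β s (k + 1) := by
  classical
  refine Finset.sum_congr rfl fun v _ => ?_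
  have h1 : ∀ v', |G.modMatrix p μ s q (k + 1) v v'| = ∑ w : Fin (k + 1) → E with
      (G.Admissible w ∧ G.src (w 0) = v) ∧ G.tgt (w (Fin.last k)) = v',
        G.wordPhi p q α β s (List.ofFn w) := by
    intro v'
    rw [modMatrix, Matrix.of_apply]
    simp only [phi_eq_wordPhi hdiag hp hα hβ, and_assoc]
    have hpos : ∀ l, 0 ≤ G.wordPhi p q α β s l := fun l => (Real.exp_pos _).le
    rw [abs_of_nonneg (Finset.sum_nonneg fun w _ => hpos (List.ofFn w))]
    congr!
  simp only [h1, ← Finset.filter_filter]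
  rw [Finset.sum_fiberwise]
  refine Finset.sum_nbij List.ofFn (fun w hw => ?_) (fun w _ w' _ h => List.ofFn_injective h)
    (fun l hl => ?_) fun _ _ => rfl
  · rw [mem_levelWords, List.length_ofFn, isPath_ofFn]
    simpa using hw
  · obtain ⟨hlen, hpath⟩ := G.mem_levelWords.1 hl
    have key : ∀ n, l.length = n → ∃ w : Fin n → E, List.ofFn w = l := by
      rintro _ rfl
      exact ⟨l.get, List.ofFn_get l⟩
    obtain ⟨w, rfl⟩ := key _ hlen
    rw [isPath_ofFn] at hpath
    exact ⟨w, by simpa using hpath, rfl⟩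

/-- The pressure exists and is the exponential of the growth rate. -/
theorem tendsto_pressureSeq [DecidableEq E] [Nonempty V] (hdiag : ∀ e, (G.T e).IsDiag)
    (hconn : G.StronglyConnected) {p : E → ℝ} (hp : ∀ e, 0 < p e)
    {μ : V → Measure (Fin 2 → ℝ)} {q α β : ℝ}
    (hα : ∀ v, HasLqSpectrum (projMeasure (μ v) 0) q α)
    (hβ : ∀ v, HasLqSpectrum (projMeasure (μ v) 1) q β) (s : ℝ) :
    Tendsto (G.pressureSeq p μ s q) atTop
      (𝓝 (Real.exp (G.growthRate hp hconn q α β s))) := by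
  refine ((Real.continuous_exp.tendsto _).comp
    (G.tendsto_log_levelSum hp hconn q α β s)).congr' ?_
  filter_upwards [eventually_ge_atTop 1] with k hk
  obtain ⟨k, rfl⟩ := Nat.exists_eq_add_of_le' hk
  rw [pressureSeq, sum_abs_modMatrix hdiag hp hα hβ, Function.comp_apply,
    Real.rpow_def_of_pos (G.levelSum_pos hconn p q α β s (k + 1))]
  congr 1
  ring

end BoxLikeGIFS

end

/-! ### Proof of the theorem. -/

theorem theorem2p3 {V E : Type*} [Fintype V] [DecidableEq V] [Nonempty V]
    [Fintype E] [DecidableEq E]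
    (G : BoxLikeGIFS V E) (hconn : G.StronglyConnected) (hrosc : G.ROSC)
    (hdiag : ∀ e, (G.T e).IsDiag)
    (p : E → ℝ) (hp : G.IsProbVector p)
    (μ : V → MeasureTheory.Measure (Fin 2 → ℝ)) (hμ : G.IsMeasureFamily p μ)
    (q : ℝ) (hq : 0 ≤ q) :
    ∃ (τA τB γA γB γ : ℝ) (Y : ℝ → ℝ) (f : ℝ → E → ℝ),
      -- `τA`, `τB` are the common values of the spectra of the projections onto the two axes
      (∀ v, HasLqSpectrum (projMeasure (μ v) 0) q τA) ∧
      (∀ v, HasLqSpectrum (projMeasure (μ v) 1) q τB) ∧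
      -- `γA`, `γB` are the unique solutions of their defining equations
      (∀ s, specRadius (G.F p q τA (s - τA)) = 1 ↔ s = γA) ∧
      (∀ s, specRadius (G.F p q (s - τB) τB) = 1 ↔ s = γB) ∧
      -- `Y x` is the unique `y` with `ρ(F x y) = 1`; `f x` is the product of the Perron vectors
      (∀ x y, specRadius (G.F p q x y) = 1 ↔ y = Y x) ∧
      (∀ x g, IsPerronProduct (G.F p q x (Y x)) g ↔ g = f x) ∧
      -- the pressure exists, `γ` is the unique `s` where it is `1`, and the spectrum of every `μ v`
      (∀ s, Filter.Tendsto (G.pressureSeq p μ s q) Filter.atTop (nhds (G.pressure p μ s q))) ∧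
      (∀ s, G.pressure p μ s q = 1 ↔ s = γ) ∧
      (∀ v, HasLqSpectrum (μ v) q γ) ∧
      -- the dichotomy
      (max γA γB ≤ τA + τB ∨ τA + τB ≤ min γA γB) ∧
      -- (a)
      (max γA γB ≤ τA + τB →
        γ = max γA γB ∧
        IsGreatest {s | ∃ x y, specRadius (G.F p q x y) = 1 ∧
          γB - τB ≤ x ∧ x ≤ τA ∧ s = x + y} γ ∧
        IsGreatest {s | ∃ x y, specRadius (G.F p q x y) = 1 ∧
          γA - τA ≤ y ∧ y ≤ τB ∧ s = x + y} γ) ∧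
      -- (b)
      (τA + τB ≤ min γA γB →
        IsLeast {s | ∃ x y, specRadius (G.F p q x y) = 1 ∧
          τA ≤ x ∧ x ≤ γB - τB ∧ s = x + y} γ ∧
        IsLeast {s | ∃ x y, specRadius (G.F p q x y) = 1 ∧
          τB ≤ y ∧ y ≤ γA - τA ∧ s = x + y} γ ∧
        -- (b1)
        (0 ≤ ∑ e, f τA e * Real.log (G.a e / G.b e) → γ = γA) ∧
        -- (b2)
        (∑ e, f (γB - τB) e * Real.log (G.a e / G.b e) ≤ 0 → γ = γB) ∧
        -- (b3)
        (¬ 0 ≤ ∑ e, f τA e * Real.log (G.a e / G.b e) →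
          ¬ ∑ e, f (γB - τB) e * Real.log (G.a e / G.b e) ≤ 0 →
          ∃ x ∈ Set.Icc τA (γB - τB), ∃ y ∈ Set.Icc τB (γA - τA),
            specRadius (G.F p q x y) = 1 ∧
            ∑ e, f x e * Real.log (G.a e / G.b e) = 0 ∧ γ = x + y)) := by
  obtain ⟨τA, hτA⟩ := hμ.exists_hasLqSpectrum_proj hdiag hconn hrosc hp hq 0
  obtain ⟨τB, hτB⟩ := hμ.exists_hasLqSpectrum_proj hdiag hconn hrosc hp hq 1
  obtain ⟨γA, γB, γ, Y, f, hγA, hγB, hY, hf, hγ, hrest⟩ :=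
    G.exists_variational_formula hp.1 hconn q τA τB
  have hlim := fun s => BoxLikeGIFS.tendsto_pressureSeq hdiag hconn hp.1 hτA hτB s
  have hpress : ∀ s, G.pressure p μ s q = Real.exp (G.growthRate hp.1 hconn q τA τB s) :=
    fun s => (hlim s).limUnder_eq
  refine ⟨τA, τB, γA, γB, γ, Y, f, hτA, hτB, hγA, hγB, hY, hf, fun s => ?_, fun s => ?_,
    hμ.hasLqSpectrum_of_growthRate_eq_zero hdiag hconn hrosc hp hq hτA hτB ((hγ γ).2 rfl), hrest⟩
  · rw [hpress]
    exact hlim s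
  · rw [hpress, Real.exp_eq_one_iff]
    exact hγ s
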